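/- There is a randomized algorithm with the following properties. Its input consists of integers $k\ge 2$ and $n,m\ge 1$, of $k$ lists $w^1,\dots,w^k\in[m]^n$, where $[m]=\{1,\dots,m\}$ (read-only, with random access), and of a target $t\in\{0,\dots,km\}$ (no other integer target is a sum of $k$ elements of $[m]$). For every constant $k\ge 2$, and for all $n,m$ with $n\le m\le \mathrm{poly}(n)$ and $n\mid m$: 1. On all lists $w^1,\dots,w^k\in[m]^n$, all targets $t\in\{0,\dots,km\}$ and all outcomes of its coin tosses, the algorithm stops within $\tilde O(n^{k-1/2})$ time and uses $O(\log n)$ bits of working memory ($O(1+\log n)$ if $n=1$ is included). 2. If $w^1,\dots,w^k$ are independent and uniformly random in $[m]^n$, and the target $t=t(w^1,\dots,w^k)$ is chosen by an adversary, as an arbitrary function of the lists, then with probability at least a constant $c>0$ (over the lists and the coin tosses) the following holds: if there are $s_1\in w^1,\dots,s_k\in w^k$ with $\sum_{i=1}^k s_i=t$, then the algorithm outputs such $s_1,\dots,s_k$. Here $\mathrm{poly}(n)$ is $An^D$ for arbitrary constants $A,D$; the constant $c$ depends only on $k$, and the constants hidden in $\tilde O$ (which suppresses factors polylogarithmic in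 $n$) and $O$ depend only on $k,A,D$. The algorithm tosses fair coins while it runs; a coin toss that it wants to use again has to be kept in its working memory, so there is no random-access tape of random bits. -/

import Mathlib

namespace KSum

/-- `k` lists of `n` integers each, every integer from `[m] = {1, …, m}`; the element `v` of
`Fin m` stands for the integer `v + 1`. -/
abbrev Lists (k n m : ℕ) : Type := Fin k → Fin n → Fin m

/-- The integer in position `j` of the `i`-th list. -/
def value {k n m : ℕ} (w : Lists k n m) (i : Fin k) (j : Fin n) : ℕ := (w i j : ℕ) + 1

/-- `s` is a solution: `s i` is an element of the `i`-th list, and the `s i` add up to `t`. -/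
def IsSolution {k n m : ℕ} (w : Lists k n m) (t : ℕ) (s : Fin k → ℕ) : Prop :=
  (∀ i, ∃ j, s i = value w i j) ∧ ∑ i, s i = t

/-- Some solution exists. -/
def Solvable {k n m : ℕ} (w : Lists k n m) (t : ℕ) : Prop := ∃ s, IsSolution w t s

/-- Instructions of a randomized random-access machine with `R` registers, which hold natural
numbers. `d` is the destination register, `a` and `b` are operands, `l` is a line of the code. -/
inductive Instr (R : ℕ) : Type
  /-- `d := v` -/
  | const (d : Fin R) (v : ℕ)
  /-- `d := a` -/
  | copy (d a : Fin R)
  /-- `d := a + b` -/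
  | add (d a b : Fin R)
  /-- `d := max (a - b) 0` -/
  | sub (d a b : Fin R)
  /-- `d := a * b` -/
  | mul (d a b : Fin R)
  /-- `d := ⌊a / b⌋` -/
  | div (d a b : Fin R)
  /-- `d := a mod b` -/
  | mod (d a b : Fin R)
  /-- `d :=` the number `k` of lists -/
  | arity (d : Fin R)
  /-- `d :=` the length `n` of the lists -/
  | length (d : Fin R)
  /-- `d :=` the bound `m` on the integers in the lists -/
  | bound (d : Fin R)
  /-- `d :=` the target `t` -/
  | target (d : Fin R)
  /-- `d :=` the integer in position `b` of list number `a`, both counted from `0`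
  (and `0` if there is no such position) -/
  | entry (d a b : Fin R)
  /-- `d :=` a fresh random bit -/
  | coin (d : Fin R)
  /-- go to line `l` -/
  | jump (l : ℕ)
  /-- go to line `l` if `a < b` -/
  | jumpLt (a b : Fin R) (l : ℕ)
  /-- append `a` to the output -/
  | output (a : Fin R)
  /-- stop -/
  | halt

/-- A machine: a fixed number of registers and a fixed finite code, the same for all inputs. -/
structure Machine where
  numRegs : ℕ
  code : List (Instr numRegs)

/-- An input: `k` lists in `[m]^n` and a target. It is read-only, with random access. -/
structure Input where
  k : ℕ
  n : ℕ
  m : ℕ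
  lists : Lists k n m
  target : ℕ

/-- A configuration: current line, contents of the registers, and the output so far, which is
write-only. -/
structure Config (R : ℕ) where
  line : ℕ
  regs : Fin R → ℕ
  out : List ℕ

/-- The instruction in line `l`; beyond the end of the code the machine stops. -/
def Machine.fetch (M : Machine) (l : ℕ) : Instr M.numRegs := M.code.getD l Instr.halt

/-- The result of the instruction `entry`. -/
def Input.read (I : Input) (a b : ℕ) : ℕ :=
  if h : a < I.k ∧ b < I.n then value I.lists ⟨a, h.1⟩ ⟨b, h.2⟩ else 0

/-- Store `v` in register `d` and go to the next line. -/
def Config.set {R : ℕ} (c : Config R) (d : Fin R) (v : ℕ) : Config R :=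
  { c with line := c.line + 1, regs := Function.update c.regs d v }

/-- One step of the machine. `coin` is the random bit that is tossed for this step; it can be
obtained in this step only, by the instruction `coin`. -/
def step (M : Machine) (I : Input) (coin : Bool) (c : Config M.numRegs) : Config M.numRegs :=
  match M.fetch c.line with
  | .const d v => c.set d v
  | .copy d a => c.set d (c.regs a)
  | .add d a b => c.set d (c.regs a + c.regs b)
  | .sub d a b => c.set d (c.regs a - c.regs b)
  | .mul d a b => c.set d (c.regs a * c.regs b)
  | .div d a b => c.set d (c.regs a / c.regs b)
  | .mod d a b => c.set d (c.regs a % c.regs b)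
  | .arity d => c.set d I.k
  | .length d => c.set d I.n
  | .bound d => c.set d I.m
  | .target d => c.set d I.target
  | .entry d a b => c.set d (I.read (c.regs a) (c.regs b))
  | .coin d => c.set d coin.toNat
  | .jump l => { c with line := l }
  | .jumpLt a b l => { c with line := if c.regs a < c.regs b then l else c.line + 1 }
  | .output a => { c with line := c.line + 1, out := c.out ++ [c.regs a] }
  | .halt => c

/-- All registers start at `0`, in line `0`. -/
def initial (M : Machine) : Config M.numRegs := ⟨0, fun _ => 0, []⟩

/-- The configuration after `i` steps, where `coins i` is the random bit of step `i`. -/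
def run (M : Machine) (I : Input) (coins : ℕ → Bool) : ℕ → Config M.numRegs
  | 0 => initial M
  | i + 1 => step M I (coins i) (run M I coins i)

/-- The configuration is a final one. -/
def Halted (M : Machine) (c : Config M.numRegs) : Prop := M.fetch c.line = Instr.halt

/-- The working memory in use, in bits: the total length of the contents of the registers in
binary. (Neither the read-only input nor the write-only output counts.) -/
def Config.bits {R : ℕ} (c : Config R) : ℕ := ∑ r, Nat.size (c.regs r)

/-- On input `I` and for all outcomes of the coin tosses, `M` stops after at most `T` steps and
uses at most `S` bits of working memory all the time. -/
def RunsWithin (M : Machine) (I : Input) (T S : ℕ) : Prop :=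
  ∀ coins : ℕ → Bool, Halted M (run M I coins T) ∧ ∀ i, (run M I coins i).bits ≤ S

/-- `T` coin tosses as an infinite sequence; the tosses from number `T` on play no role for a
machine that stops after at most `T` steps. -/
def extend {T : ℕ} (coins : Fin T → Bool) (i : ℕ) : Bool :=
  if h : i < T then coins ⟨i, h⟩ else false

/-- With these coin tosses, the output of `M` after `T` steps is a list `s_1, …, s_k` that solves
the instance `w`, `t`. -/
def Finds (M : Machine) {k n m : ℕ} (w : Lists k n m) (t : ℕ) {T : ℕ} (coins : Fin T → Bool) :
    Prop :=
  ∃ s : Fin k → ℕ, (run M ⟨k, n, m, w, t⟩ (extend coins) T).out = List.ofFn s ∧ IsSolution w t s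

/-- The probability, over uniformly random lists `w` and independent fair coin tosses, that `M`
finds a solution for the target `τ w` if there is one. -/
noncomputable def successProb (M : Machine) (k n m T : ℕ) (τ : Lists k n m → ℕ) : ℝ :=
  (Nat.card {p : Lists k n m × (Fin T → Bool) //
      Solvable p.1 (τ p.1) → Finds M p.1 (τ p.1) p.2} : ℝ) /
    (Nat.card (Lists k n m × (Fin T → Bool)) : ℝ)

end KSum

/-! Fix positions in the last `k - 2` lists. What remains is to find `i` in list `0` and `j` in list
`1` with a prescribed sum. The positions of these two lists form `2n` cells. A cell of list `0`
carries its integer modulo `n`, a cell of list `1` carries `B` minus its integer modulo `n`, where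
`B` is `k * m + t` minus the sum of the other `k - 2` integers. Since `n ∣ m`, the two cells of a
solution carry equal values.

Let `g` be the resulting function from cells to values and `h` a hash function from values to cells.
If the walk `x ↦ h (g x)` visits `i` and later `j` without having repeated itself, then `i` and `j`
have the same successor. So the walk is periodic from the step after `i` on, and Floyd's method
recovers the pair with a constant number of registers (`lastMeet_add`, `success_of_hits`). A walk of
`ℓ` steps, with `ℓ` about `√n / log n`, hits the pair with probability of order `ℓ² / n²`. Hence
about `n² / ℓ²` walks suffice for each of the `n ^ (k - 2)` choices of positions
(`machine_guarantee_pow`), and the total is `n ^ (k - 1/2)` up to logarithms (`runningTime_le`).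

Two difficulties remain. A truly random `h` does not fit into the memory, so `h` is a random cubic
polynomial over a prime field (`isHash_polyHash`). Its approximate 4-wise independence is enough to
prescribe two cells and to exclude a collision of two further arguments, which bounds the mean hit
probability from below (`expect_hits_ge`). The randomness needed along the walk comes from `g`,
which is uniformly random because the lists are (`expect_cellVal`). Values read adaptively from `g`
are dominated by independent ones (`DecTree.expect_vals_le`).

Moreover, the target is chosen after the lists. So for at least half of the lists the hit
probability `X g`, taken over `h` alone, has to be of order `ℓ² / n²` for all pairs `i`, `j` and all
`B` at once. Only `B` modulo `n` matters, which leaves `n³` events, but each must fail with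
probability well below `n⁻³`. This follows from Talagrand's inequality (`density_mul_density_le`),
applied to the functions with a fixed value at `i`. The set where `X` is small is compared with the
set where `X` is at least half its mean bound and the squared influences of the cells have a small
sum. The latter set is not too sparse, by second moment estimates (`expect_sq_le`, `paley_zygmund`).
The outcome is a failure probability `exp (-κ n / ℓ²)` up to polynomial factors
(`exists_expect_few_hits_le`). The logarithm in the choice of `ℓ` makes `n / ℓ²` at least the square
of a logarithm, which beats every polynomial factor (`exists_hitProb_ge`).

The algorithm is a structured program compiled to machine code. Its deterministic pieces are treated
by `Exec`, which bounds time and register contents. `Guarantee` adds the success probability, which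
changes only at the coin tosses (`Guarantee.toss`, `Guarantee.trials`). -/

open Finset BigOperators

/-! ### Talagrand's inequality in finite product spaces -/

namespace KSum

/-- The vectors that dominate the Hamming distance from `g` to `A` in every weighting; the convex
hull of the mismatch vectors of `g` with the points of `A` is contained in this set. -/
def MismatchHull {Ω : Type} {ι : Type} [Fintype ι] [DecidableEq Ω] (A : Set (ι → Ω)) (g : ι → Ω) :
    Set (ι → ℝ) :=
  {s | ∀ α : ι → ℝ, (∀ x, 0 ≤ α x) → ∀ z : ℝ,
    (∀ g' ∈ A, z ≤ ∑ x, α x * (if g x ≠ g' x then 1 else 0)) → z ≤ ∑ x, α x * s x}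

theorem expect_cons {Ω : Type} [Fintype Ω] {N : ℕ} (f : (Fin (N + 1) → Ω) → ℝ) :
    𝔼 g, f g = 𝔼 ω, 𝔼 y : Fin N → Ω, f (Fin.cons ω y) := by
  rw [← Finset.expect_product' (s := univ) (t := univ) (f := fun ω y => f (Fin.cons ω y))]
  exact (Fintype.expect_equiv (Fin.consEquiv (fun _ => Ω)) _ _ (fun x => rfl)).symm

/-- Hölder's inequality in exponential form. Subtracting `a` from `X` and `b` from `Y` normalises
both hypotheses to a mean of at most one, and convexity of `exp` then applies pointwise. -/
theorem expect_exp_mix_le {ι : Type} [Fintype ι] [Nonempty ι] (X Y : ι → ℝ) (a b φ : ℝ)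
    (h0 : 0 ≤ φ) (h1 : φ ≤ 1) (hX : 𝔼 i, Real.exp (X i) ≤ Real.exp a)
    (hY : 𝔼 i, Real.exp (Y i) ≤ Real.exp b) :
    𝔼 i, Real.exp ((1 - φ) * X i + φ * Y i) ≤ Real.exp ((1 - φ) * a + φ * b) := by
  have key : ∀ i, Real.exp ((1 - φ) * X i + φ * Y i) ≤ Real.exp ((1 - φ) * a + φ * b) *
      ((1 - φ) * Real.exp (-a) * Real.exp (X i) + φ * Real.exp (-b) * Real.exp (Y i)) := by
    intro i
    have := convexOn_exp.2 (Set.mem_univ (X i - a)) (Set.mem_univ (Y i - b))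
      (sub_nonneg.2 h1) h0 (by ring)
    simp only [smul_eq_mul] at this
    have e : Real.exp ((1 - φ) * X i + φ * Y i) = Real.exp ((1 - φ) * a + φ * b) *
        Real.exp ((1 - φ) * (X i - a) + φ * (Y i - b)) := by
      rw [← Real.exp_add]; congr 1; ring
    rw [e]
    refine mul_le_mul_of_nonneg_left (this.trans (le_of_eq ?_)) (Real.exp_pos _).le
    rw [sub_eq_neg_add (X i), sub_eq_neg_add (Y i), Real.exp_add, Real.exp_add]; ring
  refine (Finset.expect_le_expect fun i _ => key i).trans ?_
  rw [← Finset.mul_expect, Finset.expect_add_distrib, ← Finset.mul_expect, ← Finset.mul_expect]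
  refine (mul_le_mul_of_nonneg_left (b := _) (c := 1) ?_ (Real.exp_pos _).le).trans
    (le_of_eq (mul_one _))
  have e1 : Real.exp (-a) * 𝔼 i, Real.exp (X i) ≤ 1 := by
    calc _ ≤ Real.exp (-a) * Real.exp a := by gcongr
      _ = 1 := by rw [← Real.exp_add]; simp
  have e2 : Real.exp (-b) * 𝔼 i, Real.exp (Y i) ≤ 1 := by
    calc _ ≤ Real.exp (-b) * Real.exp b := by gcongr
      _ = 1 := by rw [← Real.exp_add]; simp
  have := sub_nonneg.2 h1
  nlinarith

/-- The scalar inequality behind Talagrand's induction. The denominator `8`, weaker than the usual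
`4`, leaves room for crude choices: `φ = 4t` for small `t` and `φ = 1` otherwise, so that
second-order bounds for `exp` suffice. -/
theorem exists_mix_exponent (t : ℝ) (ht : 0 ≤ t) :
    ∃ φ : ℝ, 0 ≤ φ ∧ φ ≤ 1 ∧ Real.exp (φ ^ 2 / 8 + (1 - φ) * t) ≤ 2 - Real.exp (-t) := by
  by_cases h : t ≤ 1 / 4
  · refine ⟨4 * t, by linarith, by linarith, ?_⟩
    have e : (4 * t) ^ 2 / 8 + (1 - 4 * t) * t = t - 2 * t ^ 2 := by ring
    rw [e]
    have h1 := (abs_le.1 (Real.abs_exp_sub_one_sub_id_le (x := t - 2 * t ^ 2)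
      (by rw [abs_le]; constructor <;> nlinarith))).2
    have h3 := (abs_le.1 (Real.abs_exp_sub_one_sub_id_le (x := -t)
      (by rw [abs_le]; constructor <;> nlinarith))).2
    have h4 : (t - 2 * t ^ 2) ^ 2 ≤ t ^ 2 := by
      apply pow_le_pow_left₀ <;> nlinarith
    nlinarith
  · push Not at h
    refine ⟨1, zero_le_one, le_rfl, ?_⟩
    have h1 := (abs_le.1 (Real.abs_exp_sub_one_sub_id_le (x := (1:ℝ) / 8)
      (by rw [abs_le]; constructor <;> norm_num))).2
    have h2 : Real.exp (-t) ≤ Real.exp (-(1/4)) := Real.exp_le_exp.2 (by linarith)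
    have h3 := (abs_le.1 (Real.abs_exp_sub_one_sub_id_le (x := -(1:ℝ) / 4)
      (by rw [abs_le]; constructor <;> norm_num))).2
    norm_num at h1 h3 ⊢
    linarith

theorem MismatchHull.mix {Ω : Type} [DecidableEq Ω] {ι : Type} [Fintype ι] {A : Set (ι → Ω)} {g : ι → Ω} {s s' : ι → ℝ}
    (hs : s ∈ MismatchHull A g) (hs' : s' ∈ MismatchHull A g) {φ : ℝ} (h0 : 0 ≤ φ) (h1 : φ ≤ 1) :
    (fun x => (1 - φ) * s x + φ * s' x) ∈ MismatchHull A g := by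
  intro α hα z hz
  have e1 := hs α hα z hz
  have e2 := hs' α hα z hz
  have : ∑ x, α x * ((1 - φ) * s x + φ * s' x) =
      (1 - φ) * ∑ x, α x * s x + φ * ∑ x, α x * s' x := by
    rw [mul_sum, mul_sum, ← sum_add_distrib]; exact sum_congr rfl fun x _ => by ring
  rw [this]
  have := sub_nonneg.2 h1
  nlinarith

/-- Points of `A` that begin with `ω` have no mismatch in the first coordinate, so this coordinate
costs nothing. -/
theorem MismatchHull.section {Ω : Type} [DecidableEq Ω] {N : ℕ} {A : Set (Fin (N + 1) → Ω)} {ω : Ω} {y : Fin N → Ω}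
    {s : Fin N → ℝ} (hs : s ∈ MismatchHull {y | Fin.cons ω y ∈ A} y) :
    (Fin.cons 0 s : Fin (N + 1) → ℝ) ∈ MismatchHull A (Fin.cons ω y) := by
  intro α hα z hz
  rw [Fin.sum_univ_succ]
  simp only [Fin.cons_zero, Fin.cons_succ, mul_zero, zero_add]
  refine hs (fun x => α x.succ) (fun x => hα _) z fun y' hy' => ?_
  have := hz _ hy'
  rw [Fin.sum_univ_succ] at this
  simpa using this

/-- Points of `A` with another first entry are admitted here, at the price of one full mismatch in
the first coordinate. -/
theorem MismatchHull.projection {Ω : Type} [DecidableEq Ω] {N : ℕ} {A : Set (Fin (N + 1) → Ω)} {ω : Ω} {y : Fin N → Ω}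
    {s : Fin N → ℝ} (hs : s ∈ MismatchHull {y | ∃ ω', Fin.cons ω' y ∈ A} y) :
    (Fin.cons 1 s : Fin (N + 1) → ℝ) ∈ MismatchHull A (Fin.cons ω y) := by
  intro α hα z hz
  rw [Fin.sum_univ_succ]
  simp only [Fin.cons_zero, Fin.cons_succ, mul_one]
  have := hs (fun x => α x.succ) (fun x => hα _) (z - α 0) ?_
  · linarith
  rintro y' ⟨ω', hy'⟩
  have := hz _ hy'
  rw [Fin.sum_univ_succ] at this
  simp only [Fin.cons_zero, Fin.cons_succ] at this
  have h2 : α 0 * (if ω ≠ ω' then 1 else 0) ≤ α 0 := by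
    split_ifs <;> simp [hα]
  linarith

open Classical in
/-- The density of a set. -/
noncomputable def density {α : Type} [Fintype α] (A : Set α) : ℝ := 𝔼 a, if a ∈ A then 1 else 0

theorem density_nonneg {α : Type} [Fintype α] (A : Set α) : 0 ≤ density A :=
  Finset.expect_nonneg fun _ _ => by split_ifs <;> norm_num

theorem density_mono {α : Type} [Fintype α] {A B : Set α} (h : A ⊆ B) : density A ≤ density B := by
  classical
  refine Finset.expect_le_expect fun a _ => ?_
  by_cases ha : a ∈ A
  · simp [ha, h ha]
  · simp only [ha, if_false]; split_ifs <;> norm_num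

theorem density_pos {α : Type} [Fintype α] {A : Set α} (h : A.Nonempty) : 0 < density A := by
  classical
  obtain ⟨a, ha⟩ := h
  refine Finset.expect_pos' (fun _ _ => by split_ifs <;> norm_num) ⟨a, mem_univ _, ?_⟩
  simp [ha]

theorem density_cons {Ω : Type} [Fintype Ω] {N : ℕ} (A : Set (Fin (N + 1) → Ω)) :
    density A = 𝔼 ω, density {y : Fin N → Ω | Fin.cons ω y ∈ A} := by
  classical
  unfold density
  rw [expect_cons]
  rfl

/-- Talagrand's induction on the number of coordinates. For each first entry `ω`, a vector for the
section of `A` at `ω` is mixed with one for the projection of `A`, the weight depending on the ratio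
of their densities. Convexity of the square leaves a cost `φ ^ 2` for the first coordinate, and
Hölder's inequality combines the two exponential moments. -/
theorem exists_mismatch_expect_exp_le {Ω : Type} [Fintype Ω] [Nonempty Ω] [DecidableEq Ω] (N : ℕ) (A : Set (Fin N → Ω)) (hA : A.Nonempty) :
    ∃ s : (Fin N → Ω) → Fin N → ℝ, (∀ g, s g ∈ MismatchHull A g) ∧
      (𝔼 g, Real.exp ((∑ x, s g x ^ 2) / 8)) ≤ 1 / density A := by
  classical
  induction N with
  | zero =>
    obtain ⟨a, ha⟩ := hA
    have hA' : A = Set.univ := by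
      ext b; simp [Subsingleton.elim b a, ha]
    refine ⟨fun _ _ => 0, fun g => ?_, ?_⟩
    · intro α hα z hz
      simpa using hz a ha
    · simp [hA', density]
  | succ N ih =>
    set P : Set (Fin N → Ω) := {y | ∃ ω', (Fin.cons ω' y : Fin (N + 1) → Ω) ∈ A} with hP
    have hPne : P.Nonempty := by
      obtain ⟨a, ha⟩ := hA
      exact ⟨Fin.tail a, a 0, by simpa using ha⟩
    obtain ⟨sP, hsP, hsP'⟩ := ih P hPne
    have hp := density_pos hPne
    set p := density P
    have key : ∀ ω : Ω, ∃ s : (Fin N → Ω) → Fin (N + 1) → ℝ,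
        (∀ y, s y ∈ MismatchHull A (Fin.cons ω y)) ∧
        (𝔼 y, Real.exp ((∑ x, s y x ^ 2) / 8)) ≤
          1 / p * (2 - density {y : Fin N → Ω | Fin.cons ω y ∈ A} / p) := by
      intro ω
      set Aω : Set (Fin N → Ω) := {y | Fin.cons ω y ∈ A} with hAω
      by_cases hne : Aω.Nonempty
      · obtain ⟨sA, hsA, hsA'⟩ := ih Aω hne
        have ha := density_pos hne
        have hle : density Aω ≤ p := density_mono fun y hy => ⟨ω, hy⟩
        set a := density Aω
        -- With `t = log (p / a)` the term `exp (-t)` is the ratio `a / p`, so the bound becomes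
        -- linear in the density of the section and can be averaged over `ω`.
        obtain ⟨φ, h0, h1, hφ⟩ := exists_mix_exponent (Real.log p - Real.log a)
          (sub_nonneg.2 (Real.log_le_log ha hle))
        refine ⟨fun y x => (1 - φ) * (Fin.cons 0 (sA y) : Fin (N + 1) → ℝ) x +
          φ * (Fin.cons 1 (sP y) : Fin (N + 1) → ℝ) x, fun y => ?_, ?_⟩
        · exact MismatchHull.mix (MismatchHull.section (hsA y)) (MismatchHull.projection (hsP y))
            h0 h1
        · have e1 : 1 / a = Real.exp (-Real.log a) := by
            rw [Real.exp_neg, Real.exp_log ha, one_div]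
          have e2 : 1 / p = Real.exp (-Real.log p) := by
            rw [Real.exp_neg, Real.exp_log hp, one_div]
          rw [e1] at hsA'
          rw [e2] at hsP'
          have hm := expect_exp_mix_le _ _ _ _ φ h0 h1 hsA' hsP'
          have hb : ∀ y, Real.exp ((∑ x, ((1 - φ) * (Fin.cons 0 (sA y) : Fin (N + 1) → ℝ) x +
              φ * (Fin.cons 1 (sP y) : Fin (N + 1) → ℝ) x) ^ 2) / 8) ≤ Real.exp (φ ^ 2 / 8) *
              Real.exp ((1 - φ) * ((∑ x, sA y x ^ 2) / 8) + φ * ((∑ x, sP y x ^ 2) / 8)) := by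
            intro y
            rw [← Real.exp_add, Real.exp_le_exp, Fin.sum_univ_succ]
            simp only [Fin.cons_zero, Fin.cons_succ]
            have : ∑ x, ((1 - φ) * sA y x + φ * sP y x) ^ 2 ≤
                (1 - φ) * ∑ x, sA y x ^ 2 + φ * ∑ x, sP y x ^ 2 := by
              rw [mul_sum, mul_sum, ← sum_add_distrib]
              refine sum_le_sum fun x _ => ?_
              have := mul_nonneg (mul_nonneg h0 (sub_nonneg.2 h1)) (sq_nonneg (sA y x - sP y x))
              nlinarith
            linarith
          refine (Finset.expect_le_expect fun y _ => hb y).trans ?_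
          rw [← Finset.mul_expect]
          refine (mul_le_mul_of_nonneg_left hm (Real.exp_pos _).le).trans ?_
          rw [← Real.exp_add]
          have e3 : a / p = Real.exp (-(Real.log p - Real.log a)) := by
            rw [neg_sub, Real.exp_sub, Real.exp_log ha, Real.exp_log hp]
          rw [e3, e2]
          refine le_trans (le_of_eq ?_) (mul_le_mul_of_nonneg_left hφ (Real.exp_pos _).le)
          rw [← Real.exp_add]; congr 1; ring
      -- Over an empty section only the projection is available; the full mismatch costs `exp (1/8)
      -- ≤ 2`.
      · refine ⟨fun y => Fin.cons 1 (sP y), fun y => MismatchHull.projection (hsP y), ?_⟩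
        have : density Aω = 0 := by
          rw [Set.not_nonempty_iff_eq_empty.1 hne]; simp [density]
        rw [this]
        simp only [Fin.sum_univ_succ, Fin.cons_zero, Fin.cons_succ, add_div, Real.exp_add]
        rw [← Finset.mul_expect]
        have h1 := (abs_le.1 (Real.abs_exp_sub_one_sub_id_le (x := (1:ℝ) / 8)
          (by rw [abs_le]; constructor <;> norm_num))).2
        have h2 : Real.exp (1 ^ 2 / 8) ≤ 2 := by norm_num at *; linarith
        calc _ ≤ 2 * (1 / p) := by
              apply mul_le_mul h2 hsP' _ (by norm_num)
              exact Finset.expect_nonneg fun _ _ => (Real.exp_pos _).le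
          _ = _ := by ring
    choose s hs hs' using key
    refine ⟨fun g => s (g 0) (Fin.tail g), fun g => ?_, ?_⟩
    · have := hs (g 0) (Fin.tail g)
      rwa [Fin.cons_self_tail] at this
    · rw [expect_cons]
      simp only [Fin.cons_zero, Fin.tail_cons]
      refine (Finset.expect_le_expect fun ω _ => hs' ω).trans ?_
      have hpos := density_pos hA
      rw [← Finset.mul_expect, Finset.expect_sub_distrib, Finset.expect_const univ_nonempty,
        ← Finset.expect_div, ← density_cons]
      set a := density A
      rw [le_div_iff₀ hpos]
      -- The average over `ω` closes the induction because `x * (2 - x) ≤ 1` for `x = a / p`.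
      have : 1 / p * (2 - a / p) * a = 1 - (1 - a / p) ^ 2 := by
        field_simp; ring
      rw [this]
      nlinarith [sq_nonneg (1 - a / p)]

/-- For `g` in `B`, the weights `α g` and the Cauchy–Schwarz inequality force the squared norm of
the mismatch vector to be at least `z ^ 2 / V`. The exponential moment then bounds the density of
`B`, as in Markov's inequality. -/
theorem density_mul_density_le_fin {Ω : Type} [Fintype Ω] [Nonempty Ω] [DecidableEq Ω]
    (N : ℕ) (A B : Set (Fin N → Ω)) (α : (Fin N → Ω) → Fin N → ℝ)
    (hα : ∀ g x, 0 ≤ α g x) (V z : ℝ) (hV : 0 < V) (hz : 0 ≤ z)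
    (hB : ∀ g ∈ B, ∑ x, α g x ^ 2 ≤ V)
    (hAB : ∀ g ∈ B, ∀ g' ∈ A, z ≤ ∑ x, α g x * (if g x ≠ g' x then 1 else 0)) :
    density A * density B ≤ Real.exp (-(z ^ 2 / (8 * V))) := by
  classical
  rcases A.eq_empty_or_nonempty with rfl | hA
  · simp [density, (Real.exp_pos _).le]
  obtain ⟨s, hs, hs'⟩ := exists_mismatch_expect_exp_le N A hA
  have hpos := density_pos hA
  have h1 : Real.exp (z ^ 2 / (8 * V)) * density B ≤ 𝔼 g, Real.exp ((∑ x, s g x ^ 2) / 8) := by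
    unfold density
    rw [Finset.mul_expect]
    refine Finset.expect_le_expect fun g _ => ?_
    split_ifs with hg
    · rw [mul_one, Real.exp_le_exp]
      have h2 := hs g (α g) (hα g) z (hAB g hg)
      have h3 := Finset.sum_mul_sq_le_sq_mul_sq univ (α g) (s g)
      have h4 := hB g hg
      have h5 : 0 ≤ ∑ x, s g x ^ 2 := sum_nonneg fun _ _ => sq_nonneg _
      have h6 : z ^ 2 ≤ V * ∑ x, s g x ^ 2 := by
        calc z ^ 2 ≤ (∑ x, α g x * s g x) ^ 2 := by gcongr
          _ ≤ _ := h3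
          _ ≤ _ := by gcongr
      rw [div_le_div_iff₀ (by positivity) (by norm_num)]
      nlinarith
    · rw [mul_zero]; exact (Real.exp_pos _).le
  have h2 := h1.trans hs'
  rw [le_div_iff₀ hpos] at h2
  rw [Real.exp_neg, ← one_div, le_div_iff₀ (Real.exp_pos _)]
  linarith

/-- Talagrand's inequality for two sets in a finite product space. -/
theorem density_mul_density_le {Ω : Type} [Fintype Ω] [Nonempty Ω] [DecidableEq Ω]
    {ι : Type} [Fintype ι] [DecidableEq ι] (A B : Set (ι → Ω)) (α : (ι → Ω) → ι → ℝ)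
    (hα : ∀ g x, 0 ≤ α g x) (V z : ℝ) (hV : 0 < V) (hz : 0 ≤ z)
    (hB : ∀ g ∈ B, ∑ x, α g x ^ 2 ≤ V)
    (hAB : ∀ g ∈ B, ∀ g' ∈ A, z ≤ ∑ x, α g x * (if g x ≠ g' x then 1 else 0)) :
    density A * density B ≤ Real.exp (-(z ^ 2 / (8 * V))) := by
  classical
  let e := Fintype.equivFin ι
  let E : (ι → Ω) ≃ (Fin (Fintype.card ι) → Ω) := e.arrowCongr (Equiv.refl Ω)
  have hd : ∀ A : Set (ι → Ω), density A = density {g | E.symm g ∈ A} := by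
    intro A
    unfold density
    exact Fintype.expect_equiv E _ _ fun g => by simp
  have hE : ∀ g x, E.symm g x = g (e x) := fun g x => rfl
  rw [hd A, hd B]
  refine density_mul_density_le_fin _ _ _ (fun g x => α (E.symm g) (e.symm x)) (fun _ _ => hα _ _)
    V z hV hz (fun g hg => ?_) (fun g hg g' hg' => ?_)
  · rw [Equiv.sum_comp e.symm (fun x => α (E.symm g) x ^ 2)]
    exact hB _ hg
  · refine (hAB _ hg _ hg').trans (le_of_eq ?_)
    rw [← Equiv.sum_comp e.symm]
    simp [hE]

end KSum

/-! ### Indicators, random functions and adaptively read values -/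

namespace KSum

open Classical in
/-- The indicator of a proposition. -/
noncomputable def ind (P : Prop) : ℝ := if P then 1 else 0

theorem ind_true {P : Prop} (h : P) : ind P = 1 := by simp [ind, h]

theorem ind_false {P : Prop} (h : ¬P) : ind P = 0 := by simp [ind, h]

theorem ind_nonneg (P : Prop) : 0 ≤ ind P := by unfold ind; split_ifs <;> norm_num

theorem ind_le_one (P : Prop) : ind P ≤ 1 := by unfold ind; split_ifs <;> norm_num

theorem ind_mono {P Q : Prop} (h : P → Q) : ind P ≤ ind Q := by
  by_cases hP : P
  · rw [ind_true hP, ind_true (h hP)]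
  · rw [ind_false hP]; exact ind_nonneg Q

theorem density_setOf {α : Type} [Fintype α] (P : α → Prop) :
    density {a | P a} = 𝔼 a, ind (P a) := rfl

theorem expect_ind_eq {V : Type} [Fintype V] (y : V) :
    𝔼 v : V, ind (v = y) = 1 / Fintype.card V := by
  classical
  rw [Fintype.expect_eq_sum_div_card]
  simp [ind]

/-- Split `g` into its value at `c` and the rest: only the rest survives the update, and the fresh
value restores uniformity. This is the device by which random values are exposed one at a time. -/
theorem expect_expect_update {C V : Type} [Fintype C] [DecidableEq C] [Fintype V] [Nonempty V]
    (c : C) (Φ : (C → V) → ℝ) : 𝔼 v, 𝔼 g, Φ (Function.update g c v) = 𝔼 g, Φ g := by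
  have h : ∀ F : (C → V) → ℝ, 𝔼 g, F g = 𝔼 w : V, 𝔼 f : {x // x ≠ c} → V,
      F ((Equiv.funSplitAt c V).symm (w, f)) := by
    intro F
    rw [← Finset.expect_product' (s := univ) (t := univ)
      (f := fun w f => F ((Equiv.funSplitAt c V).symm (w, f)))]
    refine Fintype.expect_equiv (Equiv.funSplitAt c V) _ _ (fun x => ?_)
    show F x = F ((Equiv.funSplitAt c V).symm (Equiv.funSplitAt c V x))
    rw [Equiv.symm_apply_apply]
  have h2 : ∀ v, 𝔼 g, Φ (Function.update g c v) =
      𝔼 f : {x // x ≠ c} → V, Φ ((Equiv.funSplitAt c V).symm (v, f)) := by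
    intro v
    rw [h]
    rw [← Finset.expect_const (s := (univ : Finset V)) univ_nonempty
      (𝔼 f : {x // x ≠ c} → V, Φ ((Equiv.funSplitAt c V).symm (v, f)))]
    refine Finset.expect_congr rfl fun w _ => Finset.expect_congr rfl fun f _ => ?_
    congr 1
    ext x
    by_cases hx : x = c
    · subst hx; simp [Equiv.funSplitAt, Equiv.piSplitAt]
    · simp [Equiv.funSplitAt, Equiv.piSplitAt, hx]
  rw [h Φ]
  exact Finset.expect_congr rfl fun v _ => h2 v

theorem expect_ind_apply_eq {ι V : Type} [Fintype ι] [DecidableEq ι] [Fintype V] [Nonempty V]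
    (a : ι) (F : (ι → V) → V) (hF : ∀ ω v, F (Function.update ω a v) = F ω) :
    𝔼 ω : ι → V, ind (ω a = F ω) = 1 / Fintype.card V := by
  rw [← expect_expect_update a, Finset.expect_comm]
  simp only [Function.update_self, hF, expect_ind_eq]
  rw [Finset.expect_const univ_nonempty]

/-! ### Decision trees -/

/-- Adaptive strategies for reading the values of a function `C → V`. -/
inductive DecTree (C V : Type) : Type
  | leaf
  | node (c : C) (next : V → DecTree C V)

namespace DecTree

/-- At most `d` values are read. -/
def Within {C V : Type} : DecTree C V → ℕ → Prop
  | leaf, _ => True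
  | node _ _, 0 => False
  | node _ next, d + 1 => ∀ v, (next v).Within d

/-- The set of values that are read. -/
def vals {C V : Type} [DecidableEq V] (g : C → V) : DecTree C V → Finset V
  | leaf => ∅
  | node c next => insert (g c) ((next (g c)).vals g)

/-- The values that a strategy reads in a random function are dominated by independent
uniformly random values. -/
theorem expect_vals_le {C V : Type} [Fintype C] [DecidableEq C] [Fintype V] [DecidableEq V]
    [Nonempty V] (ψ : Finset V → ℝ) (hψ : Monotone ψ) (d : ℕ) :
    ∀ (T : DecTree C V), T.Within d → ∀ (K : C → Option V) (B : Finset V),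
      (∀ c v, K c = some v → v ∈ B) →
      𝔼 g : C → V, ψ (B ∪ T.vals fun c => (K c).getD (g c)) ≤
        𝔼 ω : Fin d → V, ψ (B ∪ univ.image ω) := by
  have hleaf : ∀ (d : ℕ) (B : Finset V), ψ B ≤ 𝔼 ω : Fin d → V, ψ (B ∪ univ.image ω) := by
    intro d B
    rw [← Finset.expect_const (s := (univ : Finset (Fin d → V))) univ_nonempty (ψ B)]
    exact Finset.expect_le_expect fun ω _ => hψ subset_union_left
  induction d with
  | zero =>
    intro T hT K B hK
    cases T with
    | leaf =>
      simp only [vals, union_empty]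
      rw [Finset.expect_const univ_nonempty]
      exact hleaf 0 B
    | node c next => exact hT.elim
  | succ d ih =>
    intro T hT K B hK
    cases T with
    | leaf =>
      simp only [vals, union_empty]
      rw [Finset.expect_const univ_nonempty]
      exact hleaf _ B
    | node c next =>
      have himg : ∀ (v : V) (ω : Fin d → V),
          univ.image (Fin.cons v ω : Fin (d + 1) → V) = insert v (univ.image ω) := by
        intro v ω
        ext y
        simp [Fin.exists_fin_succ, eq_comm]
      rw [expect_cons]
      simp only [himg, vals]
      -- `K` records the values exposed so far, all of which lie in `B`. Reading a known cell adds
      -- nothing to the set, whereas the independent model draws one more value; monotonicity of `ψ`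
      -- absorbs the difference.
      cases hc : K c with
      | some v =>
        simp only [Option.getD_some]
        have hv := hK c v hc
        have e : ∀ X : Finset V, B ∪ insert v X = B ∪ X := by
          intro X
          rw [union_insert, insert_eq_self.2 (mem_union_left _ hv)]
        simp only [e]
        refine (ih (next v) (hT v) K B hK).trans ?_
        rw [← Finset.expect_const (s := (univ : Finset V)) univ_nonempty (𝔼 ω : Fin d → V, _)]
        refine Finset.expect_le_expect fun w _ => Finset.expect_le_expect fun ω _ => hψ ?_
        exact union_subset_union_right (subset_insert _ _)
      | none =>
        -- A cell read for the first time is resampled, and its value is transferred from `g` to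
        -- `K`.
        rw [← expect_expect_update c]
        refine Finset.expect_le_expect fun v _ => ?_
        have hK' : ∀ c' v', Function.update K c (some v) c' = some v' → v' ∈ insert v B := by
          intro c' v' h
          by_cases hcc : c' = c
          · subst hcc; simp at h; simp [h]
          · rw [Function.update_of_ne hcc] at h
            exact mem_insert_of_mem (hK _ _ h)
        have := ih (next v) (hT v) (Function.update K c (some v)) (insert v B) hK'
        have e : ∀ g : C → V, (fun c' => (K c').getD (Function.update g c v c')) =
            fun c' => (Function.update K c (some v) c').getD (g c') := by
          intro g; ext c'
          by_cases hcc : c' = c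
          · subst hcc; simp [hc]
          · simp [Function.update_of_ne hcc]
        simp only [Option.getD_none, Function.update_self]
        simp only [e]
        simpa only [insert_union, union_insert] using this

end DecTree

/-! ### Walks -/

/-- The walk `x₀ = h none`, `xₜ₊₁ = h (g xₜ)`. -/
def walk {C V : Type} (h : Option V → C) (g : C → V) : ℕ → C
  | 0 => h none
  | t + 1 => h (some (g (walk h g t)))

/-- The walk goes through `i` and later to `j` before any repetition. -/
def HitsAt {C V : Type} (h : Option V → C) (g : C → V) (i j : C) (u v : ℕ) : Prop :=
  u < v ∧ walk h g u = i ∧ walk h g v = j ∧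
    ∀ s t, s ≤ v → t ≤ v → walk h g s = walk h g t → s = t

/-- The walk goes through `i` and then `j` within less than `ℓ` steps. -/
def Hits {C V : Type} (h : Option V → C) (g : C → V) (ℓ : ℕ) (i j : C) : Prop :=
  ∃ u v, v < ℓ ∧ HitsAt h g i j u v

/-- The strategy that follows a walk for `r` steps from `x`. -/
def walkTree {C V : Type} (h : Option V → C) (T : DecTree C V) : ℕ → C → DecTree C V
  | 0, _ => T
  | r + 1, x => DecTree.node x fun v => walkTree h T r (h (some v))

theorem walkTree_within {C V : Type} (h : Option V → C) (T : DecTree C V) (d : ℕ)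
    (hT : T.Within d) (r : ℕ) (x : C) : (walkTree h T r x).Within (d + r) := by
  induction r generalizing x with
  | zero => exact hT
  | succ r ih => exact fun v => ih _

theorem vals_subset_walkTree {C V : Type} [DecidableEq V] (h : Option V → C) (T : DecTree C V)
    (g : C → V) (r : ℕ) (x : C) : T.vals g ⊆ (walkTree h T r x).vals g := by
  induction r generalizing x with
  | zero => exact Subset.refl _
  | succ r ih => exact (ih _).trans (subset_insert _ _)

theorem mem_vals_walkTree {C V : Type} [DecidableEq V] (h : Option V → C) (T : DecTree C V)
    (g : C → V) (r t₀ t : ℕ) (ht : t < r) :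
    g (walk h g (t₀ + t)) ∈ (walkTree h T r (walk h g t₀)).vals g := by
  induction r generalizing t₀ t with
  | zero => omega
  | succ r ih =>
    cases t with
    | zero => exact mem_insert_self _ _
    | succ t =>
      have := ih (t₀ + 1) t (by omega)
      rw [add_right_comm] at this
      exact mem_insert_of_mem this

/-- The square is an average over two independent hash parameters. For fixed `a` and `a'` the two
walks form one adaptive strategy with `2 * ℓ` reads, so the values read may be replaced by `γ` and
`2 * ℓ` independent ones. These no longer depend on `a` and `a'`, so the average factors into a
square again, and what remains is a bound over `a` for a fixed small set of values. -/
theorem expect_sq_le {𝓐 C V : Type} [Fintype 𝓐] [Nonempty 𝓐] [Fintype C] [DecidableEq C]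
    [Fintype V] [DecidableEq V] [Nonempty V] (H : 𝓐 → Option V → C) (ℓ : ℕ) (i : C) (γ : V)
    (Φ : 𝓐 → (C → V) → ℝ) (hΦ0 : ∀ a g, 0 ≤ Φ a g) (c : 𝓐 → Finset V → ℝ)
    (hc : ∀ a, Monotone (c a)) (hΦ : ∀ a g X, (∀ t < ℓ, g (walk (H a) g t) ∈ X) → Φ a g ≤ c a X)
    (hc0 : ∀ a X, 0 ≤ c a X)
    (b : ℝ) (hb : ∀ X : Finset V, X.card ≤ 2 * ℓ + 1 → 𝔼 a, c a X ≤ b) :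
    𝔼 g : C → V, (𝔼 a, Φ a (Function.update g i γ)) ^ 2 ≤ b ^ 2 := by
  have step : ∀ a a', 𝔼 g : C → V, Φ a (Function.update g i γ) * Φ a' (Function.update g i γ) ≤
      𝔼 ω : Fin (0 + ℓ + ℓ) → V, c a ({γ} ∪ univ.image ω) * c a' ({γ} ∪ univ.image ω) := by
    intro a a'
    have hT : (walkTree (H a) (walkTree (H a') DecTree.leaf ℓ (H a' none)) ℓ (H a none)).Within
        (0 + ℓ + ℓ) :=
      walkTree_within _ _ _ (walkTree_within _ DecTree.leaf 0 trivial _ _) _ _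
    -- The cell `i` counts as known from the beginning, with value `γ`; hence the initial set `{γ}`.
    have := DecTree.expect_vals_le (C := C) (fun X => c a X * c a' X)
      (fun X Y hXY => mul_le_mul (hc a hXY) (hc a' hXY) (hc0 _ _) (hc0 _ _))
      _ _ hT (Function.update (fun _ => none) i (some γ)) {γ} (by
        intro c' v h
        by_cases hcc : c' = i
        · subst hcc; simp at h; simp [h]
        · simp [Function.update_of_ne hcc] at h)
    refine le_trans (Finset.expect_le_expect fun g _ => ?_) this
    have e : (fun c' => (Function.update (fun _ => none) i (some γ) c').getD (g c')) =
        Function.update g i γ := by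
      ext c'
      by_cases hcc : c' = i
      · subst hcc; simp
      · simp [Function.update_of_ne hcc]
    rw [e]
    set G := Function.update g i γ
    refine mul_le_mul (hΦ _ _ _ fun t ht => ?_) (hΦ _ _ _ fun t ht => ?_) (hΦ0 _ _) (hc0 _ _)
    · have := mem_vals_walkTree (H a) (walkTree (H a') DecTree.leaf ℓ (H a' none)) G ℓ 0 t ht
      rw [zero_add] at this
      exact mem_union_right _ this
    · have := mem_vals_walkTree (H a') DecTree.leaf G ℓ 0 t ht
      rw [zero_add] at this
      exact mem_union_right _ (vals_subset_walkTree _ _ _ _ _ this)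
  have e1 : 𝔼 g : C → V, (𝔼 a, Φ a (Function.update g i γ)) ^ 2 =
      𝔼 a, 𝔼 a', 𝔼 g : C → V, Φ a (Function.update g i γ) * Φ a' (Function.update g i γ) := by
    simp only [sq, Finset.expect_mul_expect]
    rw [Finset.expect_comm]
    exact Finset.expect_congr rfl fun a _ => Finset.expect_comm _ _ _
  have e2 : 𝔼 a, 𝔼 a', 𝔼 ω : Fin (0 + ℓ + ℓ) → V,
      c a ({γ} ∪ univ.image ω) * c a' ({γ} ∪ univ.image ω) =
      𝔼 ω : Fin (0 + ℓ + ℓ) → V, (𝔼 a, c a ({γ} ∪ univ.image ω)) ^ 2 := by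
    simp only [sq, Finset.expect_mul_expect]
    symm
    rw [Finset.expect_comm]
    exact Finset.expect_congr rfl fun a _ => Finset.expect_comm _ _ _
  rw [e1]
  refine (Finset.expect_le_expect fun a _ => Finset.expect_le_expect fun a' _ => step a a').trans ?_
  rw [e2, ← Finset.expect_const (s := (univ : Finset (Fin (0 + ℓ + ℓ) → V))) univ_nonempty (b ^ 2)]
  refine Finset.expect_le_expect fun ω _ => ?_
  refine pow_le_pow_left₀ (Finset.expect_nonneg fun _ _ => hc0 _ _) (hb _ ?_) 2
  refine (card_union_le _ _).trans ?_
  have := card_image_le (s := univ) (f := ω)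
  simp at this ⊢
  omega

end KSum

/-! ### Hash functions with limited independence -/

namespace KSum

/-- A family of hash functions that is nearly 4-wise independent. -/
structure IsHash {𝓐 C Z : Type} [Fintype 𝓐] (n : ℕ) (H : 𝓐 → Z → C) : Prop where
  two_ge : ∀ z₁ z₂, z₁ ≠ z₂ → ∀ y₁ y₂, 1 / (16 * (n : ℝ) ^ 2) ≤
    𝔼 a, ind (H a z₁ = y₁ ∧ H a z₂ = y₂)
  two_le : ∀ z₁ z₂, z₁ ≠ z₂ → ∀ y₁ y₂,
    𝔼 a, ind (H a z₁ = y₁ ∧ H a z₂ = y₂) ≤ 1 / (n : ℝ) ^ 2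
  three_le : ∀ z₁ z₂ z₃, z₁ ≠ z₂ → z₁ ≠ z₃ → z₂ ≠ z₃ → ∀ y₁ y₂ y₃,
    𝔼 a, ind (H a z₁ = y₁ ∧ H a z₂ = y₂ ∧ H a z₃ = y₃) ≤ 1 / (n : ℝ) ^ 3
  four_le : ∀ z₁ z₂ z₃ z₄, z₁ ≠ z₂ → z₁ ≠ z₃ → z₁ ≠ z₄ → z₂ ≠ z₃ → z₂ ≠ z₄ → z₃ ≠ z₄ →
    ∀ y₁ y₂ y₃ y₄, 𝔼 a, ind (H a z₁ = y₁ ∧ H a z₂ = y₂ ∧ H a z₃ = y₃ ∧ H a z₄ = y₄) ≤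
      1 / (n : ℝ) ^ 4

namespace IsHash

variable {𝓐 C Z : Type} [Fintype 𝓐] {n : ℕ} {H : 𝓐 → Z → C}

/-- Equal arguments cannot be hashed to different cells, so it is enough that the cells are
distinct. This is convenient when the arguments come from a walk. -/
theorem expect_two_le (hH : IsHash n H) {y₁ y₂ : C} (hy : y₁ ≠ y₂) (z₁ z₂ : Z) :
    𝔼 a, ind (H a z₁ = y₁ ∧ H a z₂ = y₂) ≤ 1 / (n : ℝ) ^ 2 := by
  by_cases hz : z₁ = z₂
  · subst hz
    have : ∀ a, ind (H a z₁ = y₁ ∧ H a z₁ = y₂) = 0 := fun a =>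
      ind_false fun h => hy (h.1.symm.trans h.2)
    simp only [this, Finset.expect_const_zero]
    positivity
  · exact hH.two_le _ _ hz _ _

theorem expect_three_le (hH : IsHash n H) {y₁ y₂ y₃ : C} (h12 : y₁ ≠ y₂) (h13 : y₁ ≠ y₃)
    (h23 : y₂ ≠ y₃) (z₁ z₂ z₃ : Z) :
    𝔼 a, ind (H a z₁ = y₁ ∧ H a z₂ = y₂ ∧ H a z₃ = y₃) ≤ 1 / (n : ℝ) ^ 3 := by
  by_cases hz : z₁ ≠ z₂ ∧ z₁ ≠ z₃ ∧ z₂ ≠ z₃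
  · exact hH.three_le _ _ _ hz.1 hz.2.1 hz.2.2 _ _ _
  · have : ∀ a, ind (H a z₁ = y₁ ∧ H a z₂ = y₂ ∧ H a z₃ = y₃) = 0 := by
      refine fun a => ind_false fun ⟨h1, h2, h3⟩ => hz ⟨?_, ?_, ?_⟩
      · rintro rfl; exact h12 (h1.symm.trans h2)
      · rintro rfl; exact h13 (h1.symm.trans h3)
      · rintro rfl; exact h23 (h2.symm.trans h3)
    simp only [this, Finset.expect_const_zero]
    positivity

/-- For four distinct arguments, sum the 4-wise bound over the `2 * n` possible places of the
collision. If arguments coincide, the event either contradicts `y₁ ≠ y₂` or prescribes the cells of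
three distinct arguments. -/
theorem expect_collision_le [Fintype C] (hC : Fintype.card C = 2 * n) (hH : IsHash n H)
    (hn : 1 ≤ n) {y₁ y₂ : C} (hy : y₁ ≠ y₂) (z₁ z₂ z₃ z₄ : Z) (hz : z₃ ≠ z₄) :
    𝔼 a, ind (H a z₁ = y₁ ∧ H a z₂ = y₂ ∧ H a z₃ = H a z₄) ≤ 2 / (n : ℝ) ^ 3 := by
  have hn' : (0:ℝ) < n := by exact_mod_cast hn
  have h12 : (1:ℝ) / n ^ 3 ≤ 2 / n ^ 3 := by gcongr; norm_num
  by_cases h1 : z₁ = z₂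
  · have : ∀ a, ind (H a z₁ = y₁ ∧ H a z₂ = y₂ ∧ H a z₃ = H a z₄) = 0 := by
      refine fun a => ind_false fun h => hy ?_
      rw [← h.1, ← h.2.1, h1]
    simp only [this, Finset.expect_const_zero]
    positivity
  -- The case in which one argument of the collision is `z₁` or `z₂`: the other one, `w`, then has a
  -- prescribed cell too.
  have main : ∀ w y y' : Z, ∀ c c' : C, y ≠ y' → w ≠ y → w ≠ y' →
      (∀ a, (H a z₁ = y₁ ∧ H a z₂ = y₂ ∧ H a z₃ = H a z₄) →
        (H a w = c ∧ H a y = y₁ ∧ H a y' = y₂)) →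
      𝔼 a, ind (H a z₁ = y₁ ∧ H a z₂ = y₂ ∧ H a z₃ = H a z₄) ≤ 2 / (n : ℝ) ^ 3 := by
    intro w y y' c c' h1 h2 h3 h
    refine (Finset.expect_le_expect fun a _ => ind_mono (h a)).trans ?_
    exact (hH.three_le _ _ _ h2 h3 h1 _ _ _).trans h12
  by_cases h31 : z₃ = z₁
  · by_cases h42 : z₄ = z₂
    · have : ∀ a, ind (H a z₁ = y₁ ∧ H a z₂ = y₂ ∧ H a z₃ = H a z₄) = 0 := by
        refine fun a => ind_false fun h => hy ?_
        rw [← h.1, ← h.2.1, ← h31, ← h42, h.2.2]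
      simp only [this, Finset.expect_const_zero]
      positivity
    · exact main z₄ z₁ z₂ y₁ y₁ h1 (fun h => hz (h31.trans h.symm)) h42
        fun a h => ⟨by rw [← h.2.2, h31, h.1], h.1, h.2.1⟩
  by_cases h32 : z₃ = z₂
  · by_cases h41 : z₄ = z₁
    · have : ∀ a, ind (H a z₁ = y₁ ∧ H a z₂ = y₂ ∧ H a z₃ = H a z₄) = 0 := by
        refine fun a => ind_false fun h => hy ?_
        rw [← h.1, ← h.2.1, ← h32, ← h41, h.2.2]
      simp only [this, Finset.expect_const_zero]
      positivity
    · exact main z₄ z₁ z₂ y₂ y₁ h1 h41 (fun h => hz (h32.trans h.symm))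
        fun a h => ⟨by rw [← h.2.2, h32, h.2.1], h.1, h.2.1⟩
  by_cases h41 : z₄ = z₁
  · exact main z₃ z₁ z₂ y₁ y₁ h1 h31 h32 fun a h => ⟨by rw [h.2.2, h41, h.1], h.1, h.2.1⟩
  by_cases h42 : z₄ = z₂
  · exact main z₃ z₁ z₂ y₂ y₁ h1 h31 h32 fun a h => ⟨by rw [h.2.2, h42, h.2.1], h.1, h.2.1⟩
  have hsum : ∀ a, ind (H a z₁ = y₁ ∧ H a z₂ = y₂ ∧ H a z₃ = H a z₄) ≤
      ∑ y : C, ind (H a z₁ = y₁ ∧ H a z₂ = y₂ ∧ H a z₃ = y ∧ H a z₄ = y) := by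
    intro a
    refine (ind_mono fun h => ⟨h.1, h.2.1, rfl, h.2.2.symm⟩).trans
      (Finset.single_le_sum (f := fun y => ind (H a z₁ = y₁ ∧ H a z₂ = y₂ ∧ H a z₃ = y ∧
        H a z₄ = y)) (fun _ _ => ind_nonneg _) (mem_univ (H a z₃)))
  refine (Finset.expect_le_expect fun a _ => hsum a).trans ?_
  rw [Finset.expect_sum_comm]
  refine (Finset.sum_le_sum fun y _ => hH.four_le z₁ z₂ z₃ z₄ h1 (Ne.symm h31) (Ne.symm h41)
    (Ne.symm h32) (Ne.symm h42) hz y₁ y₂ y y).trans ?_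
  rw [Finset.sum_const, Finset.card_univ, hC, nsmul_eq_mul]
  push_cast
  apply le_of_eq
  field_simp

end IsHash

/-! ### Lower bound for the probability of a hit -/

/-- Reading `d` cells in turn, where the next cell depends on the time and the value read last;
the value read first at a cell is the one that counts. -/
def fill {C V : Type} [DecidableEq C] (cell : ℕ → Option V → C) :
    (d : ℕ) → ℕ → Option V → (Fin d → V) → (C → V) → (C → V)
  | 0, _, _, _, g => g
  | d + 1, t, prev, ω, g =>
    Function.update (fill cell d (t + 1) (some (ω 0)) (Fin.tail ω) g) (cell t prev) (ω 0)

/-- The cell overwritten at each time depends only on values drawn earlier, so each overwriting is a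
resampling. Therefore the walk may be analysed with an independent sequence `ω` in place of the
values of `g`. -/
theorem expect_fill {C V : Type} [Fintype C] [DecidableEq C] [Fintype V] [Nonempty V]
    (cell : ℕ → Option V → C) (d t : ℕ) (prev : Option V) (Φ : (C → V) → ℝ) :
    𝔼 ω : Fin d → V, 𝔼 g, Φ (fill cell d t prev ω g) = 𝔼 g, Φ g := by
  induction d generalizing t prev Φ with
  | zero =>
    simp only [fill]
    rw [Finset.expect_const univ_nonempty]
  | succ d ih =>
    rw [expect_cons]
    simp only [fill, Fin.cons_zero, Fin.tail_cons]
    rw [← expect_expect_update (cell t prev) Φ]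
    exact Finset.expect_congr rfl fun v _ =>
      ih (t + 1) (some v) (fun g => Φ (Function.update g (cell t prev) v))

/-- The cells that `fill` reads, and the one that it would read next. -/
def fillCell {C V : Type} (cell : ℕ → Option V → C) {d : ℕ} (t : ℕ) (prev : Option V)
    (ω : Fin d → V) (r : Fin (d + 1)) : C :=
  cell (t + r) ((Fin.cons prev fun s => some (ω s) : Fin (d + 1) → Option V) r)

theorem fill_apply {C V : Type} [DecidableEq C] (cell : ℕ → Option V → C) (d t : ℕ)
    (prev : Option V) (ω : Fin d → V) (g : C → V) (s : Fin d)
    (hs : ∀ r : Fin d, r < s →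
      fillCell cell t prev ω r.castSucc ≠ fillCell cell t prev ω s.castSucc) :
    fill cell d t prev ω g (fillCell cell t prev ω s.castSucc) = ω s := by
  induction d generalizing t prev with
  | zero => exact s.elim0
  | succ d ih =>
    have e : ∀ r : Fin (d + 1), fillCell cell t prev ω r.succ =
        fillCell cell (t + 1) (some (ω 0)) (Fin.tail ω) r := by
      intro r
      unfold fillCell
      congr 1
      · simp; omega
      · refine Fin.cases ?_ (fun r => ?_) r
        · simp
        · simp [Fin.tail]
    refine Fin.cases (fun _ => ?_) (fun s hs => ?_) s hs
    · simp [fill, fillCell]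
    · have h0 := hs 0 (Fin.succ_pos s)
      rw [fill, Function.update_of_ne]
      · have e2 : s.succ.castSucc = s.castSucc.succ := rfl
        rw [e2, e]
        refine ih _ _ _ s fun r hr => ?_
        have := hs r.succ (Fin.succ_lt_succ_iff.2 hr)
        have e3 : r.succ.castSucc = r.castSucc.succ := rfl
        rwa [e3, e2, e, e] at this
      · intro h
        apply h0
        rw [h]
        simp [fillCell]

section FirstMoment

variable {C V : Type}

/-- The hash arguments of a walk that reads the values `ω` except that it reads `γ` at time `u`. -/
def pathArg (γ : V) (u : ℕ) {v : ℕ} (ω : Fin v → V) (r : Fin (v + 1)) : Option V :=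
  if (r : ℕ) = u + 1 then some γ else (Fin.cons none fun s => some (ω s) : Fin (v + 1) → Option V) r

theorem pathArg_zero (γ : V) (u : ℕ) {v : ℕ} (ω : Fin v → V) : pathArg γ u ω 0 = none := by
  simp [pathArg]

theorem pathArg_succ (γ : V) (u : ℕ) {v : ℕ} (ω : Fin v → V) (s : Fin v) :
    pathArg γ u ω s.succ = if (s : ℕ) = u then some γ else some (ω s) := by
  simp [pathArg]

/-- The path reaches `i` at time `u`, ends in `j`, and does not meet itself. -/
def GoodPath (h : Option V → C) (γ : V) (i j : C) (u : ℕ) {v : ℕ} (hu : u < v)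
    (ω : Fin v → V) : Prop :=
  h (pathArg γ u ω ⟨u, by omega⟩) = i ∧ h (pathArg γ u ω (Fin.last v)) = j ∧
    ∀ s t : Fin (v + 1), s < t → h (pathArg γ u ω s) ≠ h (pathArg γ u ω t)

/-- Induction along the path. Since the path never meets itself, the cell at each time is new and
the walk reads there the value drawn for it, except that it reads `γ` when it stands at `i`. -/
theorem GoodPath.hitsAt [DecidableEq C] {h : Option V → C} {γ : V} {i j : C} {u v : ℕ}
    {hu : u < v} {ω : Fin v → V} (H : GoodPath h γ i j u hu ω) (g : C → V) :
    HitsAt h (Function.update (fill (fun t prev => h (if t = u + 1 then some γ else prev)) v 0 none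
      ω g) i γ) i j u v := by
  set cell : ℕ → Option V → C := fun t prev => h (if t = u + 1 then some γ else prev)
  set G := Function.update (fill cell v 0 none ω g) i γ
  obtain ⟨h1, h2, h3⟩ := H
  have hcell : ∀ r, fillCell cell 0 none ω r = h (pathArg γ u ω r) := by
    intro r; simp [fillCell, cell, pathArg]
  have hw : ∀ r (hr : r < v + 1), walk h G r = h (pathArg γ u ω ⟨r, hr⟩) := by
    intro r
    induction r with
    | zero => intro hr; exact congrArg h (pathArg_zero γ u ω).symm
    | succ r ih =>
      intro hr
      have e1 := ih (by omega)
      rw [walk, e1]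
      have e2 := pathArg_succ γ u ω ⟨r, by omega⟩
      have e3 : (⟨r, by omega⟩ : Fin v).succ = ⟨r + 1, hr⟩ := rfl
      rw [e3] at e2
      rw [e2]
      -- The value drawn at time `u` is lost, because cell `i` is overwritten by `γ`; at all other
      -- times the path is away from `i`, and the overwriting is invisible.
      by_cases hru : r = u
      · subst hru
        simp [G, h1]
      · rw [if_neg hru]
        congr 2
        have hne : h (pathArg γ u ω ⟨r, by omega⟩) ≠ i := by
          rw [← h1]
          rcases lt_or_gt_of_ne hru with hlt | hgt
          · exact h3 _ _ hlt
          · exact (h3 _ _ hgt).symm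
        rw [show G = Function.update (fill cell v 0 none ω g) i γ from rfl,
          Function.update_of_ne hne]
        have := fill_apply cell v 0 none ω g ⟨r, by omega⟩ (fun s hs => ?_)
        · rw [hcell] at this
          exact this
        · rw [hcell, hcell]
          exact h3 _ _ hs
  refine ⟨hu, ?_, ?_, ?_⟩
  · rw [hw u (by omega), h1]
  · rw [hw v (by omega)]; exact h2
  · intro s t hs ht hst
    rw [hw s (by omega), hw t (by omega)] at hst
    by_contra hne
    rcases lt_or_gt_of_ne hne with hlt | hgt
    · exact h3 ⟨s, by omega⟩ ⟨t, by omega⟩ hlt hst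
    · exact h3 ⟨t, by omega⟩ ⟨s, by omega⟩ hgt hst.symm

theorem expect_goodPath_le [Fintype C] [DecidableEq C] [Fintype V] [Nonempty V]
    (h : Option V → C) (γ : V) (i j : C) {u v : ℕ} (hu : u < v) :
    𝔼 ω : Fin v → V, ind (GoodPath h γ i j u hu ω) ≤
      𝔼 g, ind (HitsAt h (Function.update g i γ) i j u v) := by
  rw [← expect_fill (fun t prev => h (if t = u + 1 then some γ else prev)) v 0 none]
  refine Finset.expect_le_expect fun ω _ => ?_
  rw [← Finset.expect_const (s := (univ : Finset (C → V)))
    (univ_nonempty_iff.2 ⟨fun _ => Classical.arbitrary V⟩) (ind (GoodPath h γ i j u hu ω))]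
  exact Finset.expect_le_expect fun g _ => ind_mono fun hg => hg.hitsAt g

/-- The argument `none` occurs at the start only. Of two later arguments at most one is the fixed
`γ`, so one of them is a uniform value independent of the other. -/
theorem expect_pathArg_eq_le [Fintype V] [Nonempty V] (γ : V) (u : ℕ) {v : ℕ}
    (s t : Fin (v + 1)) (hst : s < t) :
    𝔼 ω : Fin v → V, ind (pathArg γ u ω s = pathArg γ u ω t) ≤ 1 / Fintype.card V := by
  obtain ⟨t, rfl⟩ := Fin.exists_succ_eq.2 (ne_of_gt (lt_of_le_of_lt (Fin.zero_le s) hst))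
  by_cases hs0 : s = 0
  · subst hs0
    have : ∀ ω : Fin v → V, ind (pathArg γ u ω 0 = pathArg γ u ω t.succ) = 0 := by
      intro ω
      refine ind_false ?_
      rw [pathArg_zero, pathArg_succ]
      split_ifs <;> simp
    simp only [this, Finset.expect_const_zero]
    positivity
  obtain ⟨s, rfl⟩ := Fin.exists_succ_eq.2 hs0
  have hlt : s < t := Fin.succ_lt_succ_iff.1 hst
  simp only [pathArg_succ]
  by_cases h1 : (t : ℕ) = u
  · have h2 : (s : ℕ) ≠ u := by have : (s : ℕ) < t := hlt; omega
    simp only [h1, h2, if_true, if_false, Option.some_inj]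
    exact (expect_ind_apply_eq s (fun _ => γ) (fun _ _ => rfl)).le
  · by_cases h2 : (s : ℕ) = u
    · simp only [h1, h2, if_true, if_false, Option.some_inj]
      have := (expect_ind_apply_eq t (fun _ => γ) (fun _ _ => rfl)).le
      simpa only [eq_comm] using this
    · simp only [h1, h2, if_false, Option.some_inj]
      exact (expect_ind_apply_eq s (fun ω => ω t)
        (fun ω w => Function.update_of_ne (ne_of_gt hlt) _ _)).le

end FirstMoment

end KSum

/-! ### The mean hit probability -/

namespace KSum

/-- A walk without repetition is at `i` and at `j` at most once each, so the hits at different pairs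
of times exclude each other. -/
theorem sum_hitsAt_le {C V : Type} (h : Option V → C) (g : C → V) (ℓ : ℕ) {i j : C}
    (S : Finset (ℕ × ℕ)) (hS : ∀ uv ∈ S, uv.2 < ℓ) :
    ∑ uv ∈ S, ind (HitsAt h g i j uv.1 uv.2) ≤ ind (Hits h g ℓ i j) := by
  classical
  by_cases hex : ∃ uv ∈ S, HitsAt h g i j uv.1 uv.2
  · obtain ⟨⟨u, v⟩, huv, hit⟩ := hex
    rw [ind_true ⟨u, v, hS _ huv, hit⟩, sum_eq_single (u, v)]
    · exact ind_le_one _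
    · rintro ⟨u', v'⟩ h' hne
      refine ind_false fun hit' => hne ?_
      obtain ⟨a1, a2, a3, a4⟩ := hit
      obtain ⟨b1, b2, b3, b4⟩ := hit'
      simp only at a1 a2 a3 a4 b1 b2 b3 b4
      rcases le_total v v' with hle | hle
      · rw [b4 u' u (by omega) (by omega) (b2.trans a2.symm),
          b4 v' v (by omega) (by omega) (b3.trans a3.symm)]
      · rw [a4 u' u (by omega) (by omega) (b2.trans a2.symm),
          a4 v' v (by omega) (by omega) (b3.trans a3.symm)]
    · exact fun h => (h huv).elim
  · push Not at hex
    rw [sum_eq_zero fun uv huv => ind_false (hex uv huv)]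
    exact ind_nonneg _

section HitProbability

variable {𝓐 C V : Type} [Fintype 𝓐] [Fintype C] [DecidableEq C] [Fintype V]
  [Nonempty V] {n : ℕ} {H : 𝓐 → Option V → C}

/-- Start from the probability that the path is at `i` at time `u` and at `j` at time `v`, and
subtract for each pair of times the probability that the path also repeats itself there. There are
at most `ℓ ^ 2` such pairs, and `ℓ ^ 2` is small compared with `n`, so at least half of the main
term survives. -/
theorem expect_goodPath_ge (hH : IsHash n H) (hC : Fintype.card C = 2 * n)
    (hV : Fintype.card V = n) (hn : 2 ≤ n) (γ : V) {i j : C} (hij : i ≠ j) {u v ℓ : ℕ}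
    (hu : u < v) (hv : v < ℓ) (hℓ : 192 * ℓ ^ 2 ≤ n) :
    1 / (64 * (n : ℝ) ^ 2) ≤
      𝔼 a, 𝔼 ω : Fin v → V, ind (GoodPath (H a) γ i j u hu ω) := by
  classical
  have hn' : (2:ℝ) ≤ n := by exact_mod_cast hn
  have hn0 : (0:ℝ) < n := by linarith
  set zu : (Fin v → V) → Option V := fun ω => pathArg γ u ω ⟨u, by omega⟩
  set zv : (Fin v → V) → Option V := fun ω => pathArg γ u ω (Fin.last v)
  set S : Finset (Fin (v + 1) × Fin (v + 1)) := univ.filter fun st => st.1 < st.2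
  have hpt : ∀ a ω, ind (H a (zu ω) = i ∧ H a (zv ω) = j) - ∑ st ∈ S,
      ind (H a (zu ω) = i ∧ H a (zv ω) = j ∧
        H a (pathArg γ u ω st.1) = H a (pathArg γ u ω st.2)) ≤
      ind (GoodPath (H a) γ i j u hu ω) := by
    intro a ω
    have hs0 : 0 ≤ ∑ st ∈ S, ind (H a (zu ω) = i ∧ H a (zv ω) = j ∧
        H a (pathArg γ u ω st.1) = H a (pathArg γ u ω st.2)) :=
      sum_nonneg fun _ _ => ind_nonneg _
    by_cases h : H a (zu ω) = i ∧ H a (zv ω) = j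
    · by_cases hg : GoodPath (H a) γ i j u hu ω
      · rw [ind_true hg, ind_true h]; linarith
      · rw [ind_true h, ind_false hg]
        have : ∃ s t : Fin (v + 1), s < t ∧ H a (pathArg γ u ω s) = H a (pathArg γ u ω t) := by
          by_contra hcon
          push Not at hcon
          exact hg ⟨h.1, h.2, hcon⟩
        obtain ⟨s, t, hst, he⟩ := this
        have := single_le_sum (f := fun st : Fin (v + 1) × Fin (v + 1) =>
          ind (H a (zu ω) = i ∧ H a (zv ω) = j ∧
            H a (pathArg γ u ω st.1) = H a (pathArg γ u ω st.2))) (fun _ _ => ind_nonneg _)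
          (show (s, t) ∈ S by simp [S, hst])
        rw [ind_true ⟨h.1, h.2, he⟩] at this
        linarith
    · rw [ind_false h]
      have := ind_nonneg (GoodPath (H a) γ i j u hu ω)
      linarith
  -- The two arguments agree with probability at most `1 / n ≤ 1 / 2`, which turns the constant `16`
  -- into `32`.
  have hfirst : 1 / (32 * (n : ℝ) ^ 2) ≤
      𝔼 ω : Fin v → V, 𝔼 a, ind (H a (zu ω) = i ∧ H a (zv ω) = j) := by
    have h1 : ∀ ω : Fin v → V, 1 / (16 * (n : ℝ) ^ 2) - 1 / (16 * (n : ℝ) ^ 2) *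
        ind (zu ω = zv ω) ≤ 𝔼 a, ind (H a (zu ω) = i ∧ H a (zv ω) = j) := by
      intro ω
      by_cases h : zu ω = zv ω
      · rw [ind_true h, mul_one, sub_self]
        exact Finset.expect_nonneg fun _ _ => ind_nonneg _
      · rw [ind_false h, mul_zero, sub_zero]
        exact hH.two_ge _ _ h _ _
    refine le_trans ?_ (Finset.expect_le_expect fun ω _ => h1 ω)
    rw [Finset.expect_sub_distrib, Finset.expect_const univ_nonempty, ← Finset.mul_expect]
    have h2 : 𝔼 ω : Fin v → V, ind (zu ω = zv ω) ≤ 1 / 2 := by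
      refine (expect_pathArg_eq_le γ u _ _ (show (⟨u, by omega⟩ : Fin (v + 1)) < Fin.last v
        from hu)).trans ?_
      rw [hV]
      exact one_div_le_one_div_of_le (by norm_num) hn'
    have h3 : (0:ℝ) < 1 / (16 * (n : ℝ) ^ 2) := by positivity
    have h4 : 1 / (32 * (n : ℝ) ^ 2) = 1 / (16 * (n : ℝ) ^ 2) * (1 / 2) := by
      field_simp; norm_num
    rw [h4]
    nlinarith
  -- Distinct arguments collide under the hash function, together with the two prescribed cells,
  -- with probability at most `2 / n ^ 3`. Equal arguments occur with probability at most `1 / n`,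
  -- and then the two cells contribute `1 / n ^ 2`.
  have hpair : ∀ st ∈ S, 𝔼 ω : Fin v → V, 𝔼 a, ind (H a (zu ω) = i ∧ H a (zv ω) = j ∧
      H a (pathArg γ u ω st.1) = H a (pathArg γ u ω st.2)) ≤ 3 / (n : ℝ) ^ 3 := by
    rintro ⟨s, t⟩ hst
    have hst : s < t := by simpa [S] using hst
    have h1 : ∀ ω : Fin v → V, 𝔼 a, ind (H a (zu ω) = i ∧ H a (zv ω) = j ∧
        H a (pathArg γ u ω s) = H a (pathArg γ u ω t)) ≤
        2 / (n : ℝ) ^ 3 + 1 / (n : ℝ) ^ 2 * ind (pathArg γ u ω s = pathArg γ u ω t) := by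
      intro ω
      by_cases h : pathArg γ u ω s = pathArg γ u ω t
      · rw [ind_true h, mul_one]
        have : 𝔼 a, ind (H a (zu ω) = i ∧ H a (zv ω) = j ∧
            H a (pathArg γ u ω s) = H a (pathArg γ u ω t)) ≤ 1 / (n : ℝ) ^ 2 :=
          (Finset.expect_le_expect fun a _ => ind_mono fun h => ⟨h.1, h.2.1⟩).trans
            (hH.expect_two_le hij (zu ω) (zv ω))
        have : (0:ℝ) ≤ 2 / n ^ 3 := by positivity
        linarith
      · rw [ind_false h, mul_zero, add_zero]
        exact hH.expect_collision_le hC (by omega) hij _ _ _ _ h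
    refine (Finset.expect_le_expect fun ω _ => h1 ω).trans ?_
    rw [Finset.expect_add_distrib, Finset.expect_const univ_nonempty, ← Finset.mul_expect]
    have h2 := expect_pathArg_eq_le γ u s t hst
    rw [hV] at h2
    have h3 : (3:ℝ) / n ^ 3 = 2 / n ^ 3 + 1 / n ^ 2 * (1 / n) := by field_simp; norm_num
    rw [h3]
    gcongr
  have hcard : (S.card : ℝ) ≤ ℓ ^ 2 := by
    have h1 : S.card ≤ (v + 1) * (v + 1) := by
      refine (card_le_univ _).trans ?_
      simp
    have h2 : (v + 1) * (v + 1) ≤ ℓ ^ 2 := by rw [sq]; exact Nat.mul_le_mul hv hv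
    exact_mod_cast h1.trans h2
  have htot : 1 / (32 * (n : ℝ) ^ 2) - ℓ ^ 2 * (3 / (n : ℝ) ^ 3) ≤
      𝔼 a, 𝔼 ω : Fin v → V, ind (GoodPath (H a) γ i j u hu ω) := by
    rw [Finset.expect_comm]
    refine le_trans ?_ (Finset.expect_le_expect fun ω _ => Finset.expect_le_expect
      fun a _ => hpt a ω)
    simp only [Finset.expect_sub_distrib, Finset.expect_sum_comm]
    have : ∑ st ∈ S, 𝔼 ω : Fin v → V, 𝔼 a, ind (H a (zu ω) = i ∧ H a (zv ω) = j ∧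
        H a (pathArg γ u ω st.1) = H a (pathArg γ u ω st.2)) ≤ ℓ ^ 2 * (3 / (n : ℝ) ^ 3) := by
      refine (sum_le_sum hpair).trans ?_
      rw [sum_const, nsmul_eq_mul]
      gcongr
    linarith
  refine le_trans ?_ htot
  have hℓ' : 192 * (ℓ : ℝ) ^ 2 ≤ n := by exact_mod_cast hℓ
  -- This is the source of the constant `192 = 3 * 64`.
  have h5 : (ℓ : ℝ) ^ 2 * (3 / (n : ℝ) ^ 3) ≤ 1 / (64 * (n : ℝ) ^ 2) := by
    rw [mul_div_assoc', div_le_div_iff₀ (by positivity) (by positivity)]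
    have : (n : ℝ) ^ 3 = n * n ^ 2 := by ring
    rw [this]
    have h6 : (0:ℝ) ≤ n ^ 2 := by positivity
    nlinarith
  have h6 : 1 / (32 * (n : ℝ) ^ 2) = 1 / (64 * (n : ℝ) ^ 2) + 1 / (64 * (n : ℝ) ^ 2) := by
    field_simp; norm_num
  linarith

/-- Taking `u` in `[1, q]` and `v` in `[q + 1, 2 * q]` with `q = ℓ / 4` gives `q ^ 2` mutually
exclusive ways to hit, each with a probability of order `1 / n ^ 2`. -/
theorem expect_hits_ge (hH : IsHash n H) (hC : Fintype.card C = 2 * n)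
    (hV : Fintype.card V = n) (hn : 2 ≤ n) (γ : V) {i j : C} (hij : i ≠ j) {ℓ : ℕ}
    (hℓ4 : 4 ≤ ℓ) (hℓ : 192 * ℓ ^ 2 ≤ n) :
    (ℓ : ℝ) ^ 2 / (4096 * (n : ℝ) ^ 2) ≤
      𝔼 g : C → V, 𝔼 a, ind (Hits (H a) (Function.update g i γ) ℓ i j) := by
  have hn0 : (0:ℝ) < n := by
    have : 0 < n := by omega
    exact_mod_cast this
  set q := ℓ / 4 with hq
  set S : Finset (ℕ × ℕ) := Icc 1 q ×ˢ Icc (q + 1) (q + q) with hS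
  have hSv : ∀ uv ∈ S, uv.1 < uv.2 ∧ uv.2 < ℓ := by
    rintro ⟨u, v⟩ h
    simp only [hS, mem_product, mem_Icc] at h
    simp only
    omega
  have hlow : ∀ uv ∈ S, 1 / (64 * (n : ℝ) ^ 2) ≤
      𝔼 g : C → V, 𝔼 a, ind (HitsAt (H a) (Function.update g i γ) i j uv.1 uv.2) := by
    intro uv huv
    obtain ⟨h1, h2⟩ := hSv uv huv
    refine (expect_goodPath_ge hH hC hV hn γ hij h1 h2 hℓ).trans ?_
    rw [Finset.expect_comm (s := (univ : Finset (C → V)))]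
    exact Finset.expect_le_expect fun a _ => expect_goodPath_le (H a) γ i j h1
  have hle : ∑ uv ∈ S, 𝔼 g : C → V, 𝔼 a,
      ind (HitsAt (H a) (Function.update g i γ) i j uv.1 uv.2) ≤
      𝔼 g : C → V, 𝔼 a, ind (Hits (H a) (Function.update g i γ) ℓ i j) := by
    simp only [← Finset.expect_sum_comm]
    exact Finset.expect_le_expect fun g _ => Finset.expect_le_expect fun a _ =>
      sum_hitsAt_le _ _ _ _ fun uv huv => (hSv uv huv).2
  refine le_trans ?_ ((sum_le_sum hlow).trans hle)
  rw [sum_const, nsmul_eq_mul, hS, card_product, Nat.card_Icc, Nat.card_Icc]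
  have e1 : q + 1 - 1 = q := by omega
  have e2 : q + q + 1 - (q + 1) = q := by omega
  rw [e1, e2]
  -- The factor `8` instead of `4` covers the rounding in `ℓ / 4`, as `ℓ ≥ 4`; this yields `4096 =
  -- 64 * 8 ^ 2`.
  have hq8 : (ℓ : ℝ) ≤ 8 * q := by
    have : ℓ ≤ 8 * q := by omega
    exact_mod_cast this
  push_cast
  rw [mul_one_div, div_le_div_iff₀ (by positivity) (by positivity)]
  have h3 : (ℓ : ℝ) ^ 2 ≤ (8 * q) ^ 2 := by gcongr
  have h4 : (0:ℝ) ≤ n ^ 2 := by positivity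
  nlinarith

end HitProbability

end KSum

/-! ### Second moments, influences and concentration of the hit probability -/

namespace KSum

set_option linter.unusedSectionVars false

/-- On the event, the arithmetic–geometric mean inequality gives `X ≤ p / (4 * b ^ 2) * X ^ 2 + b ^
2 / p`; off it, `X < p / 2`. After averaging, the terms `p / 2` and `p / 4` leave `p / 4` to be
covered by the event. -/
theorem paley_zygmund {ι : Type} [Fintype ι] [Nonempty ι] (X : ι → ℝ) (p b : ℝ) (hp : 0 < p)
    (hb : 0 < b) (h1 : p ≤ 𝔼 g, X g) (h2 : 𝔼 g, X g ^ 2 ≤ b ^ 2) :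
    p ^ 2 / (4 * b ^ 2) ≤ 𝔼 g, ind (p / 2 ≤ X g) := by
  have key : ∀ g, X g ≤ p / 2 + (p / (4 * b ^ 2) * X g ^ 2 + b ^ 2 / p * ind (p / 2 ≤ X g)) := by
    intro g
    by_cases h : p / 2 ≤ X g
    · rw [ind_true h, mul_one]
      have e : p / (4 * b ^ 2) * X g ^ 2 + b ^ 2 / p - X g =
          p / (4 * b ^ 2) * (X g - 2 * b ^ 2 / p) ^ 2 := by
        field_simp; ring
      have : 0 ≤ p / (4 * b ^ 2) * (X g - 2 * b ^ 2 / p) ^ 2 := by positivity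
      linarith
    · rw [ind_false h, mul_zero, add_zero]
      have : 0 ≤ p / (4 * b ^ 2) * X g ^ 2 := by positivity
      push Not at h
      linarith
  have h3 := Finset.expect_le_expect (s := univ) fun g _ => key g
  rw [Finset.expect_add_distrib, Finset.expect_add_distrib, Finset.expect_const univ_nonempty,
    ← Finset.mul_expect, ← Finset.mul_expect] at h3
  set E := 𝔼 g, ind (p / 2 ≤ X g)
  have h4 : p / (4 * b ^ 2) * 𝔼 g, X g ^ 2 ≤ p / (4 * b ^ 2) * b ^ 2 := by gcongr
  have h5 : p / (4 * b ^ 2) * b ^ 2 = p / 4 := by field_simp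
  have h6 : p / 4 ≤ b ^ 2 / p * E := by linarith
  have h7 : p ^ 2 / (4 * b ^ 2) = p / 4 * (p / b ^ 2) := by field_simp
  have h8 : E = b ^ 2 / p * E * (p / b ^ 2) := by field_simp
  rw [h7, h8]
  gcongr

/-- The walk up to time `v` depends only on the values read before that time. In particular the
value at the final cell `j` is irrelevant. -/
theorem HitsAt.congr {C V : Type} {h : Option V → C} {g g' : C → V} {i j : C} {u v : ℕ}
    (hit : HitsAt h g i j u v) (hg : ∀ t < v, g (walk h g t) = g' (walk h g t)) :
    HitsAt h g' i j u v := by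
  have hw : ∀ t ≤ v, walk h g' t = walk h g t := by
    intro t
    induction t with
    | zero => exact fun _ => rfl
    | succ t ih =>
      intro ht
      rw [walk, walk, ih (by omega), hg t (by omega)]
  obtain ⟨h1, h2, h3, h4⟩ := hit
  refine ⟨h1, (hw u (by omega)).trans h2, (hw v le_rfl).trans h3, fun s t hs ht hst => ?_⟩
  rw [hw s hs, hw t ht] at hst
  exact h4 s t hs ht hst

theorem exists_arg_of_walk {C V : Type} (h : Option V → C) (g : C → V) (ℓ : ℕ) (X : Finset V)
    (hX : ∀ t < ℓ, g (walk h g t) ∈ X) (t : ℕ) (ht : t < ℓ) :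
    ∃ z ∈ X.insertNone, h z = walk h g t := by
  cases t with
  | zero => exact ⟨none, by simp, rfl⟩
  | succ t => exact ⟨some (g (walk h g t)), by simpa using hX t (by omega), rfl⟩

section Concentration

variable {𝓐 C V : Type} [Fintype 𝓐] [Nonempty 𝓐] [Fintype C] [DecidableEq C] [Fintype V]
  [DecidableEq V] [Nonempty V] {n : ℕ} {H : 𝓐 → Option V → C}

/-- A hit means that two arguments, each a value read or the initial `none`, are hashed to `i` and
`j`. By `expect_sq_le` it is enough to count pairs of arguments over a fixed set: there are at most
`(2 * ℓ + 2) ^ 2 ≤ (3 * ℓ) ^ 2`, each with probability at most `1 / n ^ 2`. -/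
theorem expect_hits_sq_le (hH : IsHash n H) (γ : V) {i j : C} (hij : i ≠ j) {ℓ : ℕ}
    (hℓ : 2 ≤ ℓ) :
    𝔼 g : C → V, (𝔼 a, ind (Hits (H a) (Function.update g i γ) ℓ i j)) ^ 2 ≤
      (9 * (ℓ : ℝ) ^ 2 / n ^ 2) ^ 2 := by
  refine expect_sq_le H ℓ i γ (fun a g => ind (Hits (H a) g ℓ i j)) (fun _ _ => ind_nonneg _)
    (fun a X => ∑ z ∈ X.insertNone ×ˢ X.insertNone, ind (H a z.1 = i ∧ H a z.2 = j))
    ?_ ?_ (fun _ _ => sum_nonneg fun _ _ => ind_nonneg _) _ ?_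
  · intro a X Y hXY
    have := Finset.insertNone.monotone hXY
    exact sum_le_sum_of_subset_of_nonneg (product_subset_product this this)
      fun _ _ _ => ind_nonneg _
  · intro a g X hX
    by_cases h : Hits (H a) g ℓ i j
    · obtain ⟨u, v, hv, huv, hu', hv', -⟩ := h
      obtain ⟨z₁, hz₁, e₁⟩ := exists_arg_of_walk _ _ _ _ hX u (by omega)
      obtain ⟨z₂, hz₂, e₂⟩ := exists_arg_of_walk _ _ _ _ hX v (by omega)
      refine (ind_le_one _).trans ?_
      rw [← ind_true (show H a (z₁, z₂).1 = i ∧ H a (z₁, z₂).2 = j from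
        ⟨e₁.trans hu', e₂.trans hv'⟩)]
      exact single_le_sum (f := fun z : Option V × Option V => ind (H a z.1 = i ∧ H a z.2 = j))
        (fun _ _ => ind_nonneg _) (mem_product.2 ⟨hz₁, hz₂⟩)
    · show ind (Hits (H a) g ℓ i j) ≤ _
      rw [ind_false h]
      exact sum_nonneg fun _ _ => ind_nonneg _
  · intro X hX
    rw [Finset.expect_sum_comm]
    refine (sum_le_sum fun z _ => hH.expect_two_le hij z.1 z.2).trans ?_
    rw [sum_const, card_product, card_insertNone, nsmul_eq_mul, mul_one_div]
    gcongr
    have : (X.card + 1) * (X.card + 1) ≤ (3 * ℓ) * (3 * ℓ) :=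
      Nat.mul_le_mul (by omega) (by omega)
    have h2 : (((X.card + 1) * (X.card + 1) : ℕ) : ℝ) ≤ (((3 * ℓ) * (3 * ℓ) : ℕ) : ℝ) := by
      exact_mod_cast this
    refine h2.trans (le_of_eq ?_)
    push_cast; ring

/-- The count of `expect_hits_sq_le` with triples in place of pairs, the third argument being hashed
to the visited cell `x`. -/
theorem expect_hits_visit_sq_le (hH : IsHash n H) (γ : V) {i j x : C} (hij : i ≠ j)
    (hix : i ≠ x) (hjx : j ≠ x) {ℓ : ℕ} (hℓ : 2 ≤ ℓ) :
    𝔼 g : C → V, (𝔼 a, ind (Hits (H a) (Function.update g i γ) ℓ i j ∧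
        ∃ t < ℓ, walk (H a) (Function.update g i γ) t = x)) ^ 2 ≤
      (27 * (ℓ : ℝ) ^ 3 / n ^ 3) ^ 2 := by
  refine expect_sq_le H ℓ i γ (fun a g => ind (Hits (H a) g ℓ i j ∧ ∃ t < ℓ, walk (H a) g t = x))
    (fun _ _ => ind_nonneg _)
    (fun a X => ∑ z ∈ X.insertNone ×ˢ X.insertNone ×ˢ X.insertNone,
      ind (H a z.1 = i ∧ H a z.2.1 = j ∧ H a z.2.2 = x))
    ?_ ?_ (fun _ _ => sum_nonneg fun _ _ => ind_nonneg _) _ ?_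
  · intro a X Y hXY
    have := Finset.insertNone.monotone hXY
    exact sum_le_sum_of_subset_of_nonneg (product_subset_product this
      (product_subset_product this this)) fun _ _ _ => ind_nonneg _
  · intro a g X hX
    by_cases h : Hits (H a) g ℓ i j ∧ ∃ t < ℓ, walk (H a) g t = x
    · obtain ⟨⟨u, v, hv, huv, hu', hv', -⟩, t, ht, ht'⟩ := h
      obtain ⟨z₁, hz₁, e₁⟩ := exists_arg_of_walk _ _ _ _ hX u (by omega)
      obtain ⟨z₂, hz₂, e₂⟩ := exists_arg_of_walk _ _ _ _ hX v (by omega)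
      obtain ⟨z₃, hz₃, e₃⟩ := exists_arg_of_walk _ _ _ _ hX t ht
      refine (ind_le_one _).trans ?_
      rw [← ind_true (show H a (z₁, z₂, z₃).1 = i ∧ H a (z₁, z₂, z₃).2.1 = j ∧
        H a (z₁, z₂, z₃).2.2 = x from ⟨e₁.trans hu', e₂.trans hv', e₃.trans ht'⟩)]
      exact single_le_sum (f := fun z : Option V × Option V × Option V =>
          ind (H a z.1 = i ∧ H a z.2.1 = j ∧ H a z.2.2 = x))
        (fun _ _ => ind_nonneg _) (mem_product.2 ⟨hz₁, mem_product.2 ⟨hz₂, hz₃⟩⟩)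
    · show ind (Hits (H a) g ℓ i j ∧ ∃ t < ℓ, walk (H a) g t = x) ≤ _
      rw [ind_false h]
      exact sum_nonneg fun _ _ => ind_nonneg _
  · intro X hX
    rw [Finset.expect_sum_comm]
    refine (sum_le_sum fun z _ => hH.expect_three_le hij hix hjx z.1 z.2.1 z.2.2).trans ?_
    rw [sum_const, card_product, card_product, card_insertNone, nsmul_eq_mul, mul_one_div]
    gcongr
    have : (X.card + 1) * ((X.card + 1) * (X.card + 1)) ≤ (3 * ℓ) * ((3 * ℓ) * (3 * ℓ)) :=
      Nat.mul_le_mul (by omega) (Nat.mul_le_mul (by omega) (by omega))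
    have h2 : (((X.card + 1) * ((X.card + 1) * (X.card + 1)) : ℕ) : ℝ) ≤
        (((3 * ℓ) * ((3 * ℓ) * (3 * ℓ)) : ℕ) : ℝ) := by
      exact_mod_cast this
    refine h2.trans (le_of_eq ?_)
    push_cast; ring

/-- How much the probability of a hit depends on the value at `x`. -/
noncomputable def influence (H : 𝓐 → Option V → C) (ℓ : ℕ) (i j : C) (g : C → V) (x : C) : ℝ :=
  if x = i ∨ x = j then 0 else 𝔼 a, ind (Hits (H a) g ℓ i j ∧ ∃ t < ℓ, walk (H a) g t = x)

theorem influence_nonneg (ℓ : ℕ) (i j : C) (g : C → V) (x : C) : 0 ≤ influence H ℓ i j g x := by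
  unfold influence
  split_ifs
  · exact le_rfl
  · exact Finset.expect_nonneg fun _ _ => ind_nonneg _

/-- If `g` hits and `g'` does not, the walk of `g` meets, before it reaches `j`, a cell where the
functions differ. This cell is not `j`, and it is not `i` because they agree there. That agreement
matters: every hit visits `i`, so the influence of `i` would be as large as the hit probability
itself. -/
theorem expect_hits_sub_le (ℓ : ℕ) (i j : C) (g g' : C → V) (hi : g i = g' i) :
    (𝔼 a, ind (Hits (H a) g ℓ i j)) - 𝔼 a, ind (Hits (H a) g' ℓ i j) ≤
      ∑ x, influence H ℓ i j g x * (if g x ≠ g' x then 1 else 0) := by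
  have key : ∀ a, ind (Hits (H a) g ℓ i j) - ind (Hits (H a) g' ℓ i j) ≤
      ∑ x, (if x = i ∨ x = j then 0 else ind (Hits (H a) g ℓ i j ∧ ∃ t < ℓ, walk (H a) g t = x)) *
        (if g x ≠ g' x then 1 else 0) := by
    intro a
    have hterm : ∀ x ∈ (univ : Finset C), 0 ≤ (if x = i ∨ x = j then 0 else
        ind (Hits (H a) g ℓ i j ∧ ∃ t < ℓ, walk (H a) g t = x)) *
        (if g x ≠ g' x then (1:ℝ) else 0) := by
      intro x _
      apply mul_nonneg
      · split_ifs
        · exact le_rfl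
        · exact ind_nonneg _
      · split_ifs <;> norm_num
    by_cases h : Hits (H a) g ℓ i j
    · by_cases h' : Hits (H a) g' ℓ i j
      · rw [ind_true h, ind_true h', sub_self]
        exact sum_nonneg hterm
      · obtain ⟨u, v, hv, hit⟩ := id h
        have : ∃ t < v, g (walk (H a) g t) ≠ g' (walk (H a) g t) := by
          by_contra hcon
          push Not at hcon
          exact h' ⟨u, v, hv, hit.congr hcon⟩
        obtain ⟨t, ht, hne⟩ := this
        set x := walk (H a) g t with hx
        have hxi : x ≠ i := by rintro rfl; exact hne hi
        have hxj : x ≠ j := by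
          intro hxj
          have := hit.2.2.2 t v (by omega) le_rfl (hxj.trans hit.2.2.1.symm)
          omega
        refine le_trans ?_ (single_le_sum hterm (mem_univ x))
        rw [ind_true h, ind_false h', if_neg (by tauto), if_pos hne,
          ind_true ⟨h, t, by omega, hx.symm⟩]
        norm_num
    · rw [ind_false h]
      have := ind_nonneg (Hits (H a) g' ℓ i j)
      have := sum_nonneg hterm
      linarith
  rw [← Finset.expect_sub_distrib]
  refine (Finset.expect_le_expect fun a _ => key a).trans (le_of_eq ?_)
  rw [Finset.expect_sum_comm]
  refine sum_congr rfl fun x _ => ?_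
  rw [← Finset.expect_mul, influence]
  split_ifs <;> simp

theorem expect_influence_sq_le (hH : IsHash n H) (hC : Fintype.card C = 2 * n) (γ : V) {i j : C}
    (hij : i ≠ j) {ℓ : ℕ} (hℓ : 2 ≤ ℓ) :
    𝔼 g : C → V, ∑ x, influence H ℓ i j (Function.update g i γ) x ^ 2 ≤
      2 * n * (27 * (ℓ : ℝ) ^ 3 / n ^ 3) ^ 2 := by
  rw [Finset.expect_sum_comm]
  have : ∀ x ∈ (univ : Finset C), 𝔼 g : C → V,
      influence H ℓ i j (Function.update g i γ) x ^ 2 ≤ (27 * (ℓ : ℝ) ^ 3 / n ^ 3) ^ 2 := by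
    intro x _
    unfold influence
    by_cases hx : x = i ∨ x = j
    · simp only [hx, if_true]
      rw [Finset.expect_const (univ_nonempty_iff.2 ⟨fun _ => Classical.arbitrary V⟩)]
      exact pow_le_pow_left₀ le_rfl (by positivity) 2
    · simp only [hx, if_false]
      push Not at hx
      exact expect_hits_visit_sq_le hH γ hij hx.1.symm hx.2.symm hℓ
  refine (sum_le_sum this).trans ?_
  rw [sum_const, card_univ, hC, nsmul_eq_mul]
  push_cast
  exact le_rfl

theorem expect_fix_value (i : C) (γ : V) (hV : Fintype.card V = n) (Q : (C → V) → Prop) :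
    𝔼 g, ind (g i = γ ∧ Q g) = 1 / n * 𝔼 g, ind (Q (Function.update g i γ)) := by
  rw [← expect_expect_update i]
  have : ∀ v, 𝔼 g : C → V, ind (Function.update g i v i = γ ∧ Q (Function.update g i v)) =
      ind (v = γ) * 𝔼 g, ind (Q (Function.update g i γ)) := by
    intro v
    by_cases h : v = γ
    · subst h
      simp [ind_true]
    · rw [ind_false h, zero_mul]
      simp only [Function.update_self]
      rw [Finset.expect_eq_zero]
      exact fun g _ => ind_false fun h' => h h'.1
  simp only [this]
  rw [← Finset.expect_mul, expect_ind_eq, hV]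

/-- The probability of a hit, over the hash function, is small for few `g` only. -/
theorem exists_expect_few_hits_le : ∃ κ : ℝ, 0 < κ ∧ ∃ K : ℝ, 0 < K ∧
    ∀ {𝓐 C V : Type} [Fintype 𝓐] [Nonempty 𝓐] [Fintype C] [DecidableEq C] [Fintype V]
      [DecidableEq V] [Nonempty V] {n : ℕ} {H : 𝓐 → Option V → C}, IsHash n H →
      Fintype.card C = 2 * n → Fintype.card V = n → 2 ≤ n → ∀ {i j : C}, i ≠ j → ∀ {ℓ : ℕ},
      4 ≤ ℓ → 192 * ℓ ^ 2 ≤ n →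
      𝔼 g : C → V, ind (𝔼 a, ind (Hits (H a) g ℓ i j) < (ℓ : ℝ) ^ 2 / (16384 * (n : ℝ) ^ 2)) ≤
        K * (n : ℝ) ^ 2 * Real.exp (-(κ * (n / (ℓ : ℝ) ^ 2))) := by
  -- The Paley–Zygmund bound `p ^ 2 / (4 * b ^ 2)` for the moment estimates above, since `b / p = 9
  -- * 4096 = 36864`.
  set δ : ℝ := 1 / (4 * 36864 ^ 2) with hδ
  have hδ0 : 0 < δ := by rw [hδ]; norm_num
  refine ⟨δ / (4096 ^ 2 * 512 * 729), by positivity, 2 / δ, by positivity, ?_⟩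
  intro 𝓐 C V _ _ _ _ _ _ _ n H hH hC hV hn i j hij ℓ hℓ4 hℓ
  have hn0 : (0:ℝ) < n := by
    have : 0 < n := by omega
    exact_mod_cast this
  have hl0 : (0:ℝ) < ℓ := by
    have : 0 < ℓ := by omega
    exact_mod_cast this
  set X : (C → V) → ℝ := fun g => 𝔼 a, ind (Hits (H a) g ℓ i j) with hX
  set p : ℝ := (ℓ : ℝ) ^ 2 / (4096 * (n : ℝ) ^ 2) with hp
  have hp0 : 0 < p := by positivity
  -- The bound on the mean sum of squared influences times `2 / δ`, so that by Markov's inequality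
  -- it is exceeded with probability at most `δ / 2`.
  set Vb : ℝ := 4 * n * (27 * (ℓ : ℝ) ^ 3 / n ^ 3) ^ 2 / δ with hVb
  have hVb0 : 0 < Vb := by positivity
  have hp4 : (ℓ : ℝ) ^ 2 / (16384 * (n : ℝ) ^ 2) = p / 4 := by
    rw [hp]; field_simp; norm_num
  rw [hp4]
  -- The value at `i` is fixed, since changes at this cell are not controlled by the influences.
  have main : ∀ γ : V, 𝔼 g, ind (g i = γ ∧ X g < p / 4) ≤
      2 / δ * n * Real.exp (-(δ / (4096 ^ 2 * 512 * 729) * (n / (ℓ : ℝ) ^ 2))) := by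
    intro γ
    have hpz := paley_zygmund (fun g : C → V => X (Function.update g i γ)) p
      (9 * (ℓ : ℝ) ^ 2 / n ^ 2) hp0 (by positivity) (expect_hits_ge hH hC hV hn γ hij hℓ4 hℓ)
      (expect_hits_sq_le hH γ hij (by omega))
    have hδ' : p ^ 2 / (4 * (9 * (ℓ : ℝ) ^ 2 / n ^ 2) ^ 2) = δ := by
      rw [hp, hδ]; field_simp; norm_num
    rw [hδ'] at hpz
    set Y : (C → V) → ℝ := fun g => ∑ x, influence H ℓ i j g x ^ 2 with hY
    have hmk : 𝔼 g : C → V, ind (Vb < Y (Function.update g i γ)) ≤ δ / 2 := by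
      have h1 : ∀ g : C → V, ind (Vb < Y (Function.update g i γ)) ≤
          1 / Vb * Y (Function.update g i γ) := by
        intro g
        by_cases h : Vb < Y (Function.update g i γ)
        · rw [ind_true h, one_div, ← div_eq_inv_mul, le_div_iff₀ hVb0, one_mul]; exact h.le
        · rw [ind_false h]
          exact mul_nonneg (by positivity) (sum_nonneg fun _ _ => sq_nonneg _)
      refine (Finset.expect_le_expect fun g _ => h1 g).trans ?_
      rw [← Finset.mul_expect]
      calc _ ≤ 1 / Vb * (2 * n * (27 * (ℓ : ℝ) ^ 3 / n ^ 3) ^ 2) := by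
            gcongr
            exact expect_influence_sq_le hH hC γ hij (by omega)
        _ = δ / 2 := by rw [hVb]; field_simp; norm_num
    set A : Set (C → V) := {g | g i = γ ∧ X g < p / 4} with hA
    set B : Set (C → V) := {g | g i = γ ∧ (p / 2 ≤ X g ∧ Y g ≤ Vb)} with hB
    -- Fixing the value at `i` costs the factor `1 / n`. Of the conditional probability `δ`,
    -- Markov's inequality takes away at most half.
    have hBd : 1 / n * (δ / 2) ≤ density B := by
      rw [hB, density_setOf, expect_fix_value i γ hV]
      gcongr
      have : ∀ g : C → V, ind (p / 2 ≤ X (Function.update g i γ)) -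
          ind (Vb < Y (Function.update g i γ)) ≤
          ind (p / 2 ≤ X (Function.update g i γ) ∧ Y (Function.update g i γ) ≤ Vb) := by
        intro g
        by_cases h : Vb < Y (Function.update g i γ)
        · rw [ind_true h]
          have := ind_le_one (p / 2 ≤ X (Function.update g i γ))
          have := ind_nonneg (p / 2 ≤ X (Function.update g i γ) ∧ Y (Function.update g i γ) ≤ Vb)
          linarith
        · rw [ind_false h, sub_zero]
          exact ind_mono fun h' => ⟨h', not_lt.1 h⟩
      refine le_trans ?_ (Finset.expect_le_expect fun g _ => this g)
      rw [Finset.expect_sub_distrib]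
      linarith
    have htal := density_mul_density_le A B (influence H ℓ i j)
      (fun g x => influence_nonneg ℓ i j g x) Vb (p / 4) hVb0 (by positivity)
      (fun g hg => hg.2.2) (fun g hg g' hg' => by
        refine le_trans ?_ (expect_hits_sub_le ℓ i j g g' (hg.1.trans hg'.1.symm))
        have h1 : p / 2 ≤ X g := hg.2.1
        have h2 : X g' < p / 4 := hg'.2
        show p / 4 ≤ X g - X g'
        linarith)
    have hexp : (p / 4) ^ 2 / (8 * Vb) = δ / (4096 ^ 2 * 512 * 729) * (n / (ℓ : ℝ) ^ 2) := by
      rw [hp, hVb]; field_simp; norm_num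
    rw [hexp] at htal
    have hAd : density A * (1 / n * (δ / 2)) ≤
        Real.exp (-(δ / (4096 ^ 2 * 512 * 729) * (n / (ℓ : ℝ) ^ 2))) :=
      (mul_le_mul_of_nonneg_left hBd (density_nonneg A)).trans htal
    rw [← density_setOf]
    calc density A = 2 / δ * n * (density A * (1 / n * (δ / 2))) := by field_simp
      _ ≤ _ := by gcongr
  -- The `n` possible values at `i` are treated separately. Together with the density `1 / n` of
  -- each in the set `B` this explains the factor `n ^ 2` of the bound.
  have hsplit : ∀ g : C → V, ind (X g < p / 4) ≤ ∑ γ, ind (g i = γ ∧ X g < p / 4) := by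
    intro g
    refine (ind_mono fun h => ⟨rfl, h⟩).trans (single_le_sum
      (f := fun γ => ind (g i = γ ∧ X g < p / 4)) (fun _ _ => ind_nonneg _) (mem_univ (g i)))
  refine (Finset.expect_le_expect fun g _ => hsplit g).trans ?_
  rw [Finset.expect_sum_comm]
  refine (sum_le_sum fun γ _ => main γ).trans ?_
  rw [sum_const, card_univ, hV, nsmul_eq_mul]
  apply le_of_eq; ring

end Concentration

end KSum

/-! ### Hashing by cubic polynomials over a prime field -/

namespace KSum

/-- A polynomial of degree at most three with coefficients `a`. -/
def cubic {F : Type} [CommRing F] (a : Fin 4 → F) (x : F) : F :=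
  ((a 3 * x + a 2) * x + a 1) * x + a 0

section Field

variable {F : Type} [Field F]

theorem cubic_sub (a b : Fin 4 → F) (x : F) : cubic (a - b) x = cubic a x - cubic b x := by
  simp [cubic]; ring

/-- The first divided difference of the cubic at its two roots. Repeating the division with a third
and a fourth root lowers the degree each time; so the values at some points and the remaining
leading coefficients determine the polynomial. -/
theorem cubic_two_roots {d : Fin 4 → F} {x y : F} (hxy : x ≠ y) (hx : cubic d x = 0)
    (hy : cubic d y = 0) : d 1 + d 2 * (x + y) + d 3 * (x ^ 2 + x * y + y ^ 2) = 0 := by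
  apply (mul_eq_zero.1 (?_ : (x - y) * _ = 0)).resolve_left (sub_ne_zero.2 hxy)
  simp only [cubic] at hx hy
  linear_combination hx - hy

theorem cubic_three_roots {d : Fin 4 → F} {x y z : F} (hxy : x ≠ y) (hxz : x ≠ z) (hyz : y ≠ z)
    (hx : cubic d x = 0) (hy : cubic d y = 0) (hz : cubic d z = 0) :
    d 2 + d 3 * (x + y + z) = 0 := by
  apply (mul_eq_zero.1 (?_ : (y - z) * _ = 0)).resolve_left (sub_ne_zero.2 hyz)
  linear_combination cubic_two_roots hxy hx hy - cubic_two_roots hxz hx hz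

theorem cubic_four_roots {d : Fin 4 → F} {x y z w : F} (hxy : x ≠ y) (hxz : x ≠ z) (hxw : x ≠ w)
    (hyz : y ≠ z) (hyw : y ≠ w) (hzw : z ≠ w)
    (hx : cubic d x = 0) (hy : cubic d y = 0) (hz : cubic d z = 0) (hw : cubic d w = 0) :
    d 3 = 0 := by
  apply (mul_eq_zero.1 (?_ : (z - w) * _ = 0)).resolve_left (sub_ne_zero.2 hzw)
  linear_combination cubic_three_roots hxy hxz hyz hx hy hz - cubic_three_roots hxy hxw hyw hx hy hw

theorem eq_zero_of_two_roots {d : Fin 4 → F} {x y : F} (hxy : x ≠ y) (hx : cubic d x = 0)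
    (hy : cubic d y = 0) (h2 : d 2 = 0) (h3 : d 3 = 0) : d = 0 := by
  have h1 := cubic_two_roots hxy hx hy
  simp only [h2, h3, zero_mul, add_zero] at h1
  have h0 : d 0 = 0 := by simpa [cubic, h1, h2, h3] using hx
  ext k; fin_cases k <;> simpa

/-- The two leading coefficients are free, so two prescribed values are taken by at least one
polynomial for each choice of them; this serves the lower bound on pair probabilities. -/
theorem exists_interpolation {x y : F} (hxy : x ≠ y) (b₂ b₃ r s : F) :
    ∃ a : Fin 4 → F, a 2 = b₂ ∧ a 3 = b₃ ∧ cubic a x = r ∧ cubic a y = s := by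
  set c := ((r - (b₃ * x + b₂) * x * x) - (s - (b₃ * y + b₂) * y * y)) / (x - y) with hc
  have hc' : c * (x - y) = (r - (b₃ * x + b₂) * x * x) - (s - (b₃ * y + b₂) * y * y) :=
    div_mul_cancel₀ _ (sub_ne_zero.2 hxy)
  refine ⟨![r - ((b₃ * x + b₂) * x + c) * x, c, b₂, b₃], rfl, rfl, ?_, ?_⟩
  · simp [cubic]
  · simp only [cubic, Matrix.cons_val]
    linear_combination -hc'

variable [Fintype F]

/-- Counting: `ψ` describes a polynomial by values at some points and by leading coefficients, and
it maps the event injectively into a box. -/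
theorem expect_ind_le_of_injective (P : (Fin 4 → F) → Prop) (ψ : (Fin 4 → F) → Fin 4 → F)
    (hψ : ψ.Injective) (S : Fin 4 → Finset F) (h : ∀ a, P a → ∀ k, ψ a k ∈ S k) :
    𝔼 a, ind (P a) ≤ (∏ k, ((S k).card : ℝ)) / (Fintype.card F : ℝ) ^ 4 := by
  classical
  rw [Fintype.expect_eq_sum_div_card]
  have hc : (Fintype.card (Fin 4 → F) : ℝ) = (Fintype.card F : ℝ) ^ 4 := by simp
  rw [hc]
  gcongr
  have : ∑ a, ind (P a) = ((univ.filter P).card : ℝ) := by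
    rw [card_filter]; push_cast; rfl
  rw [this]
  have h2 : (univ.filter P).card ≤ (Fintype.piFinset S).card :=
    card_le_card_of_injOn ψ (fun a ha => by
      rw [mem_coe, Fintype.mem_piFinset]; exact h a (by simpa using ha)) hψ.injOn
  rw [Fintype.card_piFinset] at h2
  exact_mod_cast h2

end Field

/-- The point of `ZMod p` at which the polynomial is evaluated to hash `z`. -/
def hashPoint (n p : ℕ) (z : Option (Fin n)) : ZMod p := ((z.elim n (fun v => (v : ℕ)) : ℕ) : ZMod p)

/-- Hashing by a random polynomial of degree at most three. -/
def polyHash (n p : ℕ) [NeZero n] (a : Fin 4 → ZMod p) (z : Option (Fin n)) : Fin (2 * n) :=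
  ⟨(cubic a (hashPoint n p z)).val % (2 * n),
    Nat.mod_lt _ (Nat.mul_pos two_pos (Nat.pos_of_ne_zero (NeZero.ne n)))⟩

theorem hashPoint_injective {n p : ℕ} (hp : n < p) : (hashPoint n p).Injective := by
  intro z z' h
  have hlt : ∀ z : Option (Fin n), z.elim n (fun v => (v : ℕ)) < p := by
    rintro (_ | v)
    · exact hp
    · exact v.2.trans hp
  have h2 := (ZMod.natCast_eq_natCast_iff' _ _ _).1 h
  rw [Nat.mod_eq_of_lt (hlt z), Nat.mod_eq_of_lt (hlt z')] at h2
  rcases z with _ | v <;> rcases z' with _ | v'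
  · rfl
  · simp at h2; have := v'.2; omega
  · simp at h2; have := v.2; omega
  · simp at h2; rw [Fin.ext h2]

/-- The elements of `ZMod p` that are mapped to the cell `y`. -/
def preCell (n p : ℕ) (y : ℕ) : Finset (ZMod p) := {(y : ZMod p), ((y + 2 * n : ℕ) : ZMod p)}

theorem card_preCell_le (n p y : ℕ) : (preCell n p y).card ≤ 2 := card_le_two

/-- A residue is below `p ≤ 4 * n`, so its quotient by `2 * n` is `0` or `1`. -/
theorem mem_preCell {n p : ℕ} [NeZero p] (hp : p ≤ 4 * n) {r : ZMod p} {y : ℕ}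
    (h : r.val % (2 * n) = y) : r ∈ preCell n p y := by
  have h1 := ZMod.val_lt r
  have h2 := Nat.div_add_mod r.val (2 * n)
  have h3 : r.val / (2 * n) < 2 := Nat.div_lt_of_lt_mul (by omega)
  rw [h] at h2
  have h4 : r = ((r.val : ℕ) : ZMod p) := (ZMod.natCast_zmod_val r).symm
  rw [preCell, mem_insert, mem_singleton]
  interval_cases hd : r.val / (2 * n)
  · left; rw [h4]; congr 1; omega
  · right; rw [h4]; congr 1; omega

/-- A random cubic has independent uniform values at up to four points. At most two residues are
mapped to a given cell, which gives `2 / p ≤ 1 / n` for each point. At least one is, the number of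
the cell itself because of `2 * n < p`, and this gives `1 / p ^ 2 ≥ 1 / (16 * n ^ 2)` for two
points. -/
theorem isHash_polyHash (n p : ℕ) [NeZero n] [Fact p.Prime] (h1 : 2 * n < p) (h2 : p ≤ 4 * n) :
    IsHash n (polyHash n p) := by
  have hn : 0 < n := Nat.pos_of_ne_zero (NeZero.ne n)
  have hn0 : (0:ℝ) < n := by exact_mod_cast hn
  have hp0 : (0:ℝ) < p := by exact_mod_cast (by omega : 0 < p)
  have h1' : 2 * (n:ℝ) ≤ p := by exact_mod_cast h1.le
  have hcard : Fintype.card (ZMod p) = p := ZMod.card p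
  have hpt : ∀ {z z' : Option (Fin n)}, z ≠ z' → hashPoint n p z ≠ hashPoint n p z' :=
    fun h => (hashPoint_injective (by omega)).ne h
  have hmem : ∀ {a : Fin 4 → ZMod p} {z y}, polyHash n p a z = y →
      cubic a (hashPoint n p z) ∈ preCell n p y := fun h => mem_preCell h2 (Fin.ext_iff.1 h)
  have hval : ∀ {a b : Fin 4 → ZMod p} {x}, cubic a x = cubic b x → cubic (a - b) x = 0 :=
    fun h => by rw [cubic_sub, h, sub_self]
  have hc2 : ∀ y, ((preCell n p y).card : ℝ) ≤ 2 := fun y => by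
    exact_mod_cast card_preCell_le n p y
  have hunivc : ((univ : Finset (ZMod p)).card : ℝ) = p := by rw [card_univ, hcard]
  have hq : (2:ℝ) / p ≤ 1 / n := by
    rw [div_le_div_iff₀ hp0 hn0]; linarith
  refine ⟨fun z₁ z₂ hz y₁ y₂ => ?_, fun z₁ z₂ hz y₁ y₂ => ?_,
    fun z₁ z₂ z₃ h12 h13 h23 y₁ y₂ y₃ => ?_,
    fun z₁ z₂ z₃ z₄ h12 h13 h14 h23 h24 h34 y₁ y₂ y₃ y₄ => ?_⟩
  · classical
    choose f hf using fun b : ZMod p × ZMod p =>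
      exists_interpolation (hpt hz) b.1 b.2 ((y₁ : ℕ) : ZMod p) ((y₂ : ℕ) : ZMod p)
    have hfinj : f.Injective := by
      intro b b' h
      ext
      · rw [← (hf b).1, ← (hf b').1, h]
      · rw [← (hf b).2.1, ← (hf b').2.1, h]
    have hhit : ∀ b, polyHash n p (f b) z₁ = y₁ ∧ polyHash n p (f b) z₂ = y₂ := by
      intro b
      constructor
      · apply Fin.ext
        rw [polyHash]
        simp only [(hf b).2.2.1]
        rw [ZMod.val_natCast, Nat.mod_eq_of_lt (show (y₁ : ℕ) < p by have := y₁.2; omega),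
          Nat.mod_eq_of_lt y₁.2]
      · apply Fin.ext
        rw [polyHash]
        simp only [(hf b).2.2.2]
        rw [ZMod.val_natCast, Nat.mod_eq_of_lt (show (y₂ : ℕ) < p by have := y₂.2; omega),
          Nat.mod_eq_of_lt y₂.2]
    rw [Fintype.expect_eq_sum_div_card]
    have hc : (Fintype.card (Fin 4 → ZMod p) : ℝ) = (p : ℝ) ^ 4 := by simp
    have hs : (p : ℝ) ^ 2 ≤ ∑ a : Fin 4 → ZMod p, ind (polyHash n p a z₁ = y₁ ∧
        polyHash n p a z₂ = y₂) := by
      have e : (p : ℝ) ^ 2 = ∑ a ∈ univ.image f, ind (polyHash n p a z₁ = y₁ ∧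
          polyHash n p a z₂ = y₂) := by
        rw [sum_image fun _ _ _ _ h => hfinj h]
        simp only [ind_true (hhit _)]
        rw [sum_const, card_univ, Fintype.card_prod, hcard]
        simp [sq]
      rw [e]
      exact sum_le_sum_of_subset_of_nonneg (subset_univ _) fun _ _ _ => ind_nonneg _
    rw [hc, le_div_iff₀ (by positivity)]
    refine le_trans ?_ hs
    rw [div_mul_eq_mul_div, one_mul, div_le_iff₀ (by positivity)]
    have h3 : (p:ℝ) ≤ 4 * n := by exact_mod_cast h2
    have h4 : (p:ℝ) ^ 2 ≤ (4 * n) ^ 2 := by gcongr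
    have h5 : (0:ℝ) ≤ p ^ 2 := by positivity
    nlinarith
  · refine (expect_ind_le_of_injective _
      (fun a => ![cubic a (hashPoint n p z₁), cubic a (hashPoint n p z₂), a 2, a 3]) ?_
      ![preCell n p y₁, preCell n p y₂, univ, univ] ?_).trans ?_
    · intro a b h
      have e := congrFun h
      have e0 := e 0; have e1 := e 1; have e2 := e 2; have e3 := e 3
      simp only [Matrix.cons_val] at e0 e1 e2 e3
      refine sub_eq_zero.1 (eq_zero_of_two_roots (hpt hz) (hval e0) (hval e1) ?_ ?_)
      · rw [Pi.sub_apply, e2, sub_self]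
      · rw [Pi.sub_apply, e3, sub_self]
    · rintro a ⟨ha1, ha2⟩ k
      fin_cases k
      · exact hmem ha1
      · exact hmem ha2
      · exact mem_univ _
      · exact mem_univ _
    · rw [Fin.prod_univ_four, hcard]
      simp only [Matrix.cons_val, hunivc]
      calc _ ≤ 2 * 2 * (p:ℝ) * p / p ^ 4 := by gcongr <;> apply hc2
        _ = (2 / p) ^ 2 := by field_simp
        _ ≤ (1 / n) ^ 2 := by gcongr
        _ = _ := by rw [one_div_pow]
  · refine (expect_ind_le_of_injective _
      (fun a => ![cubic a (hashPoint n p z₁), cubic a (hashPoint n p z₂),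
        cubic a (hashPoint n p z₃), a 3]) ?_
      ![preCell n p y₁, preCell n p y₂, preCell n p y₃, univ] ?_).trans ?_
    · intro a b h
      have e := congrFun h
      have e0 := e 0; have e1 := e 1; have e2 := e 2; have e3 := e 3
      simp only [Matrix.cons_val] at e0 e1 e2 e3
      have r3 : (a - b) 3 = 0 := by rw [Pi.sub_apply, e3, sub_self]
      have r2 := cubic_three_roots (hpt h12) (hpt h13) (hpt h23) (hval e0) (hval e1) (hval e2)
      rw [r3, zero_mul, add_zero] at r2
      exact sub_eq_zero.1 (eq_zero_of_two_roots (hpt h12) (hval e0) (hval e1) r2 r3)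
    · rintro a ⟨ha1, ha2, ha3⟩ k
      fin_cases k
      · exact hmem ha1
      · exact hmem ha2
      · exact hmem ha3
      · exact mem_univ _
    · rw [Fin.prod_univ_four, hcard]
      simp only [Matrix.cons_val, hunivc]
      calc _ ≤ 2 * 2 * 2 * (p:ℝ) / p ^ 4 := by gcongr <;> apply hc2
        _ = (2 / p) ^ 3 := by field_simp
        _ ≤ (1 / n) ^ 3 := by gcongr
        _ = _ := by rw [one_div_pow]
  · refine (expect_ind_le_of_injective _
      (fun a => ![cubic a (hashPoint n p z₁), cubic a (hashPoint n p z₂),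
        cubic a (hashPoint n p z₃), cubic a (hashPoint n p z₄)]) ?_
      ![preCell n p y₁, preCell n p y₂, preCell n p y₃, preCell n p y₄] ?_).trans ?_
    · intro a b h
      have e := congrFun h
      have e0 := e 0; have e1 := e 1; have e2 := e 2; have e3 := e 3
      simp only [Matrix.cons_val] at e0 e1 e2 e3
      have r3 := cubic_four_roots (hpt h12) (hpt h13) (hpt h14) (hpt h23) (hpt h24) (hpt h34)
        (hval e0) (hval e1) (hval e2) (hval e3)
      have r2 := cubic_three_roots (hpt h12) (hpt h13) (hpt h23) (hval e0) (hval e1) (hval e2)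
      rw [r3, zero_mul, add_zero] at r2
      exact sub_eq_zero.1 (eq_zero_of_two_roots (hpt h12) (hval e0) (hval e1) r2 r3)
    · rintro a ⟨ha1, ha2, ha3, ha4⟩ k
      fin_cases k
      · exact hmem ha1
      · exact hmem ha2
      · exact hmem ha3
      · exact hmem ha4
    · rw [Fin.prod_univ_four, hcard]
      simp only [Matrix.cons_val]
      calc _ ≤ 2 * 2 * 2 * 2 / (p:ℝ) ^ 4 := by gcongr <;> apply hc2
        _ = (2 / p) ^ 4 := by field_simp
        _ ≤ (1 / n) ^ 4 := by gcongr
        _ = _ := by rw [one_div_pow]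

end KSum

/-! ### From random lists to random functions, and the union bound -/

namespace KSum

theorem expect_comp_eq_of_card_fiber {W G : Type} [Fintype W] [Nonempty W] [Fintype G]
    [DecidableEq G] (f : W → G) (N : ℕ) (hN : ∀ g, (univ.filter fun w => f w = g).card = N)
    (F : G → ℝ) : 𝔼 w, F (f w) = 𝔼 g, F g := by
  rw [Fintype.expect_eq_sum_div_card, Fintype.expect_eq_sum_div_card]
  have h1 : ∑ w, F (f w) = N * ∑ g, F g := by
    rw [← sum_fiberwise (s := (univ : Finset W)) (g := f), mul_sum]
    refine sum_congr rfl fun g _ => ?_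
    rw [sum_congr rfl (g := fun _ => F g) fun w hw => by rw [(mem_filter.1 hw).2], sum_const,
      hN, nsmul_eq_mul]
  have h2 : (Fintype.card W : ℝ) = N * Fintype.card G := by
    have : Fintype.card W = Fintype.card G * N := by
      rw [← card_univ, card_eq_sum_card_fiberwise (f := f) (t := univ) (fun _ _ => mem_univ _)]
      simp [hN]
    rw [this]; push_cast; ring
  have h3 : (Fintype.card W : ℝ) ≠ 0 := by exact_mod_cast Fintype.card_ne_zero
  have h4 : (N : ℝ) ≠ 0 := by rintro h; rw [h2, h, zero_mul] at h3; exact h3 rfl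
  rw [h1, h2, mul_div_mul_left _ _ h4]

/-- On each of the `q` blocks of `n` consecutive numbers, `φ` is injective and hence bijective; so
every value has one preimage per block. -/
theorem card_fiber_of_modEq {n q m : ℕ} (hm : m = q * n) (φ : Fin m → Fin n)
    (h : ∀ e e', φ e = φ e' → (e : ℕ) % n = e' % n) (v : Fin n) :
    (univ.filter fun e => φ e = v).card = q := by
  classical
  subst hm
  have hbij : ∀ a : Fin q, Function.Bijective fun b : Fin n => φ (finProdFinEquiv (a, b)) := by
    intro a
    rw [← Finite.injective_iff_bijective]
    intro b b' hb
    have := h _ _ hb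
    simp only [finProdFinEquiv_apply_val, Nat.add_mul_mod_self_left] at this
    rw [Nat.mod_eq_of_lt b.2, Nat.mod_eq_of_lt b'.2] at this
    exact Fin.ext this
  choose b hb hb' using fun a => (hbij a).existsUnique v
  have : (univ.filter fun e => φ e = v) =
      univ.image fun a : Fin q => finProdFinEquiv (a, b a) := by
    ext e
    simp only [mem_filter, mem_univ, true_and, mem_image]
    constructor
    · intro he
      obtain ⟨⟨a, c⟩, rfl⟩ := finProdFinEquiv.surjective e
      exact ⟨a, by rw [← hb' a c he]⟩
    · rintro ⟨a, rfl⟩; exact hb a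
  rw [this, card_image_of_injective, card_univ, Fintype.card_fin]
  intro a a' haa
  exact (Prod.ext_iff.1 (finProdFinEquiv.injective haa)).1

/-- The value in a cell: cells `x < n` are the positions of list `0`, the others are those of
list `1`. Cells of the two lists have equal values if and only if their integers add up to `B`
modulo `n`. -/
def cellVal {k n m : ℕ} (hk : 2 ≤ k) (hn : 0 < n) (w : Lists k n m) (B : ℕ) (x : Fin (2 * n)) :
    Fin n :=
  if h : (x : ℕ) < n then ⟨value w ⟨0, by omega⟩ ⟨x, h⟩ % n, Nat.mod_lt _ hn⟩
  else ⟨(B - value w ⟨1, by omega⟩ ⟨x - n, by have := x.2; omega⟩) % n, Nat.mod_lt _ hn⟩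

theorem add_one_mod_inj {n a b : ℕ} (h : (a + 1) % n = (b + 1) % n) : a % n = b % n :=
  Nat.ModEq.add_right_cancel' 1 h

theorem sub_mod_inj {n B a b : ℕ} (ha : a ≤ B) (hb : b ≤ B) (h : (B - a) % n = (B - b) % n) :
    a % n = b % n := by
  have h1 : (B - a) ≡ (B - b) [MOD n] := h
  have h2 := (h1.add_right a).add_right b
  rw [Nat.sub_add_cancel ha, add_right_comm, Nat.sub_add_cancel hb] at h2
  exact (Nat.ModEq.add_left_cancel' B h2).symm

/-- As `n ∣ m`, a uniform element of `[m]` has a uniform residue modulo `n`, and so has `B` minus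
it; `m ≤ B` keeps the truncated subtraction exact. Different cells use different entries, hence are
independent. -/
theorem expect_cellVal {k n m : ℕ} (hk : 2 ≤ k) (hn : 0 < n) (hm : 0 < m) (hnm : n ∣ m) (B : ℕ)
    (hB : m ≤ B) (F : (Fin (2 * n) → Fin n) → ℝ) :
    𝔼 w : Lists k n m, F (cellVal hk hn w B) = 𝔼 g, F g := by
  classical
  have : Nonempty (Fin m) := ⟨⟨0, hm⟩⟩
  obtain ⟨q, rfl⟩ := hnm
  have hk0 : 0 < k := by omega
  have hk1 : 1 < k := by omega
  set φ₀ : Fin (n * q) → Fin n := fun e => ⟨((e : ℕ) + 1) % n, Nat.mod_lt _ hn⟩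
  set φ₁ : Fin (n * q) → Fin n := fun e => ⟨(B - ((e : ℕ) + 1)) % n, Nat.mod_lt _ hn⟩
  have hφ₀ : ∀ v, (univ.filter fun e => φ₀ e = v).card = q :=
    card_fiber_of_modEq (mul_comm _ _) φ₀ fun e e' h => add_one_mod_inj (Fin.ext_iff.1 h)
  have hφ₁ : ∀ v, (univ.filter fun e => φ₁ e = v).card = q := by
    refine card_fiber_of_modEq (mul_comm _ _) φ₁ fun e e' h => ?_
    have h1 := e.2
    have h2 := e'.2
    exact add_one_mod_inj (sub_mod_inj (by omega) (by omega) (Fin.ext_iff.1 h))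
  set S : (Fin (2 * n) → Fin n) → Fin k → Fin n → Finset (Fin (n * q)) := fun g i j =>
    if (i : ℕ) = 0 then univ.filter fun e => φ₀ e = g ⟨j, by omega⟩
    else if (i : ℕ) = 1 then univ.filter fun e => φ₁ e = g ⟨j + n, by omega⟩
    else univ with hS
  -- The fibre over `g` is a product set: every entry of the first two lists is constrained on its
  -- own, and all other entries are free.
  have hfib : ∀ g, (univ.filter fun w : Lists k n (n * q) => cellVal hk hn w B = g) =
      Fintype.piFinset fun i => Fintype.piFinset fun j => S g i j := by
    intro g
    ext w
    simp only [mem_filter, mem_univ, true_and, Fintype.mem_piFinset]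
    constructor
    · rintro rfl i j
      rw [hS]
      dsimp only
      split_ifs with h0 h1
      · rw [mem_filter]
        refine ⟨mem_univ _, ?_⟩
        obtain rfl : i = ⟨0, hk0⟩ := Fin.ext h0
        simp [cellVal, φ₀, value]
      · rw [mem_filter]
        refine ⟨mem_univ _, ?_⟩
        obtain rfl : i = ⟨1, hk1⟩ := Fin.ext h1
        simp [cellVal, φ₁, value]
      · exact mem_univ _
    · intro h
      ext x
      rw [cellVal]
      split_ifs with hx
      · have := h ⟨0, by omega⟩ ⟨x, hx⟩
        simp only [hS, if_true, mem_filter, mem_univ, true_and, φ₀] at this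
        rw [← this]
        rfl
      · have h' := h ⟨1, by omega⟩ ⟨x - n, by have := x.2; omega⟩
        simp only [hS, one_ne_zero, if_false, if_true, mem_filter, mem_univ, true_and, φ₁] at h'
        have e : (⟨x - n + n, by have := x.2; omega⟩ : Fin (2 * n)) = x := by
          apply Fin.ext; simp only; omega
        rw [e] at h'
        rw [← h']
        rfl
  refine expect_comp_eq_of_card_fiber (fun w : Lists k n (n * q) => cellVal hk hn w B)
    (∏ i : Fin k, ∏ _j : Fin n, if (i : ℕ) = 0 then q else if (i : ℕ) = 1 then q else n * q)
    (fun g => ?_) F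
  rw [hfib, Fintype.card_piFinset]
  refine prod_congr rfl fun i _ => ?_
  rw [Fintype.card_piFinset]
  refine prod_congr rfl fun j _ => ?_
  simp only [hS]
  split_ifs
  · exact hφ₀ _
  · exact hφ₁ _
  · simp

/-- Only the residue of `B` matters. Therefore `n` representatives stand for all targets and all
choices in the other lists. -/
theorem cellVal_mod {k n m : ℕ} (hk : 2 ≤ k) (hn : 0 < n) (hnm : n ∣ m) (w : Lists k n m) (B : ℕ)
    (hB : m ≤ B) : cellVal hk hn w B = cellVal hk hn w (m + B % n) := by
  ext x
  unfold cellVal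
  split_ifs with h
  · rfl
  · simp only
    set v := value w ⟨1, by omega⟩ ⟨x - n, by have := x.2; omega⟩ with hv
    have hvm : v ≤ m := by rw [hv]; exact (w _ _).2
    have h1 : B - v + v ≡ m + B % n - v + v [MOD n] := by
      rw [Nat.sub_add_cancel (by omega), Nat.sub_add_cancel (by omega)]
      obtain ⟨q, rfl⟩ := hnm
      simp [Nat.ModEq]
    exact Nat.ModEq.add_right_cancel' v h1

/-- The probability that a random hash function makes the walk hit cell `i` of list `0` and cell
`j` of list `1`. -/
noncomputable def hitProb {k n m : ℕ} (hk : 2 ≤ k) (hn : 0 < n) (w : Lists k n m) (p : ℕ)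
    [Fact p.Prime] (ℓ B : ℕ) (i j : Fin n) : ℝ :=
  haveI : NeZero n := ⟨hn.ne'⟩
  𝔼 a : Fin 4 → ZMod p, ind (Hits (polyHash n p a) (cellVal hk hn w B) ℓ ⟨i, by omega⟩
    ⟨j + n, by omega⟩)

/-- The walk may start in `i` and proceed to `j` at once. The two arguments involved, `none` and a
value, differ, so the lower bound for pairs applies. This handles small `n`, for every choice of
lists. -/
theorem hitProb_ge {k n m : ℕ} (hk : 2 ≤ k) (hn : 0 < n) (w : Lists k n m) (p : ℕ)
    [Fact p.Prime] (h1 : 2 * n < p) (h2 : p ≤ 4 * n) {ℓ : ℕ} (hℓ : 2 ≤ ℓ) (B : ℕ) (i j : Fin n) :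
    1 / (16 * (n : ℝ) ^ 2) ≤ hitProb hk hn w p ℓ B i j := by
  have : NeZero n := ⟨hn.ne'⟩
  have hi : (⟨i, by omega⟩ : Fin (2 * n)) ≠ ⟨j + n, by omega⟩ := by
    intro h
    have := Fin.ext_iff.1 h
    simp only at this
    omega
  refine ((isHash_polyHash n p h1 h2).two_ge none
    (some (cellVal hk hn w B ⟨i, by omega⟩)) (by simp) ⟨i, by omega⟩ ⟨j + n, by omega⟩).trans ?_
  refine Finset.expect_le_expect fun a _ => ind_mono ?_
  rintro ⟨ha, hb⟩
  have w0 : walk (polyHash n p a) (cellVal hk hn w B) 0 = ⟨i, by omega⟩ := ha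
  have w1 : walk (polyHash n p a) (cellVal hk hn w B) 1 = ⟨j + n, by omega⟩ := by
    rw [walk, w0, hb]
  refine ⟨0, 1, by omega, zero_lt_one, w0, w1, fun s t hs ht hst => ?_⟩
  interval_cases s <;> interval_cases t
  · rfl
  · rw [w0, w1] at hst; exact (hi hst).elim
  · rw [w0, w1] at hst; exact (hi hst.symm).elim
  · rfl

/-- A union bound over the residue of `B` and the pair `i`, `j`. Since it covers all `B` at once,
the target may be chosen after the lists. -/
theorem expect_bad_le {k n m : ℕ} (hk : 2 ≤ k) (hn : 0 < n) (hm : 0 < m) (hnm : n ∣ m) (p : ℕ)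
    [Fact p.Prime] (ℓ : ℕ) (θ ε : ℝ)
    (h : ∀ i j : Fin n, haveI : NeZero n := ⟨hn.ne'⟩
      𝔼 g : Fin (2 * n) → Fin n, ind ((𝔼 a : Fin 4 → ZMod p, ind (Hits (polyHash n p a) g ℓ
        ⟨i, by omega⟩ ⟨j + n, by omega⟩)) < θ) ≤ ε) :
    𝔼 w : Lists k n m, ind (∃ B, m ≤ B ∧ ∃ i j, hitProb hk hn w p ℓ B i j < θ) ≤
      (n : ℝ) ^ 3 * ε := by
  have : NeZero n := ⟨hn.ne'⟩
  have hpt : ∀ w : Lists k n m, ind (∃ B, m ≤ B ∧ ∃ i j, hitProb hk hn w p ℓ B i j < θ) ≤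
      ∑ x : Fin n × Fin n × Fin n, ind (hitProb hk hn w p ℓ (m + x.1) x.2.1 x.2.2 < θ) := by
    intro w
    by_cases hex : ∃ B, m ≤ B ∧ ∃ i j, hitProb hk hn w p ℓ B i j < θ
    · obtain ⟨B, hB, i, j, hlt⟩ := hex
      have e : hitProb hk hn w p ℓ (m + B % n) i j = hitProb hk hn w p ℓ B i j := by
        unfold hitProb
        rw [cellVal_mod hk hn hnm w B hB]
      set f : Fin n × Fin n × Fin n → ℝ := fun x =>
        ind (hitProb hk hn w p ℓ (m + x.1) x.2.1 x.2.2 < θ) with hf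
      have hone : f (⟨B % n, Nat.mod_lt _ hn⟩, i, j) = 1 := by
        rw [hf]
        refine ind_true ?_
        rw [e]
        exact hlt
      calc _ ≤ (1:ℝ) := ind_le_one _
        _ = f (⟨B % n, Nat.mod_lt _ hn⟩, i, j) := hone.symm
        _ ≤ _ := single_le_sum (f := f) (fun _ _ => ind_nonneg _) (mem_univ _)
    · rw [ind_false hex]
      exact sum_nonneg fun _ _ => ind_nonneg _
  refine (Finset.expect_le_expect fun w _ => hpt w).trans ?_
  rw [Finset.expect_sum_comm]
  have : ∀ x ∈ (univ : Finset (Fin n × Fin n × Fin n)),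
      𝔼 w : Lists k n m, ind (hitProb hk hn w p ℓ (m + x.1) x.2.1 x.2.2 < θ) ≤ ε := by
    rintro ⟨b, i, j⟩ -
    refine le_trans (le_of_eq ?_) (h i j)
    exact expect_cellVal hk hn hm hnm (m + b) (Nat.le_add_right _ _) (fun g =>
      ind ((𝔼 a : Fin 4 → ZMod p, ind (Hits (polyHash n p a) g ℓ
        ⟨i, by omega⟩ ⟨j + n, by omega⟩)) < θ))
  refine (sum_le_sum this).trans (le_of_eq ?_)
  rw [sum_const, card_univ, nsmul_eq_mul]
  simp [pow_succ, mul_assoc]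

/-- The Gaussian factor in `L` beats every power of `2 ^ L`. The exponent `5` is made up of three
from the union bound and two from the concentration estimate. -/
theorem exists_threshold (κ K : ℝ) (hκ : 0 < κ) (hK : 0 < K) : ∃ L₀ : ℕ, ∀ L : ℕ, L₀ ≤ L →
    192 ≤ L ∧ 128 * L ^ 2 < 2 ^ L ∧
      K * ((2:ℝ) ^ L) ^ 5 * Real.exp (-(κ * (L : ℝ) ^ 2)) ≤ 1 / 2 := by
  have h1 : ∀ᶠ L : ℕ in Filter.atTop, 192 ≤ L := Filter.eventually_ge_atTop 192
  have h2 : ∀ᶠ L : ℕ in Filter.atTop, 5 / κ + |Real.log (2 * K)| / κ + 1 ≤ (L : ℝ) :=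
    tendsto_natCast_atTop_atTop.eventually_ge_atTop _
  obtain ⟨L₀, h⟩ := Filter.eventually_atTop.1 (h1.and h2)
  refine ⟨max L₀ 192, fun L hL => ?_⟩
  obtain ⟨h1, h2⟩ := h L ((le_max_left _ _).trans hL)
  refine ⟨h1, ?_, ?_⟩
  · have : ∀ L : ℕ, 20 ≤ L → 128 * L ^ 2 < 2 ^ L := by
      intro L hL
      induction L, hL using Nat.le_induction with
      | base => norm_num
      | succ L hL ih =>
        have h3 : (L + 1) ^ 2 ≤ 2 * L ^ 2 := by nlinarith
        rw [pow_succ 2 L]; omega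
    exact this L (by omega)
  · have h3 : 5 + |Real.log (2 * K)| + κ ≤ κ * L := by
      have := mul_le_mul_of_nonneg_left h2 hκ.le
      have e : κ * (5 / κ + |Real.log (2 * K)| / κ + 1) = 5 + |Real.log (2 * K)| + κ := by
        field_simp
      linarith
    have hL1 : (1:ℝ) ≤ L := by exact_mod_cast (by omega : 1 ≤ L)
    have h4 : (2:ℝ) ^ L ≤ Real.exp L := by
      rw [← Real.exp_one_pow]
      exact pow_le_pow_left₀ (by norm_num) (by have := Real.add_one_le_exp (1:ℝ); linarith) _
    have h5 : Real.log (2 * K) + 5 * L - κ * (L : ℝ) ^ 2 ≤ 0 := by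
      have h6 := le_abs_self (Real.log (2 * K))
      have h7 := abs_nonneg (Real.log (2 * K))
      nlinarith
    have h6 : 2 * K = Real.exp (Real.log (2 * K)) := (Real.exp_log (by positivity)).symm
    have h7 : 2 * K * ((2:ℝ) ^ L) ^ 5 * Real.exp (-(κ * (L : ℝ) ^ 2)) ≤ 1 := by
      calc _ ≤ 2 * K * (Real.exp L) ^ 5 * Real.exp (-(κ * (L : ℝ) ^ 2)) := by gcongr
        _ = Real.exp (Real.log (2 * K) + 5 * L - κ * (L : ℝ) ^ 2) := by
          rw [← Real.exp_nat_mul, sub_eq_add_neg, Real.exp_add, Real.exp_add, ← h6]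
          push_cast; ring
        _ ≤ 1 := Real.exp_le_one_iff.2 h5
    linarith

/-- For at least half of the lists, the walk hits every pair of cells with sufficient
probability. -/
theorem exists_hitProb_ge : ∃ ρ : ℝ, 0 < ρ ∧ ∀ (k n m : ℕ) (hk : 2 ≤ k) (hn : 0 < n), 0 < m →
    n ∣ m → ∀ (p : ℕ) [Fact p.Prime], 2 * n < p → p ≤ 4 * n → ∀ L ℓ : ℕ, p ≤ 2 ^ L →
    2 ^ L < 2 * p → 2 ≤ ℓ → (ℓ = 2 ∨ (ℓ * L) ^ 2 < n) → n ≤ ((ℓ + 1) * L) ^ 2 →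
    1 / 2 ≤ 𝔼 w : Lists k n m, ind (∀ B, m ≤ B → ∀ i j,
      ρ * ((ℓ : ℝ) ^ 2 / n ^ 2) ≤ hitProb hk hn w p ℓ B i j) := by
  obtain ⟨κ, hκ, K, hK, hmain⟩ := exists_expect_few_hits_le
  obtain ⟨L₀, hL₀⟩ := exists_threshold κ K hκ hK
  -- The first constant comes from the concentration estimate and serves large `n`; the second is
  -- small enough for the trivial bound when `n ≤ 2 ^ L₀`.
  refine ⟨min (1 / 16384) (1 / (64 * 2 ^ L₀)), by positivity, ?_⟩
  intro k n m hk hn hm hnm p _ h1 h2 L ℓ hL1 hL2 hℓ hℓ1 hℓ2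
  have : NeZero n := ⟨hn.ne'⟩
  have : Nonempty (Fin m) := ⟨⟨0, hm⟩⟩
  have : Nonempty (Fin n) := ⟨⟨0, hn⟩⟩
  have hn0 : (0:ℝ) < n := by exact_mod_cast hn
  have hnL : n ≤ 2 ^ L := by omega
  by_cases hL : L₀ ≤ L
  · obtain ⟨hL3, hL4, hL5⟩ := hL₀ L hL
    -- Otherwise `n ≤ (4 * L) ^ 2`, which contradicts `128 * L ^ 2 < 2 ^ L < 8 * n`.
    have hℓ4 : 4 ≤ ℓ := by
      by_contra hcon
      have : (ℓ + 1) * L ≤ 4 * L := Nat.mul_le_mul_right _ (by omega)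
      have h3 : ((ℓ + 1) * L) ^ 2 ≤ (4 * L) ^ 2 := Nat.pow_le_pow_left this 2
      nlinarith
    have hlt : (ℓ * L) ^ 2 < n := hℓ1.resolve_left (by omega)
    have h192 : 192 * ℓ ^ 2 ≤ n := by
      have : 192 ≤ L ^ 2 := by nlinarith
      have h3 : (ℓ * L) ^ 2 = ℓ ^ 2 * L ^ 2 := by ring
      nlinarith [Nat.mul_le_mul_left (ℓ ^ 2) this]
    have hn2 : 2 ≤ n := by nlinarith
    have hbad := expect_bad_le hk hn hm hnm p ℓ ((ℓ : ℝ) ^ 2 / (16384 * (n : ℝ) ^ 2)) _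
      (fun i j => hmain (isHash_polyHash n p h1 h2) (by simp) (by simp) hn2
        (i := ⟨i, by omega⟩) (j := ⟨j + n, by omega⟩)
        (by intro h; have := Fin.ext_iff.1 h; simp only at this; omega) hℓ4 h192)
    have hfin : (n : ℝ) ^ 3 * (K * (n : ℝ) ^ 2 * Real.exp (-(κ * (n / (ℓ : ℝ) ^ 2)))) ≤ 1 / 2 := by
      refine le_trans ?_ hL5
      have hnL' : (n : ℝ) ≤ 2 ^ L := by exact_mod_cast hnL
      have hl0 : (0:ℝ) < ℓ := by exact_mod_cast (by omega : 0 < ℓ)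
      have h3 : (L : ℝ) ^ 2 ≤ n / (ℓ : ℝ) ^ 2 := by
        rw [le_div_iff₀ (by positivity)]
        have : ((ℓ * L) ^ 2 : ℕ) ≤ n := hlt.le
        have h4 : (((ℓ * L) ^ 2 : ℕ) : ℝ) ≤ n := by exact_mod_cast this
        push_cast at h4
        linarith [mul_pow (ℓ : ℝ) (L : ℝ) 2]
      calc _ = K * (n : ℝ) ^ 5 * Real.exp (-(κ * (n / (ℓ : ℝ) ^ 2))) := by ring
        _ ≤ _ := by gcongr
    have hsum : ∀ w : Lists k n m, 1 - ind (∃ B, m ≤ B ∧ ∃ i j, hitProb hk hn w p ℓ B i j <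
        (ℓ : ℝ) ^ 2 / (16384 * (n : ℝ) ^ 2)) ≤ ind (∀ B, m ≤ B → ∀ i j,
      min (1 / 16384) (1 / (64 * 2 ^ L₀)) * ((ℓ : ℝ) ^ 2 / n ^ 2) ≤ hitProb hk hn w p ℓ B i j) := by
      intro w
      by_cases hw : ∃ B, m ≤ B ∧ ∃ i j, hitProb hk hn w p ℓ B i j <
        (ℓ : ℝ) ^ 2 / (16384 * (n : ℝ) ^ 2)
      · rw [ind_true hw, sub_self]; exact ind_nonneg _
      · rw [ind_false hw, ind_true]
        · norm_num
        push Not at hw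
        intro B hB i j
        refine le_trans ?_ (hw B hB i j)
        calc _ ≤ 1 / 16384 * ((ℓ : ℝ) ^ 2 / n ^ 2) := by gcongr; exact min_le_left _ _
          _ = _ := by field_simp
    refine le_trans ?_ (Finset.expect_le_expect fun w _ => hsum w)
    rw [Finset.expect_sub_distrib, Finset.expect_const univ_nonempty]
    have := hbad.trans hfin
    linarith
  -- Now `n ≤ 2 ^ L₀`, and with `ℓ ^ 2 ≤ 4 * n` the claimed bound is at most the `1 / (16 * n ^ 2)`
  -- that holds for all lists.
  · push Not at hL
    have hall : ∀ w : Lists k n m, ind (∀ B, m ≤ B → ∀ i j,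
      min (1 / 16384) (1 / (64 * 2 ^ L₀)) * ((ℓ : ℝ) ^ 2 / n ^ 2) ≤
        hitProb hk hn w p ℓ B i j) = 1 := by
      intro w
      refine ind_true fun B _ i j => ?_
      refine le_trans ?_ (hitProb_ge hk hn w p h1 h2 hℓ B i j)
      have hℓn : ℓ ^ 2 ≤ 4 * n := by
        rcases hℓ1 with rfl | h
        · omega
        · have : 1 ≤ L := by
            by_contra hcon
            have : L = 0 := by omega
            subst this
            omega
          have h3 : ℓ ^ 2 ≤ (ℓ * L) ^ 2 := Nat.pow_le_pow_left (Nat.le_mul_of_pos_right _ this) 2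
          omega
      have hnL₀ : n ≤ 2 ^ L₀ := hnL.trans (Nat.pow_le_pow_right (by norm_num) hL.le)
      have hℓ' : (ℓ : ℝ) ^ 2 ≤ 4 * 2 ^ L₀ := by
        have : ℓ ^ 2 ≤ 4 * 2 ^ L₀ := by omega
        exact_mod_cast this
      calc _ ≤ 1 / (64 * 2 ^ L₀) * ((4 * 2 ^ L₀ : ℝ) / n ^ 2) := by
            gcongr; exact min_le_right _ _
        _ = _ := by field_simp; norm_num
    simp only [hall]
    rw [Finset.expect_const univ_nonempty]
    norm_num

end KSum

namespace KSum

/-! ### Runs of a machine -/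

/-- The configuration `i` steps after `c`. -/
def runFrom (M : Machine) (I : Input) (coins : ℕ → Bool) (c : Config M.numRegs) :
    ℕ → Config M.numRegs
  | 0 => c
  | i + 1 => runFrom M I (fun j => coins (j + 1)) (step M I (coins 0) c) i

theorem step_runFrom (M : Machine) (I : Input) (i : ℕ) (coins : ℕ → Bool)
    (c : Config M.numRegs) :
    step M I (coins i) (runFrom M I coins c i) = runFrom M I coins c (i + 1) := by
  induction i generalizing coins c with
  | zero => rfl
  | succ i ih => exact ih (fun j => coins (j + 1)) _

theorem run_eq_runFrom (M : Machine) (I : Input) (coins : ℕ → Bool) (i : ℕ) :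
    run M I coins i = runFrom M I coins (initial M) i := by
  induction i with
  | zero => rfl
  | succ i ih => rw [run, ih, step_runFrom]

theorem step_of_halted {M : Machine} {I : Input} {c : Config M.numRegs} (h : Halted M c)
    (b : Bool) : step M I b c = c := by
  unfold step; rw [h]

theorem runFrom_of_halted {M : Machine} {I : Input} {c : Config M.numRegs} (h : Halted M c)
    (coins : ℕ → Bool) (i : ℕ) : runFrom M I coins c i = c := by
  induction i generalizing coins with
  | zero => rfl
  | succ i ih => rw [runFrom, step_of_halted h, ih]

theorem runFrom_congr (M : Machine) (I : Input) (i : ℕ) (coins coins' : ℕ → Bool)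
    (c : Config M.numRegs) (h : ∀ j < i, coins j = coins' j) :
    runFrom M I coins c i = runFrom M I coins' c i := by
  induction i generalizing coins coins' c with
  | zero => rfl
  | succ i ih =>
    rw [runFrom, runFrom, h 0 (by omega)]
    exact ih _ _ _ fun j hj => h (j + 1) (by omega)

/-- From `c` on, the machine halts within `T` steps, uses at most `S` bits, and its output
satisfies `Good` with probability at least `x`. -/
inductive Guarantee (M : Machine) (I : Input) (S : ℕ) (Good : List ℕ → Prop) :
    Config M.numRegs → ℕ → ℝ → Prop
  | halted (c : Config M.numRegs) (T : ℕ) (x : ℝ) (hc : Halted M c) (hS : c.bits ≤ S)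
      (hx : x ≤ 0 ∨ x ≤ 1 ∧ Good c.out) : Guarantee M I S Good c T x
  | step (c : Config M.numRegs) (T : ℕ) (x : ℝ) (y : Bool → ℝ) (hS : c.bits ≤ S)
      (h : ∀ b, Guarantee M I S Good (step M I b c) T (y b)) (hx : x ≤ (y false + y true) / 2) :
      Guarantee M I S Good c (T + 1) x

namespace Guarantee

variable {M : Machine} {I : Input} {S : ℕ} {Good : List ℕ → Prop} {c : Config M.numRegs} {T : ℕ}
  {x : ℝ}

theorem mono (h : Guarantee M I S Good c T x) : ∀ {T' : ℕ} {x' : ℝ}, T ≤ T' → x' ≤ x →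
    Guarantee M I S Good c T' x' := by
  induction h with
  | halted c T x hc hS hx =>
    intro T' x' _ hx'
    refine halted _ _ _ hc hS ?_
    rcases hx with h | ⟨h, h'⟩
    · exact Or.inl (hx'.trans h)
    · exact Or.inr ⟨hx'.trans h, h'⟩
  | step c T x y hS h hx ih =>
    intro T' x' hT hx'
    obtain ⟨T', rfl⟩ : ∃ T'', T' = T'' + 1 := ⟨T' - 1, by omega⟩
    exact step _ _ _ y hS (fun b => ih b (by omega) le_rfl) (hx'.trans hx)

theorem halts (h : Guarantee M I S Good c T x) : ∀ coins : ℕ → Bool,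
    Halted M (runFrom M I coins c T) ∧ ∀ i, (runFrom M I coins c i).bits ≤ S := by
  induction h with
  | halted c T x hc hS hx =>
    intro coins
    simp only [runFrom_of_halted hc]
    exact ⟨hc, fun _ => hS⟩
  | step c T x y hS h hx ih =>
    intro coins
    refine ⟨(ih _ _).1, fun i => ?_⟩
    cases i with
    | zero => exact hS
    | succ i => exact (ih _ _).2 i

theorem extend_cons {T : ℕ} (b : Bool) (coins : Fin T → Bool) (i : ℕ) :
    extend (Fin.cons b coins : Fin (T + 1) → Bool) (i + 1) = extend coins i := by
  unfold extend
  by_cases h : i < T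
  · rw [dif_pos h, dif_pos (by omega)]
    exact Fin.cons_succ (α := fun _ => Bool) b coins ⟨i, h⟩
  · rw [dif_neg h, dif_neg (by omega)]

theorem le_expect (h : Guarantee M I S Good c T x) :
    x ≤ 𝔼 coins : Fin T → Bool, ind (Good (runFrom M I (extend coins) c T).out) := by
  induction h with
  | halted c T x hc hS hx =>
    simp only [runFrom_of_halted hc]
    rw [Finset.expect_const univ_nonempty]
    rcases hx with h | ⟨h, h'⟩
    · exact h.trans (ind_nonneg _)
    · rwa [ind_true h']
  | step c T x y hS h hx ih =>
    rw [expect_cons]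
    have e : ∀ b, 𝔼 coins : Fin T → Bool, ind (Good (runFrom M I
        (extend (Fin.cons b coins : Fin (T + 1) → Bool)) c (T + 1)).out) =
        𝔼 coins : Fin T → Bool, ind (Good (runFrom M I (extend coins) (KSum.step M I b c) T).out) := by
      intro b
      refine Finset.expect_congr rfl fun coins _ => ?_
      rw [runFrom]
      have e0 : extend (Fin.cons b coins : Fin (T + 1) → Bool) 0 = b := by
        simp [extend]
      rw [e0]
      rw [runFrom_congr M I T _ (extend coins) _ fun j _ => extend_cons b coins j]
    rw [Finset.expect_congr rfl fun b _ => e b]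
    have h2 : 𝔼 b : Bool, y b = (y false + y true) / 2 := by
      rw [Fintype.expect_eq_sum_div_card]; simp [add_comm]
    refine hx.trans ?_
    rw [← h2]
    exact Finset.expect_le_expect fun b _ => ih b

/-- A step that does not depend on the coin. -/
theorem of_step {c' : Config M.numRegs} (h : Guarantee M I S Good c' T x) (hS : c.bits ≤ S)
    (hstep : ∀ b, KSum.step M I b c = c') : Guarantee M I S Good c (T + 1) x :=
  step c T x (fun _ => x) hS (fun b => by rw [hstep b]; exact h) (by linarith)

end Guarantee

/-! ### Structured programs -/

/-- Structured programs. -/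
inductive Prog (R : ℕ) : Type
  /-- straight-line code -/
  | ops (l : List (Instr R))
  | seq (P Q : Prog R)
  /-- if `a < b` then `P` else `Q` -/
  | ite (a b : Fin R) (P Q : Prog R)
  /-- while `a < b` do `P` -/
  | loop (a b : Fin R) (P : Prog R)

namespace Prog

variable {R : ℕ}

/-- The number of instructions. -/
def size : Prog R → ℕ
  | ops l => l.length
  | seq P Q => P.size + Q.size
  | ite _ _ P Q => 2 + Q.size + P.size
  | loop _ _ P => 3 + P.size

/-- The machine code, placed at line `o`. -/
def compile : Prog R → ℕ → List (Instr R)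
  | ops l, _ => l
  | seq P Q, o => P.compile o ++ Q.compile (o + P.size)
  | ite a b P Q, o => Instr.jumpLt a b (o + 2 + Q.size) :: (Q.compile (o + 1) ++
      Instr.jump (o + 2 + Q.size + P.size) :: P.compile (o + 2 + Q.size))
  | loop a b P, o => Instr.jumpLt a b (o + 2) :: Instr.jump (o + 3 + P.size) ::
      (P.compile (o + 2) ++ [Instr.jump o])

theorem length_compile (P : Prog R) (o : ℕ) : (P.compile o).length = P.size := by
  induction P generalizing o with
  | ops l => rfl
  | seq P Q ihP ihQ => simp [compile, size, ihP, ihQ]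
  | ite a b P Q ihP ihQ => simp [compile, size, ihP, ihQ]; omega
  | loop a b P ih => simp [compile, size, ih]; omega

end Prog

/-- The destination and the result of an instruction that assigns a value. -/
def Input.eval {R : ℕ} (I : Input) (r : Fin R → ℕ) : Instr R → Option (Fin R × ℕ)
  | .const d v => some (d, v)
  | .copy d a => some (d, r a)
  | .add d a b => some (d, r a + r b)
  | .sub d a b => some (d, r a - r b)
  | .mul d a b => some (d, r a * r b)
  | .div d a b => some (d, r a / r b)
  | .mod d a b => some (d, r a % r b)
  | .arity d => some (d, I.k)
  | .length d => some (d, I.n)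
  | .bound d => some (d, I.m)
  | .target d => some (d, I.target)
  | .entry d a b => some (d, I.read (r a) (r b))
  | _ => none

/-- The register that is output. -/
def Instr.outReg {R : ℕ} : Instr R → Option (Fin R)
  | .output a => some a
  | _ => none

theorem Instr.eq_output {R : ℕ} {i : Instr R} {a : Fin R} (h : i.outReg = some a) :
    i = .output a := by
  cases i <;> simp_all [Instr.outReg]

/-- Contents of the registers, and the output. -/
structure St (R : ℕ) where
  regs : Fin R → ℕ
  out : List ℕ

/-- `Q` holds after the straight-line code, and all values on the way are at most `B`. -/
def opsWp {R : ℕ} (I : Input) (B : ℕ) : List (Instr R) → St R → (St R → Prop) → Prop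
  | [], s, Q => Q s
  | i :: l, s, Q =>
    match I.eval s.regs i with
    | some (d, v) => v ≤ B ∧ opsWp I B l ⟨Function.update s.regs d v, s.out⟩ Q
    | none =>
      match i.outReg with
      | some a => opsWp I B l ⟨s.regs, s.out ++ [s.regs a]⟩ Q
      | none => False

/-- `P` runs from `s` to `s'` in `d` steps, and all values on the way are at most `B`. -/
inductive Runs {R : ℕ} (I : Input) (B : ℕ) : Prog R → St R → ℕ → St R → Prop
  | ops (l : List (Instr R)) (s s' : St R) (h : opsWp I B l s (· = s')) :
      Runs I B (.ops l) s l.length s'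
  | seq {P Q : Prog R} {s s' s'' : St R} {d d' : ℕ} (h : Runs I B P s d s')
      (h' : Runs I B Q s' d' s'') : Runs I B (.seq P Q) s (d + d') s''
  | iteLt {a b : Fin R} {P Q : Prog R} {s s' : St R} {d : ℕ} (hab : s.regs a < s.regs b)
      (h : Runs I B P s d s') : Runs I B (.ite a b P Q) s (d + 1) s'
  | iteGe {a b : Fin R} {P Q : Prog R} {s s' : St R} {d : ℕ} (hab : ¬s.regs a < s.regs b)
      (h : Runs I B Q s d s') : Runs I B (.ite a b P Q) s (d + 2) s'
  | loopLt {a b : Fin R} {P : Prog R} {s s' s'' : St R} {d d' : ℕ} (hab : s.regs a < s.regs b)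
      (h : Runs I B P s d s') (h' : Runs I B (.loop a b P) s' d' s'') :
      Runs I B (.loop a b P) s (d + d' + 2) s''
  | loopGe {a b : Fin R} {P : Prog R} {s : St R} (hab : ¬s.regs a < s.regs b) :
      Runs I B (.loop a b P) s 2 s

/-- The code `l` stands at line `o`. -/
def CodeAt {R : ℕ} (code : List (Instr R)) (o : ℕ) (l : List (Instr R)) : Prop :=
  ∀ j i, l[j]? = some i → code[o + j]? = some i

theorem CodeAt.left {R : ℕ} {code l l' : List (Instr R)} {o : ℕ} (h : CodeAt code o (l ++ l')) :
    CodeAt code o l := by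
  intro j i hj
  refine h j i ?_
  obtain ⟨hlt, -⟩ := List.getElem?_eq_some_iff.1 hj
  rw [List.getElem?_append_left hlt, hj]

theorem CodeAt.right {R : ℕ} {code l l' : List (Instr R)} {o : ℕ} (h : CodeAt code o (l ++ l')) :
    CodeAt code (o + l.length) l' := by
  intro j i hj
  rw [add_assoc]
  refine h _ i ?_
  rw [List.getElem?_append_right (by omega), Nat.add_sub_cancel_left, hj]

theorem CodeAt.tail {R : ℕ} {code l : List (Instr R)} {o : ℕ} {i : Instr R}
    (h : CodeAt code o (i :: l)) : CodeAt code (o + 1) l :=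
  CodeAt.right (l := [i]) h

theorem CodeAt.fetch {M : Machine} {l : List (Instr M.numRegs)} {o : ℕ} {i : Instr M.numRegs}
    (h : CodeAt M.code o (i :: l)) : M.fetch o = i := by
  have := h 0 i rfl
  rw [add_zero] at this
  simp [Machine.fetch, List.getD, this]

/-- The registers contain numbers of at most `B`. -/
def St.Bdd {R : ℕ} (B : ℕ) (s : St R) : Prop := ∀ r, s.regs r ≤ B

/-- The configuration in line `o` with state `s`. -/
def St.at {R : ℕ} (s : St R) (o : ℕ) : Config R := ⟨o, s.regs, s.out⟩

theorem St.Bdd.bits_le {R : ℕ} {B : ℕ} {s : St R} (h : s.Bdd B) (o : ℕ) :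
    (s.at o).bits ≤ R * Nat.size B := by
  unfold Config.bits
  refine (Finset.sum_le_card_nsmul univ _ (Nat.size B) fun r _ => Nat.size_le_size (h r)).trans ?_
  simp

theorem St.Bdd.update {R : ℕ} {B : ℕ} {s : St R} (h : s.Bdd B) (d : Fin R) {v : ℕ} (hv : v ≤ B)
    (out : List ℕ) : (⟨Function.update s.regs d v, out⟩ : St R).Bdd B := by
  intro r
  by_cases hr : r = d
  · subst hr; simpa using hv
  · simpa [Function.update_of_ne hr] using h r

theorem step_of_eval {M : Machine} {I : Input} {s : St M.numRegs} {o : ℕ} {i : Instr M.numRegs}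
    {d : Fin M.numRegs} {v : ℕ} (hf : M.fetch o = i) (h : I.eval s.regs i = some (d, v)) (b : Bool) :
    step M I b (s.at o) = St.at ⟨Function.update s.regs d v, s.out⟩ (o + 1) := by
  unfold step
  simp only [St.at] at *
  rw [hf]
  cases i <;> simp_all [Input.eval, Config.set]

theorem Guarantee.of_ops {M : Machine} {I : Input} {B : ℕ} {Good : List ℕ → Prop} {T : ℕ} {x : ℝ}
    (l : List (Instr M.numRegs)) (s s' : St M.numRegs) (o : ℕ) (hs : s.Bdd B)
    (hl : CodeAt M.code o l) (h : opsWp I B l s (· = s')) :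
    s'.Bdd B ∧ (Guarantee M I (M.numRegs * Nat.size B) Good (s'.at (o + l.length)) T x →
      Guarantee M I (M.numRegs * Nat.size B) Good (s.at o) (T + l.length) x) := by
  induction l generalizing s o with
  | nil =>
    have : s = s' := h
    subst this
    exact ⟨hs, fun h => h⟩
  | cons i l ih =>
    rw [opsWp] at h
    cases he : I.eval s.regs i with
    | some dv =>
      obtain ⟨d, v⟩ := dv
      rw [he] at h
      obtain ⟨hv, h⟩ := h
      obtain ⟨h1, h2⟩ := ih _ (o + 1) (hs.update d hv s.out) hl.tail h
      refine ⟨h1, fun hg => ?_⟩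
      rw [List.length_cons, ← add_assoc]
      refine Guarantee.of_step (h2 ?_) (hs.bits_le o) (step_of_eval hl.fetch he)
      rw [List.length_cons] at hg
      rwa [add_assoc, add_comm 1]
    | none =>
      rw [he] at h
      cases ho : i.outReg with
      | some a =>
        simp only [ho] at h
        obtain rfl := Instr.eq_output ho
        obtain ⟨h1, h2⟩ := ih ⟨s.regs, s.out ++ [s.regs a]⟩ (o + 1) hs hl.tail h
        refine ⟨h1, fun hg => ?_⟩
        rw [List.length_cons, ← add_assoc]
        refine Guarantee.of_step (h2 ?_) (hs.bits_le o) fun b => ?_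
        · rw [List.length_cons] at hg
          rwa [add_assoc, add_comm 1]
        · unfold KSum.step
          simp only [St.at]
          rw [hl.fetch]
      | none => simp only [ho] at h

section Jumps

variable {M : Machine} {I : Input} {B : ℕ} {Good : List ℕ → Prop} {T : ℕ} {x : ℝ}

theorem Guarantee.of_jump {s : St M.numRegs} {o l : ℕ} (hs : s.Bdd B)
    (hf : M.fetch o = Instr.jump l)
    (h : Guarantee M I (M.numRegs * Nat.size B) Good (s.at l) T x) :
    Guarantee M I (M.numRegs * Nat.size B) Good (s.at o) (T + 1) x := by
  refine Guarantee.of_step h (hs.bits_le o) fun b => ?_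
  unfold KSum.step
  simp only [St.at]
  rw [hf]

theorem Guarantee.of_jumpLt {s : St M.numRegs} {o l : ℕ} {a b : Fin M.numRegs} (hs : s.Bdd B)
    (hf : M.fetch o = Instr.jumpLt a b l) (hab : s.regs a < s.regs b)
    (h : Guarantee M I (M.numRegs * Nat.size B) Good (s.at l) T x) :
    Guarantee M I (M.numRegs * Nat.size B) Good (s.at o) (T + 1) x := by
  refine Guarantee.of_step h (hs.bits_le o) fun b => ?_
  unfold KSum.step
  simp only [St.at]
  rw [hf]
  simp [hab]

theorem Guarantee.of_not_jumpLt {s : St M.numRegs} {o l : ℕ} {a b : Fin M.numRegs} (hs : s.Bdd B)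
    (hf : M.fetch o = Instr.jumpLt a b l) (hab : ¬s.regs a < s.regs b)
    (h : Guarantee M I (M.numRegs * Nat.size B) Good (s.at (o + 1)) T x) :
    Guarantee M I (M.numRegs * Nat.size B) Good (s.at o) (T + 1) x := by
  refine Guarantee.of_step h (hs.bits_le o) fun b => ?_
  unfold KSum.step
  simp only [St.at]
  rw [hf]
  simp [hab]

theorem Guarantee.loop_enter {P : Prog M.numRegs} {a b : Fin M.numRegs} {s : St M.numRegs} {o : ℕ}
    (hs : s.Bdd B) (hl : CodeAt M.code o ((Prog.loop a b P).compile o))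
    (hab : s.regs a < s.regs b)
    (h : Guarantee M I (M.numRegs * Nat.size B) Good (s.at (o + 2)) T x) :
    Guarantee M I (M.numRegs * Nat.size B) Good (s.at o) (T + 1) x :=
  Guarantee.of_jumpLt hs hl.fetch hab h

theorem Guarantee.loop_back {P : Prog M.numRegs} {a b : Fin M.numRegs} {s : St M.numRegs} {o : ℕ}
    (hs : s.Bdd B) (hl : CodeAt M.code o ((Prog.loop a b P).compile o))
    (h : Guarantee M I (M.numRegs * Nat.size B) Good (s.at o) T x) :
    Guarantee M I (M.numRegs * Nat.size B) Good (s.at (o + 2 + P.size)) (T + 1) x := by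
  refine Guarantee.of_jump hs ?_ h
  have := hl.tail.tail.right.fetch
  rwa [Prog.length_compile] at this

theorem Guarantee.loop_exit {P : Prog M.numRegs} {a b : Fin M.numRegs} {s : St M.numRegs} {o : ℕ}
    (hs : s.Bdd B) (hl : CodeAt M.code o ((Prog.loop a b P).compile o))
    (hab : ¬s.regs a < s.regs b)
    (h : Guarantee M I (M.numRegs * Nat.size B) Good (s.at (o + (Prog.loop a b P).size)) T x) :
    Guarantee M I (M.numRegs * Nat.size B) Good (s.at o) (T + 2) x := by
  refine Guarantee.of_not_jumpLt (T := T + 1) hs hl.fetch hab ?_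
  refine Guarantee.of_jump hs hl.tail.fetch ?_
  rwa [Prog.size, ← add_assoc] at h

theorem CodeAt.loop_body {P : Prog M.numRegs} {a b : Fin M.numRegs} {o : ℕ}
    (hl : CodeAt M.code o ((Prog.loop a b P).compile o)) :
    CodeAt M.code (o + 2) (P.compile (o + 2)) := hl.tail.tail.left

/-- Induction on the run. Bounds on the registers are passed forwards through the program,
guarantees backwards. Thus a deterministic piece of code only adds its running time, and the success
probability is unaffected. -/
theorem Runs.guarantee {P : Prog M.numRegs} {s s' : St M.numRegs} {d : ℕ}
    (h : Runs I B P s d s') : ∀ {o T : ℕ} {x : ℝ}, s.Bdd B → CodeAt M.code o (P.compile o) →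
    s'.Bdd B ∧ (Guarantee M I (M.numRegs * Nat.size B) Good (s'.at (o + P.size)) T x →
      Guarantee M I (M.numRegs * Nat.size B) Good (s.at o) (T + d) x) := by
  induction h with
  | ops l s s' h => exact fun hs hl => Guarantee.of_ops l s s' _ hs hl h
  | @seq P Q s s' s'' d d' h h' ih ih' =>
    intro o T x hs hl
    have hr := hl.right
    rw [Prog.length_compile] at hr
    obtain ⟨h1, h2⟩ := ih (T := T + d') (x := x) hs hl.left
    obtain ⟨h3, h4⟩ := ih' (T := T) (x := x) h1 hr
    refine ⟨h3, fun hg => ?_⟩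
    rw [add_comm d, ← add_assoc]
    refine h2 (h4 ?_)
    rwa [Prog.size, ← add_assoc] at hg
  | @iteLt a b P Q s s' d hab h ih =>
    intro o T x hs hl
    have hr := hl.tail.right.tail
    rw [Prog.length_compile] at hr
    have e : o + 1 + Q.size + 1 = o + 2 + Q.size := by omega
    rw [e] at hr
    obtain ⟨h1, h2⟩ := ih (T := T) (x := x) hs hr
    refine ⟨h1, fun hg => ?_⟩
    refine Guarantee.of_jumpLt hs hl.fetch hab (h2 ?_)
    rwa [Prog.size, ← add_assoc, ← add_assoc] at hg
  | @iteGe a b P Q s s' d hab h ih =>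
    intro o T x hs hl
    obtain ⟨h1, h2⟩ := ih (T := T + 1) (x := x) hs hl.tail.left
    refine ⟨h1, fun hg => ?_⟩
    have e : T + (d + 2) = T + 1 + d + 1 := by omega
    rw [e]
    refine Guarantee.of_not_jumpLt hs hl.fetch hab (h2 ?_)
    have hf := hl.tail.right.fetch
    rw [Prog.length_compile] at hf
    refine Guarantee.of_jump h1 hf ?_
    rwa [Prog.size, ← add_assoc, ← add_assoc] at hg
  | @loopLt a b P s s' s'' d d' hab h h' ih ih' =>
    intro o T x hs hl
    obtain ⟨h1, h2⟩ := ih (T := T + d' + 1) (x := x) hs hl.loop_body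
    obtain ⟨h3, h4⟩ := ih' (T := T) (x := x) h1 hl
    refine ⟨h3, fun hg => ?_⟩
    have e : T + (d + d' + 2) = T + d' + 1 + d + 1 := by omega
    rw [e]
    exact Guarantee.loop_enter hs hl hab (h2 (Guarantee.loop_back h1 hl (h4 hg)))
  | @loopGe a b P s hab =>
    intro o T x hs hl
    exact ⟨hs, fun hg => Guarantee.loop_exit hs hl hab hg⟩

end Jumps

/-! ### Total correctness with running time -/

namespace Prog

variable {R : ℕ}

/-- The register that an instruction may change. -/
def _root_.KSum.Instr.dests : Instr R → List (Fin R)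
  | .const d _ | .copy d _ | .add d _ _ | .sub d _ _ | .mul d _ _ | .div d _ _ | .mod d _ _
  | .arity d | .length d | .bound d | .target d | .entry d _ _ | .coin d => [d]
  | .jump _ | .jumpLt _ _ _ | .output _ | .halt => []

/-- The registers that a program may change. -/
def writes : Prog R → List (Fin R)
  | ops l => l.flatMap Instr.dests
  | seq P Q => P.writes ++ Q.writes
  | ite _ _ P Q => P.writes ++ Q.writes
  | loop _ _ P => P.writes

/-- The program outputs nothing. -/
def silent : Prog R → Bool
  | ops l => l.all fun i => i.outReg.isNone
  | seq P Q => P.silent && Q.silent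
  | ite _ _ P Q => P.silent && Q.silent
  | loop _ _ P => P.silent

end Prog

theorem mem_dests_of_eval {R : ℕ} {I : Input} {r : Fin R → ℕ} {i : Instr R} {d : Fin R} {v : ℕ}
    (h : I.eval r i = some (d, v)) : d ∈ i.dests := by
  cases i <;> simp_all [Input.eval, Instr.dests]

theorem opsWp_frame {R : ℕ} {I : Input} {B : ℕ} (l : List (Instr R)) (s s' : St R)
    (h : opsWp I B l s (· = s')) (r : Fin R) (hr : r ∉ l.flatMap Instr.dests) :
    s'.regs r = s.regs r := by
  induction l generalizing s with
  | nil => have : s = s' := h; rw [this]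
  | cons i l ih =>
    rw [List.flatMap_cons, List.mem_append, not_or] at hr
    rw [opsWp] at h
    cases he : I.eval s.regs i with
    | some dv =>
      obtain ⟨d, v⟩ := dv
      rw [he] at h
      rw [ih _ h.2 hr.2]
      refine Function.update_of_ne ?_ _ _
      rintro rfl
      exact hr.1 (mem_dests_of_eval he)
    | none =>
      rw [he] at h
      cases ho : i.outReg with
      | some a => simp only [ho] at h; rw [ih _ h hr.2]
      | none => simp only [ho] at h

theorem opsWp_silent {R : ℕ} {I : Input} {B : ℕ} (l : List (Instr R)) (s s' : St R)
    (h : opsWp I B l s (· = s')) (hl : (l.all fun i => i.outReg.isNone) = true) : s'.out = s.out := by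
  induction l generalizing s with
  | nil => have : s = s' := h; rw [this]
  | cons i l ih =>
    rw [List.all_cons, Bool.and_eq_true] at hl
    rw [opsWp] at h
    cases he : I.eval s.regs i with
    | some dv =>
      rw [he] at h
      rw [ih _ h.2 hl.2]
    | none =>
      rw [he] at h
      cases ho : i.outReg with
      | some a => simp [ho] at hl
      | none => simp only [ho] at h

theorem Runs.frame {R : ℕ} {I : Input} {B : ℕ} {P : Prog R} {s s' : St R} {d : ℕ}
    (h : Runs I B P s d s') (r : Fin R) (hr : r ∉ P.writes) : s'.regs r = s.regs r := by
  induction h with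
  | ops l s s' h => exact opsWp_frame l s s' h r hr
  | seq h h' ih ih' =>
    rw [Prog.writes, List.mem_append, not_or] at hr
    rw [ih' hr.2, ih hr.1]
  | iteLt hab h ih =>
    rw [Prog.writes, List.mem_append, not_or] at hr
    exact ih hr.1
  | iteGe hab h ih =>
    rw [Prog.writes, List.mem_append, not_or] at hr
    exact ih hr.2
  | loopLt hab h h' ih ih' => rw [ih' hr, ih hr]
  | loopGe hab => rfl

theorem Runs.out_eq {R : ℕ} {I : Input} {B : ℕ} {P : Prog R} {s s' : St R} {d : ℕ}
    (h : Runs I B P s d s') (hP : P.silent = true) : s'.out = s.out := by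
  induction h with
  | ops l s s' h => exact opsWp_silent l s s' h hP
  | seq h h' ih ih' =>
    rw [Prog.silent, Bool.and_eq_true] at hP
    rw [ih' hP.2, ih hP.1]
  | iteLt hab h ih =>
    rw [Prog.silent, Bool.and_eq_true] at hP
    exact ih hP.1
  | iteGe hab h ih =>
    rw [Prog.silent, Bool.and_eq_true] at hP
    exact ih hP.2
  | loopLt hab h h' ih ih' => rw [ih' hP, ih hP]
  | loopGe hab => rfl

/-- `P` stops within `D` steps from `s` in a state that satisfies `Q`, and all values on the way
are at most `B`. -/
def Exec {R : ℕ} (I : Input) (B : ℕ) (P : Prog R) (s : St R) (D : ℕ) (Q : St R → Prop) : Prop :=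
  ∃ s' d, d ≤ D ∧ Runs I B P s d s' ∧ Q s'

/-- The two states agree except in the registers that `P` may change. -/
def SameOff {R : ℕ} (P : Prog R) (s s' : St R) : Prop := ∀ r, r ∉ P.writes → s'.regs r = s.regs r

namespace Exec

variable {R : ℕ} {I : Input} {B : ℕ} {P P' : Prog R} {s : St R} {D D' : ℕ} {Q Q' : St R → Prop}

theorem mono (h : Exec I B P s D Q) (hD : D ≤ D') (hQ : ∀ s', Q s' → Q' s') :
    Exec I B P s D' Q' := by
  obtain ⟨s', d, hd, hr, hq⟩ := h
  exact ⟨s', d, hd.trans hD, hr, hQ _ hq⟩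

theorem frame (h : Exec I B P s D Q) : Exec I B P s D fun s' => Q s' ∧ SameOff P s s' := by
  obtain ⟨s', d, hd, hr, hq⟩ := h
  exact ⟨s', d, hd, hr, hq, hr.frame⟩

theorem ops {l : List (Instr R)} (h : opsWp I B l s Q) : Exec I B (.ops l) s l.length Q := by
  suffices ∃ s', opsWp I B l s (· = s') ∧ Q s' by
    obtain ⟨s', h1, h2⟩ := this
    exact ⟨s', _, le_rfl, Runs.ops l s s' h1, h2⟩
  induction l generalizing s with
  | nil => exact ⟨s, rfl, h⟩
  | cons i l ih =>
    simp only [opsWp] at h ⊢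
    cases he : I.eval s.regs i with
    | some dv =>
      simp only [he] at h ⊢
      obtain ⟨s', h1, h2⟩ := ih h.2
      exact ⟨s', ⟨h.1, h1⟩, h2⟩
    | none =>
      simp only [he] at h ⊢
      cases ho : i.outReg with
      | some a => simp only [ho] at h ⊢; exact ih h
      | none => simp only [ho] at h

theorem seq (h : Exec I B P s D fun s' => Exec I B P' s' D' Q) :
    Exec I B (.seq P P') s (D + D') Q := by
  obtain ⟨s', d, hd, hr, s'', d', hd', hr', hq⟩ := h
  exact ⟨s'', d + d', by omega, hr.seq hr', hq⟩

theorem ite {a b : Fin R} (h : s.regs a < s.regs b → Exec I B P s D Q)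
    (h' : ¬s.regs a < s.regs b → Exec I B P' s D Q) : Exec I B (.ite a b P P') s (D + 2) Q := by
  by_cases hab : s.regs a < s.regs b
  · obtain ⟨s', d, hd, hr, hq⟩ := h hab
    exact ⟨s', d + 1, by omega, Runs.iteLt hab hr, hq⟩
  · obtain ⟨s', d, hd, hr, hq⟩ := h' hab
    exact ⟨s', d + 2, by omega, Runs.iteGe hab hr, hq⟩

/-- Each round costs two extra steps, the test and the jump back; leaving the loop costs the failed
test and one jump. -/
theorem loop {a b : Fin R} (N : ℕ) (Inv : ℕ → St R → Prop) (h0 : Inv 0 s)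
    (hcond : ∀ j s', j ≤ N → Inv j s' → SameOff P s s' → (s'.regs a < s'.regs b ↔ j < N))
    (hbody : ∀ j s', j < N → Inv j s' → SameOff P s s' → Exec I B P s' D (Inv (j + 1))) :
    Exec I B (.loop a b P) s (N * (D + 2) + 2) fun s' => Inv N s' ∧ SameOff P s s' := by
  suffices ∀ r j s', j + r = N → Inv j s' → SameOff P s s' →
      Exec I B (.loop a b P) s' (r * (D + 2) + 2) fun s' => Inv N s' ∧ SameOff P s s' from
    this N 0 s (by omega) h0 fun _ _ => rfl
  intro r
  induction r with
  | zero =>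
    intro j s' hj hI hs
    obtain rfl : j = N := by omega
    refine ⟨s', 2, by omega, Runs.loopGe ?_, hI, hs⟩
    rw [hcond j s' le_rfl hI hs]
    omega
  | succ r ih =>
    intro j s' hj hI hs
    obtain ⟨s₁, d₁, hd₁, hr₁, hI₁⟩ := hbody j s' (by omega) hI hs
    have hs₁ : SameOff P s s₁ := fun q hq => (hr₁.frame q hq).trans (hs q hq)
    obtain ⟨s₂, d₂, hd₂, hr₂, hq⟩ := ih (j + 1) s₁ (by omega) hI₁ hs₁
    refine ⟨s₂, d₁ + d₂ + 2, ?_, Runs.loopLt ((hcond j s' (by omega) hI hs).2 (by omega)) hr₁ hr₂,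
      hq⟩
    rw [Nat.succ_mul]
    omega

end Exec

end KSum

namespace KSum

/-! ### The program -/

notation "rZ" => (0 : Fin 41)
notation "rK" => (1 : Fin 41)
notation "rN" => (2 : Fin 41)
notation "rM" => (3 : Fin 41)
notation "rT" => (4 : Fin 41)
notation "rOne" => (5 : Fin 41)
notation "rTwo" => (6 : Fin 41)
notation "rNN" => (7 : Fin 41)
notation "rP" => (8 : Fin 41)
notation "rL" => (9 : Fin 41)
notation "rPW" => (10 : Fin 41)
notation "rKK" => (11 : Fin 41)
notation "rE" => (12 : Fin 41)
notation "rR" => (13 : Fin 41)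
notation "rQ" => (14 : Fin 41)
notation "rCnt" => (15 : Fin 41)
notation "rIdx" => (16 : Fin 41)
notation "rRest" => (17 : Fin 41)
notation "rB" => (18 : Fin 41)
notation "rA" => (19 : Fin 41)
notation "rAa" => (20 : Fin 41)
notation "rAb" => (21 : Fin 41)
notation "rAc" => (22 : Fin 41)
notation "rAd" => (23 : Fin 41)
notation "rX" => (24 : Fin 41)
notation "rV" => (25 : Fin 41)
notation "rU" => (26 : Fin 41)
notation "rW" => (27 : Fin 41)
notation "rTo" => (28 : Fin 41)
notation "rHa" => (29 : Fin 41)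
notation "rMe" => (30 : Fin 41)
notation "rXs" => (31 : Fin 41)
notation "rC" => (32 : Fin 41)
notation "rSa" => (33 : Fin 41)
notation "rSb" => (34 : Fin 41)
notation "rF" => (35 : Fin 41)
notation "rD" => (36 : Fin 41)
notation "rDD" => (37 : Fin 41)
notation "rCo" => (38 : Fin 41)
notation "rFl" => (39 : Fin 41)
notation "rY" => (40 : Fin 41)

namespace Prog

open Instr

/-- Read the parameters. -/
def readParams : Prog 41 :=
  ops [arity rK, length rN, bound rM, target rT, const rOne 1, const rTwo 2, add rNN rN rN,
    add rP rNN rOne]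

/-- `rCo := 1` if `rP` has a divisor `d ≥ 2` with `d² ≤ rP`, else `rCo := 0`. -/
def testPrime : Prog 41 :=
  seq (ops [copy rD rTwo, mul rDD rTwo rTwo, const rCo 0, add rU rP rOne])
    (loop rDD rU (seq (ops [mod rW rP rD])
      (seq (ite rW rOne (ops [copy rCo rOne]) (ops []))
        (ops [add rD rD rOne, mul rDD rD rD]))))

/-- Increase `rP` until it is a prime number. -/
def findPrime : Prog 41 :=
  loop rFl rOne (seq testPrime (ite rCo rOne (ops [copy rFl rOne]) (ops [add rP rP rOne])))

/-- `rPW` := the least power of `2` that is at least `rP`, and `rL` := its exponent. -/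
def findPow : Prog 41 :=
  seq (ops [const rL 0, copy rPW rOne])
    (seq (loop rPW rP (ops [add rPW rPW rPW, add rL rL rOne]))
      (ops [mul rKK rTwo rTwo, mul rKK rKK rL]))

/-- `rE` := the least `ℓ ≥ 2` with `n ≤ ((ℓ + 1) * rL) ^ 2`. -/
def findLen : Prog 41 :=
  seq (ops [copy rE rTwo, add rU rE rOne, mul rU rU rL, mul rU rU rU])
    (loop rU rN (ops [add rE rE rOne, add rU rE rOne, mul rU rU rL, mul rU rU rU]))

/-- The number of trials for each choice of `k - 2` positions, and the number of all trials. -/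
def countTrials : Prog 41 :=
  seq (ops [mul rU rN rN, mul rW rE rE, div rR rU rW, add rR rR rOne, copy rQ rR, copy rC rTwo])
    (loop rC rK (ops [mul rQ rQ rN, add rC rC rOne]))

/-- The preparations. -/
def prepare : Prog 41 :=
  seq readParams (seq findPrime (seq findPow (seq findLen countTrials)))

end Prog

/-! ### Size bounds and register invariants -/

/-- A bound on the contents of all registers. -/
def Input.cap (I : Input) : ℕ := 65536 * I.n ^ 4 + 4 * I.n ^ I.k + 4 * (I.k * I.m)

/-- The input is admissible. -/
structure Input.Valid (I : Input) : Prop where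
  two_le_k : 2 ≤ I.k
  n_pos : 0 < I.n
  m_pos : 0 < I.m
  target_le : I.target ≤ I.k * I.m

namespace Input

variable {I : Input}

/-- The fourth power of `n` in `Input.cap` is needed for evaluating the cubic and for the random
number that encodes its four coefficients. The other terms account for the number of trials and for
sums of integers from the lists. -/
theorem le_cap_of_pow {x i : ℕ} (hI : I.Valid) (hi : i ≤ 4) (h : x ≤ 65536 * I.n ^ i) :
    x ≤ I.cap := by
  have := Nat.pow_le_pow_right hI.n_pos hi
  unfold cap; omega

theorem le_cap_of_n {x : ℕ} (hI : I.Valid) (h : x ≤ 65536 * I.n) : x ≤ I.cap :=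
  le_cap_of_pow (i := 1) hI (by norm_num) (by simpa using h)

theorem le_cap_of_n_sq {x : ℕ} (hI : I.Valid) (h : x ≤ 65536 * I.n ^ 2) : x ≤ I.cap :=
  le_cap_of_pow hI (by norm_num) h

theorem le_cap_of_km {x : ℕ} (h : x ≤ 4 * (I.k * I.m)) : x ≤ I.cap := by
  unfold cap; omega

theorem le_cap_of_trials {x : ℕ} (h : x ≤ 4 * I.n ^ I.k) : x ≤ I.cap := by
  unfold cap; omega

theorem Valid.le_km (hI : I.Valid) : I.k ≤ I.k * I.m ∧ 2 * I.m ≤ I.k * I.m :=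
  ⟨Nat.le_mul_of_pos_right _ hI.m_pos, Nat.mul_le_mul_right _ hI.two_le_k⟩

end Input

/-- The parameters that the program computes. -/
structure Setting (I : Input) (p L ℓ : ℕ) : Prop extends I.Valid where
  prime : p.Prime
  lt_p : 2 * I.n < p
  p_min : ∀ q, q.Prime → 2 * I.n < q → p ≤ q
  p_le : p ≤ 4 * I.n
  p_le_pow : p ≤ 2 ^ L
  pow_lt : 2 ^ L < 2 * p
  two_le_len : 2 ≤ ℓ
  len_lt : ℓ = 2 ∨ (ℓ * L) ^ 2 < I.n
  le_len : I.n ≤ ((ℓ + 1) * L) ^ 2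

/-- The registers that hold the parameters. -/
structure Base (I : Input) (s : St 41) : Prop where
  hZ : s.regs rZ = 0
  hK : s.regs rK = I.k
  hN : s.regs rN = I.n
  hM : s.regs rM = I.m
  hT : s.regs rT = I.target
  hOne : s.regs rOne = 1
  hTwo : s.regs rTwo = 2
  hNN : s.regs rNN = 2 * I.n

theorem Base.frame {I : Input} {s s' : St 41} {P : Prog 41} (h : Base I s) (hs : SameOff P s s')
    (hP : ∀ r ∈ [rZ, rK, rN, rM, rT, rOne, rTwo, rNN], r ∉ P.writes) : Base I s' := by
  constructor
  · rw [hs _ (hP _ (by decide)), h.hZ]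
  · rw [hs _ (hP _ (by decide)), h.hK]
  · rw [hs _ (hP _ (by decide)), h.hN]
  · rw [hs _ (hP _ (by decide)), h.hM]
  · rw [hs _ (hP _ (by decide)), h.hT]
  · rw [hs _ (hP _ (by decide)), h.hOne]
  · rw [hs _ (hP _ (by decide)), h.hTwo]
  · rw [hs _ (hP _ (by decide)), h.hNN]

/-- The parameters depend on the length of the lists only. -/
theorem Setting.unique {I I' : Input} {p L ℓ p' L' ℓ' : ℕ} (h : Setting I p L ℓ)
    (h' : Setting I' p' L' ℓ') (hn : I.n = I'.n) : p = p' ∧ L = L' ∧ ℓ = ℓ' := by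
  have hp : p = p' := le_antisymm (h.p_min _ h'.prime (by have := h'.lt_p; omega))
    (h'.p_min _ h.prime (by have := h.lt_p; omega))
  subst hp
  have key : ∀ {a b : ℕ}, p ≤ 2 ^ b → 2 ^ a < 2 * p → a ≤ b := by
    intro a b h1 h2
    have : 2 ^ a < 2 ^ (b + 1) := by rw [pow_succ]; omega
    have := (Nat.pow_lt_pow_iff_right (by norm_num : 1 < 2)).1 this
    omega
  have hL : L = L' := le_antisymm (key h'.p_le_pow h.pow_lt) (key h.p_le_pow h'.pow_lt)
  subst hL
  have key' : ∀ {a b : ℕ}, (a = 2 ∨ (a * L) ^ 2 < I.n) → 2 ≤ b → I.n ≤ ((b + 1) * L) ^ 2 →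
      a ≤ b := by
    rintro a b (h1 | h1) h2 h3
    · omega
    · by_contra hlt
      have := Nat.pow_le_pow_left (Nat.mul_le_mul_right L (by omega : b + 1 ≤ a)) 2
      omega
  exact ⟨rfl, rfl, le_antisymm (key' h.len_lt h'.two_le_len (hn ▸ h'.le_len))
    (key' (hn ▸ h'.len_lt) h.two_le_len h.le_len)⟩

/-- The registers during the trials. -/
structure Env (I : Input) (p L ℓ : ℕ) (s : St 41) : Prop extends Base I s where
  hP : s.regs rP = p
  hL : s.regs rL = L
  hPW : s.regs rPW = 2 ^ L
  hKK : s.regs rKK = 4 * L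
  hE : s.regs rE = ℓ
  hR : s.regs rR = I.n ^ 2 / ℓ ^ 2 + 1
  hQ : s.regs rQ = (I.n ^ 2 / ℓ ^ 2 + 1) * I.n ^ (I.k - 2)

theorem Env.frame {I : Input} {p L ℓ : ℕ} {s s' : St 41} {P : Prog 41} (h : Env I p L ℓ s)
    (hs : SameOff P s s')
    (hP : ∀ r ∈ [rZ, rK, rN, rM, rT, rOne, rTwo, rNN, rP, rL, rPW, rKK, rE, rR, rQ],
      r ∉ P.writes) : Env I p L ℓ s' where
  toBase := h.toBase.frame hs fun r hr => hP r (by revert r; decide)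
  hP := by rw [hs _ (hP _ (by decide)), h.hP]
  hL := by rw [hs _ (hP _ (by decide)), h.hL]
  hPW := by rw [hs _ (hP _ (by decide)), h.hPW]
  hKK := by rw [hs _ (hP _ (by decide)), h.hKK]
  hE := by rw [hs _ (hP _ (by decide)), h.hE]
  hR := by rw [hs _ (hP _ (by decide)), h.hR]
  hQ := by rw [hs _ (hP _ (by decide)), h.hQ]

theorem Setting.len_sq_le {I : Input} {p L ℓ : ℕ} (h : Setting I p L ℓ) : ℓ ^ 2 ≤ 4 * I.n := by
  have hn := h.n_pos
  have hL : 1 ≤ L := by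
    rcases Nat.eq_zero_or_pos L with h0 | h0
    · have := h.p_le_pow; have := h.lt_p; subst h0; simp at *; omega
    · exact h0
  rcases h.len_lt with h1 | h1
  · subst h1; omega
  · have := Nat.pow_le_pow_left (Nat.le_mul_of_pos_right ℓ hL) 2
    omega

/-! ### Correctness and running time of the preparations -/

namespace Exec

variable {I : Input} {s : St 41}

theorem readParams (hI : I.Valid) (hs : ∀ r, s.regs r = 0) :
    Exec I I.cap Prog.readParams s 8 fun s' =>
      Base I s' ∧ s'.regs rP = 2 * I.n + 1 ∧ s'.regs rFl = 0 := by
  have h1 := hI.le_km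
  have h2 := hI.n_pos
  have h3 := hI.target_le
  refine Exec.ops ?_
  simp [opsWp, Input.eval, hs]
  refine ⟨Input.le_cap_of_km (by omega), Input.le_cap_of_n hI (by omega),
    Input.le_cap_of_km (by omega), Input.le_cap_of_km (by omega), Input.le_cap_of_n hI (by omega),
    Input.le_cap_of_n hI (by omega), Input.le_cap_of_n hI (by omega),
    Input.le_cap_of_n hI (by omega), ?_, by omega⟩
  constructor <;> simp [hs]
  omega

/-- Trial division. Register `rU` contains `q + 1`, so the strict test of the loop admits exactly
the divisors `d` with `d ^ 2 ≤ q`. -/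
theorem testPrime (hI : I.Valid) (hb : Base I s) {q : ℕ} (hq : s.regs rP = q)
    (h2 : 2 ≤ q) (h4 : q ≤ 4 * I.n) :
    Exec I I.cap Prog.testPrime s (4 + (Nat.sqrt q * 8 + 2)) fun s' =>
      s'.regs rCo = if q.Prime then 0 else 1 := by
  classical
  have hn := hI.n_pos
  have hsq : ∀ {x : ℕ}, x ≤ 36 * I.n ^ 2 → x ≤ I.cap := fun h =>
    Input.le_cap_of_n_sq hI (h.trans (Nat.mul_le_mul_right _ (by norm_num)))
  have hnn : I.n ≤ I.n ^ 2 := Nat.le_self_pow (by norm_num) _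
  have h1n : ∀ {x : ℕ}, x ≤ 16 * I.n → x ≤ I.cap := fun h => Input.le_cap_of_n hI (by omega)
  refine Exec.seq (Exec.mono (Exec.frame (Exec.ops (Q := fun s' => s'.regs rD = 2 ∧
    s'.regs rDD = 4 ∧ s'.regs rCo = 0 ∧ s'.regs rU = q + 1) ?_)) le_rfl ?_)
  · simp [opsWp, Input.eval, hb.hTwo, hb.hOne, hq]
    refine ⟨h1n ?_, h1n ?_, h1n ?_⟩ <;> omega
  rintro s₁ ⟨⟨hD, hDD, hCo, hU⟩, hs₁⟩
  have hP₁ : s₁.regs rP = q := by rw [hs₁ _ (by decide), hq]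
  have hb₁ : Base I s₁ := hb.frame hs₁ (by decide)
  have hsqrt : 1 ≤ Nat.sqrt q := Nat.le_sqrt'.2 (by omega)
  refine Exec.mono (Exec.loop (D := 6) (Nat.sqrt q - 1) (fun j s' => s'.regs rD = 2 + j ∧
    s'.regs rDD = (2 + j) ^ 2 ∧ s'.regs rCo = if ∀ d, 2 ≤ d → d < 2 + j → ¬d ∣ q then 0 else 1)
    ?_ ?_ ?_) (by have := Nat.sub_le (Nat.sqrt q) 1; omega) ?_
  · refine ⟨hD, hDD, ?_⟩
    rw [hCo, if_pos]
    intro d h h'; omega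
  · rintro j s' hj ⟨-, hDD', -⟩ hs'
    rw [hDD', hs' _ (by decide), hU, Nat.lt_succ_iff, ← Nat.le_sqrt']
    omega
  · rintro j s' hj ⟨hD', hDD', hCo'⟩ hs'
    have hb' : Base I s' := hb₁.frame hs' (by decide)
    have hP' : s'.regs rP = q := by rw [hs' _ (by decide), hP₁]
    have hj2 : (2 + j) ^ 2 ≤ q := Nat.le_sqrt'.1 (by omega)
    have hjq : 2 + j ≤ q := (Nat.le_self_pow (by norm_num) _).trans hj2
    refine Exec.seq (D := 1) (D' := 5) (Exec.mono (Exec.frame (Exec.ops (Q := fun s' =>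
      s'.regs rW = q % (2 + j)) ?_)) le_rfl ?_)
    · simp [opsWp, Input.eval, hP', hD']
      exact h1n ((Nat.mod_le _ _).trans (by omega))
    rintro s₂ ⟨hW₂, hs₂⟩
    have hb₂ : Base I s₂ := hb'.frame hs₂ (by decide)
    refine Exec.seq (D := 3) (D' := 2) (Exec.mono (Exec.frame (Exec.ite (D := 1) (Q := fun s' =>
      s'.regs rCo = if ∀ d, 2 ≤ d → d < 2 + (j + 1) → ¬d ∣ q then 0 else 1) ?_ ?_)) le_rfl ?_)
    · intro hlt
      refine Exec.ops ?_
      rw [hW₂, hb₂.hOne] at hlt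
      simp only [opsWp, Input.eval, hb₂.hOne]
      refine ⟨h1n (by omega), ?_⟩
      rw [if_neg]
      · rfl
      · intro h
        exact h (2 + j) (by omega) (by omega) (Nat.dvd_of_mod_eq_zero (by omega))
    · intro hlt
      refine Exec.mono (Exec.ops (l := []) ?_) (Nat.zero_le 1) fun _ h => h
      rw [hW₂, hb₂.hOne] at hlt
      simp only [opsWp]
      rw [hs₂ _ (by decide), hCo']
      have : (∀ d, 2 ≤ d → d < 2 + j → ¬d ∣ q) ↔ (∀ d, 2 ≤ d → d < 2 + (j + 1) → ¬d ∣ q) := by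
        refine ⟨fun h d hd hd' => ?_, fun h d hd hd' => h d hd (by omega)⟩
        rcases Nat.lt_or_ge d (2 + j) with h' | h'
        · exact h d hd h'
        · obtain rfl : d = 2 + j := by omega
          intro hdvd
          exact hlt (by rw [Nat.mod_eq_zero_of_dvd hdvd]; norm_num)
      simp only [this]
      congr
    rintro s₃ ⟨hCo₃, hs₃⟩
    have hb₃ : Base I s₃ := hb₂.frame hs₃ (by decide)
    have hD₃ : s₃.regs rD = 2 + j := by rw [hs₃ _ (by decide), hs₂ _ (by decide), hD']
    refine Exec.ops ?_
    simp [opsWp, Input.eval, hb₃.hOne, hD₃, hCo₃]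
    refine ⟨h1n (by omega), hsq ?_, by ring, by ring⟩
    have : (2 + j) * (2 + j) ≤ q := by rw [← sq]; exact hj2
    nlinarith
  · rintro s' ⟨⟨-, -, h⟩, -⟩
    have : (∀ d, 2 ≤ d → d < 2 + (Nat.sqrt q - 1) → ¬d ∣ q) ↔ q.Prime := by
      rw [Nat.prime_def_le_sqrt]
      refine ⟨fun h => ⟨h2, fun d hd hd' => h d hd (by omega)⟩,
        fun h d hd hd' => h.2 d hd (by omega)⟩
    rw [h]
    simp only [this]

/-- Bertrand's postulate for `2 * n`. -/
theorem exists_prime {n : ℕ} (hn : 0 < n) : ∃ i, (2 * n + 1 + i).Prime ∧ 2 * n + 1 + i ≤ 4 * n := by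
  obtain ⟨p, hp, h1, h2⟩ := Nat.exists_prime_lt_and_le_two_mul (2 * n) (by omega)
  exact ⟨p - (2 * n + 1), by rwa [Nat.add_sub_cancel' h1], by omega⟩

/-- At most `2 * n` candidates are tested with about `√n` divisions each. The resulting order `n ^
(3/2)` stays within the time bound, as `k ≥ 2`. -/
theorem findPrime (hI : I.Valid) (hb : Base I s) (hP : s.regs rP = 2 * I.n + 1)
    (hFl : s.regs rFl = 0) :
    Exec I I.cap Prog.findPrime s (2 * I.n * (Nat.sqrt (4 * I.n) * 8 + 11) + 2) fun s' =>
      Base I s' ∧ ∃ p, s'.regs rP = p ∧ p.Prime ∧ 2 * I.n < p ∧ p ≤ 4 * I.n ∧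
        ∀ q, q.Prime → 2 * I.n < q → p ≤ q := by
  classical
  have hn := hI.n_pos
  have hex := exists_prime hn
  obtain ⟨hJ1, hJ2⟩ := Nat.find_spec hex
  set J := Nat.find hex with hJ
  refine Exec.mono (Exec.loop (D := 4 + (Nat.sqrt (4 * I.n) * 8 + 2) + 3) (J + 1)
    (fun j s' => (j ≤ J → s'.regs rFl = 0 ∧ s'.regs rP = 2 * I.n + 1 + j) ∧
      (j = J + 1 → s'.regs rFl = 1 ∧ s'.regs rP = 2 * I.n + 1 + J)) ?_ ?_ ?_) ?_ ?_
  · exact ⟨fun _ => ⟨hFl, hP⟩, fun h => by omega⟩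
  · rintro j s' hj ⟨h1, h2⟩ hs'
    rw [hs' rOne (by decide), hb.hOne]
    rcases Nat.lt_or_ge J j with h | h
    · rw [(h2 (by omega)).1]; omega
    · rw [(h1 h).1]; omega
  · rintro j s' hj ⟨h1, -⟩ hs'
    obtain ⟨hFl', hP'⟩ := h1 (by omega)
    have hb' : Base I s' := hb.frame hs' (by decide)
    refine Exec.seq (Exec.mono (Exec.frame (Exec.testPrime hI hb' hP' (by omega) (by omega)))
      ?_ ?_)
    · have : Nat.sqrt (2 * I.n + 1 + j) ≤ Nat.sqrt (4 * I.n) := Nat.sqrt_le_sqrt (by omega)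
      omega
    rintro s₁ ⟨hCo₁, hs₁⟩
    have hb₁ : Base I s₁ := hb'.frame hs₁ (by decide)
    have hP₁ : s₁.regs rP = 2 * I.n + 1 + j := by rw [hs₁ _ (by decide), hP']
    have hFl₁ : s₁.regs rFl = 0 := by rw [hs₁ _ (by decide), hFl']
    refine Exec.ite (D := 1) ?_ ?_
    · intro hlt
      refine Exec.ops ?_
      rw [hCo₁, hb₁.hOne] at hlt
      have hprime : (2 * I.n + 1 + j).Prime := by
        by_contra h; rw [if_neg h] at hlt; omega
      have : J ≤ j := Nat.find_min' hex ⟨hprime, by omega⟩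
      obtain rfl : j = J := by omega
      simp [opsWp, Input.eval, hb₁.hOne, hP₁]
      exact Input.le_cap_of_n hI (by omega)
    · intro hlt
      refine Exec.ops ?_
      rw [hCo₁, hb₁.hOne] at hlt
      have hprime : ¬(2 * I.n + 1 + j).Prime := by
        intro h; rw [if_pos h] at hlt; omega
      have hne : j ≠ J := by rintro rfl; exact hprime hJ1
      simp [opsWp, Input.eval, hb₁.hOne, hP₁, hFl₁]
      exact ⟨Input.le_cap_of_n hI (by omega), fun _ => by omega, by omega⟩
  · have : J + 1 ≤ 2 * I.n := by omega
    have := Nat.mul_le_mul_right (Nat.sqrt (4 * I.n) * 8 + 11) this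
    have e : 4 + (Nat.sqrt (4 * I.n) * 8 + 2) + 3 + 2 = Nat.sqrt (4 * I.n) * 8 + 11 := by omega
    rw [e]; omega
  · rintro s' ⟨⟨-, h⟩, hs'⟩
    refine ⟨hb.frame hs' (by decide), _, (h rfl).2, hJ1, by omega, hJ2, fun q hq hq' => ?_⟩
    by_contra hlt
    have : J ≤ q - (2 * I.n + 1) :=
      Nat.find_min' hex ⟨by rwa [Nat.add_sub_cancel' (by omega)], by omega⟩
    omega

theorem findPow (hI : I.Valid) (hb : Base I s) {p : ℕ} (hP : s.regs rP = p) (hp2 : 2 ≤ p)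
    (hp : p ≤ 4 * I.n) :
    Exec I I.cap Prog.findPow s (4 * Nat.clog 2 p + 6) fun s' =>
      Base I s' ∧ ∃ L, s'.regs rP = p ∧ s'.regs rL = L ∧ s'.regs rPW = 2 ^ L ∧
        s'.regs rKK = 4 * L ∧ p ≤ 2 ^ L ∧ 2 ^ L < 2 * p := by
  have hn := hI.n_pos
  have h1n : ∀ {x : ℕ}, x ≤ 32 * I.n → x ≤ I.cap := fun h => Input.le_cap_of_n hI (by omega)
  have hL1 : p ≤ 2 ^ Nat.clog 2 p := Nat.le_pow_clog (by norm_num) p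
  have hlt : ∀ j, j < Nat.clog 2 p → 2 ^ j < p := fun j hj =>
    (Nat.lt_clog_iff_pow_lt (by norm_num)).1 hj
  have hpos : 0 < Nat.clog 2 p := Nat.clog_pos (by norm_num) hp2
  have hL2 : 2 ^ Nat.clog 2 p < 2 * p := by
    have := hlt (Nat.clog 2 p - 1) (by omega)
    obtain ⟨j, hj⟩ : ∃ j, Nat.clog 2 p = j + 1 := ⟨Nat.clog 2 p - 1, by omega⟩
    rw [hj] at this ⊢
    rw [pow_succ]; simp at this; omega
  have hLle : Nat.clog 2 p < 2 ^ Nat.clog 2 p := Nat.lt_two_pow_self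
  set L := Nat.clog 2 p
  refine Exec.mono (D := 2 + (L * (2 + 2) + 2 + 2)) (Exec.seq (Exec.mono (Exec.frame (Exec.ops
    (Q := fun s' => s'.regs rL = 0 ∧ s'.regs rPW = 1) ?_)) le_rfl ?_)) (by omega) fun _ h => h
  · simp [opsWp, Input.eval, hb.hOne]
    exact h1n (by omega)
  rintro s₁ ⟨⟨hL₁, hPW₁⟩, hs₁⟩
  have hb₁ : Base I s₁ := hb.frame hs₁ (by decide)
  have hP₁ : s₁.regs rP = p := by rw [hs₁ _ (by decide), hP]
  refine Exec.seq (Exec.mono (Exec.loop (D := 2) L (fun j s' => s'.regs rL = j ∧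
    s'.regs rPW = 2 ^ j) ⟨hL₁, hPW₁⟩ ?_ ?_) le_rfl ?_)
  · rintro j s' hj ⟨-, h⟩ hs'
    rw [h, hs' _ (by decide), hP₁]
    exact (Nat.lt_clog_iff_pow_lt (by norm_num)).symm
  · rintro j s' hj ⟨h1, h2⟩ hs'
    have hb' : Base I s' := hb₁.frame hs' (by decide)
    have := hlt j hj
    refine Exec.ops ?_
    simp [opsWp, Input.eval, hb'.hOne, h1, h2]
    exact ⟨h1n (by omega), h1n (by omega), by rw [pow_succ]; omega⟩
  rintro s₂ ⟨⟨hL₂, hPW₂⟩, hs₂⟩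
  have hb₂ : Base I s₂ := hb₁.frame hs₂ (by decide)
  have hP₂ : s₂.regs rP = p := by rw [hs₂ _ (by decide), hP₁]
  refine Exec.mono (Exec.frame (Exec.ops (Q := fun s' => s'.regs rKK = 4 * L ∧ s'.regs rP = p ∧
    s'.regs rL = L ∧ s'.regs rPW = 2 ^ L) ?_)) le_rfl ?_
  · simp [opsWp, Input.eval, hb₂.hTwo, hL₂, hP₂, hPW₂]
    exact ⟨h1n (by omega), h1n (by omega)⟩
  · rintro s₃ ⟨⟨h1, h2, h3, h4⟩, hs₃⟩
    exact ⟨hb₂.frame hs₃ (by decide), L, h2, h3, h4, h1, hL1, hL2⟩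

theorem findLen (hI : I.Valid) (hb : Base I s) {L : ℕ} (hL : s.regs rL = L) (hL0 : 1 ≤ L)
    (hL8 : L ≤ 8 * I.n) :
    Exec I I.cap Prog.findLen s (6 * I.n + 6) fun s' =>
      ∃ ℓ, s'.regs rE = ℓ ∧ 2 ≤ ℓ ∧ (ℓ = 2 ∨ (ℓ * L) ^ 2 < I.n) ∧ I.n ≤ ((ℓ + 1) * L) ^ 2 := by
  classical
  have hn := hI.n_pos
  have h1n : ∀ {x : ℕ}, x ≤ 1000 * I.n → x ≤ I.cap := fun h => Input.le_cap_of_n hI (by omega)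
  have h2n : ∀ {x : ℕ}, x ≤ 1000 * I.n ^ 2 → x ≤ I.cap := fun h =>
    Input.le_cap_of_n_sq hI (h.trans (Nat.mul_le_mul_right _ (by norm_num)))
  have hnn : I.n ≤ I.n ^ 2 := Nat.le_self_pow (by norm_num) _
  have hL2 : L ^ 2 ≤ 64 * I.n ^ 2 := by
    calc L ^ 2 ≤ (8 * I.n) ^ 2 := Nat.pow_le_pow_left hL8 2
      _ = 64 * I.n ^ 2 := by ring
  have hex : ∃ j, I.n ≤ ((3 + j) * L) ^ 2 := by
    refine ⟨I.n, (?_ : I.n ≤ (3 + I.n) * L).trans (Nat.le_self_pow (by norm_num) _)⟩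
    nlinarith
  have hmin : ∀ j, j < Nat.find hex → ((3 + j) * L) ^ 2 < I.n := fun j hj =>
    not_le.1 (Nat.find_min hex hj)
  have hspec := Nat.find_spec hex
  set N := Nat.find hex
  have hNn : N ≤ I.n := by
    rcases Nat.eq_zero_or_pos N with h | h
    · omega
    · have := hmin (N - 1) (by omega)
      have h3 : 3 + (N - 1) ≤ (3 + (N - 1)) * L := Nat.le_mul_of_pos_right _ hL0
      have h4 := Nat.le_self_pow (two_ne_zero) ((3 + (N - 1)) * L)
      omega
  have hbd : ∀ j, j < N → ((4 + j) * L) ^ 2 ≤ 4 * I.n := by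
    intro j hj
    have h3 : (4 + j) * L ≤ 2 * ((3 + j) * L) := by
      rw [← mul_assoc]; exact Nat.mul_le_mul_right _ (by omega)
    calc ((4 + j) * L) ^ 2 ≤ (2 * ((3 + j) * L)) ^ 2 := Nat.pow_le_pow_left h3 2
      _ = 4 * ((3 + j) * L) ^ 2 := by ring
      _ ≤ _ := Nat.mul_le_mul_left _ (hmin j hj).le
  refine Exec.mono (D := 4 + (N * (4 + 2) + 2)) (Exec.seq (Exec.mono (Exec.frame (Exec.ops
    (Q := fun s' => s'.regs rE = 2 ∧ s'.regs rU = (3 * L) ^ 2) ?_)) le_rfl ?_)) (by omega)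
    fun _ h => h
  · simp [opsWp, Input.eval, hb.hOne, hb.hTwo, hL]
    refine ⟨h1n (by omega), h1n (by omega), h1n (by omega), h2n ?_, by ring⟩
    nlinarith
  rintro s₁ ⟨⟨hE₁, hU₁⟩, hs₁⟩
  have hb₁ : Base I s₁ := hb.frame hs₁ (by decide)
  have hL₁ : s₁.regs rL = L := by rw [hs₁ _ (by decide), hL]
  refine Exec.mono (Exec.loop (D := 4) N (fun j s' => s'.regs rE = 2 + j ∧
    s'.regs rU = ((3 + j) * L) ^ 2) ⟨hE₁, hU₁⟩ ?_ ?_) le_rfl ?_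
  · rintro j s' hj ⟨-, h⟩ hs'
    rw [h, hs' _ (by decide), hb₁.hN]
    refine ⟨fun h => ?_, hmin j⟩
    by_contra h'
    obtain rfl : j = N := by omega
    omega
  · rintro j s' hj ⟨h1, h2⟩ hs'
    have hb' : Base I s' := hb₁.frame hs' (by decide)
    have hL' : s'.regs rL = L := by rw [hs' _ (by decide), hL₁]
    refine Exec.ops ?_
    have h4 := hbd j hj
    have h5 := Nat.le_self_pow (two_ne_zero) ((4 + j) * L)
    have h6 : 4 + j ≤ (4 + j) * L := Nat.le_mul_of_pos_right _ hL0
    have e : 2 + j + 1 + 1 = 4 + j := by omega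
    simp [opsWp, Input.eval, hb'.hOne, hL', h1, e]
    refine ⟨h1n (by omega), h1n (by omega), h1n (by omega), h1n ?_, by omega, by ring⟩
    rw [← sq]; omega
  · rintro s' ⟨⟨h1, h2⟩, hs'⟩
    refine ⟨2 + N, h1, by omega, ?_, ?_⟩
    · rcases Nat.eq_zero_or_pos N with h | h
      · left; omega
      · right
        have := hmin (N - 1) (by omega)
        have e : 3 + (N - 1) = 2 + N := by omega
        rwa [e] at this
    · have e : 2 + N + 1 = 3 + N := by omega
      rwa [e]

theorem countTrials (hI : I.Valid) (hb : Base I s) {ℓ : ℕ} (hE : s.regs rE = ℓ)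
    (hℓn : ℓ ^ 2 ≤ 4 * I.n) :
    Exec I I.cap Prog.countTrials s (4 * I.k + 10) fun s' =>
      s'.regs rR = I.n ^ 2 / ℓ ^ 2 + 1 ∧
        s'.regs rQ = (I.n ^ 2 / ℓ ^ 2 + 1) * I.n ^ (I.k - 2) := by
  have hn := hI.n_pos
  have hk := hI.two_le_k
  have hkm := hI.le_km
  have h1n : ∀ {x : ℕ}, x ≤ 1000 * I.n → x ≤ I.cap := fun h => Input.le_cap_of_n hI (by omega)
  have h2n : ∀ {x : ℕ}, x ≤ 1000 * I.n ^ 2 → x ≤ I.cap := fun h =>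
    Input.le_cap_of_n_sq hI (h.trans (Nat.mul_le_mul_right _ (by norm_num)))
  have hnn : I.n ≤ I.n ^ 2 := Nat.le_self_pow (by norm_num) _
  have hR : I.n ^ 2 / ℓ ^ 2 ≤ I.n ^ 2 := Nat.div_le_self _ _
  have e1 : I.n * I.n = I.n ^ 2 := by ring
  have e2 : ℓ * ℓ = ℓ ^ 2 := by ring
  have hQ : ∀ j, j ≤ I.k - 2 → (I.n ^ 2 / ℓ ^ 2 + 1) * I.n ^ j ≤ 4 * I.n ^ I.k := by
    intro j hj
    calc (I.n ^ 2 / ℓ ^ 2 + 1) * I.n ^ j ≤ (2 * I.n ^ 2) * I.n ^ (I.k - 2) :=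
          Nat.mul_le_mul (by omega) (Nat.pow_le_pow_right hn hj)
      _ = 2 * I.n ^ (2 + (I.k - 2)) := by ring
      _ ≤ _ := by rw [Nat.add_sub_cancel' hk]; omega
  set R := I.n ^ 2 / ℓ ^ 2 + 1
  refine Exec.mono (D := 6 + ((I.k - 2) * (2 + 2) + 2)) (Exec.seq (Exec.mono (Exec.frame (Exec.ops
    (Q := fun s' => s'.regs rR = R ∧ s'.regs rQ = R ∧ s'.regs rC = 2) ?_)) le_rfl ?_)) (by omega)
    fun _ h => h
  · simp [opsWp, Input.eval, hb.hOne, hb.hTwo, hb.hN, hE, e1, e2]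
    refine ⟨h2n (by omega), h2n (by omega), h2n (by omega), h2n (by omega), h2n (by omega), rfl⟩
  rintro s₁ ⟨⟨hR₁, hQ₁, hC₁⟩, hs₁⟩
  have hb₁ : Base I s₁ := hb.frame hs₁ (by decide)
  refine Exec.mono (Exec.loop (D := 2) (I.k - 2) (fun j s' => s'.regs rC = 2 + j ∧
    s'.regs rQ = R * I.n ^ j) ⟨hC₁, by rw [hQ₁]; ring⟩ ?_ ?_) le_rfl ?_
  · rintro j s' hj ⟨h, -⟩ hs'
    rw [h, hs' _ (by decide), hb₁.hK]
    omega
  · rintro j s' hj ⟨h1, h2⟩ hs'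
    have hb' : Base I s' := hb₁.frame hs' (by decide)
    refine Exec.ops ?_
    have h4 := hQ (j + 1) hj
    rw [pow_succ, ← mul_assoc] at h4
    simp [opsWp, Input.eval, hb'.hOne, hb'.hN, h1, h2]
    exact ⟨Input.le_cap_of_trials h4, Input.le_cap_of_km (by omega), by omega, by ring⟩
  · rintro s' ⟨⟨-, h2⟩, hs'⟩
    exact ⟨by rw [hs' _ (by decide), hR₁], h2⟩

theorem silent {R : ℕ} {I : Input} {B : ℕ} {P : Prog R} {s : St R} {D : ℕ} {Q : St R → Prop}
    (h : Exec I B P s D Q) (hP : P.silent = true) :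
    Exec I B P s D fun s' => Q s' ∧ s'.out = s.out := by
  obtain ⟨s', d, hd, hr, hq⟩ := h
  exact ⟨s', d, hd, hr, hq, hr.out_eq hP⟩

theorem prepare (hI : I.Valid) (hs : ∀ r, s.regs r = 0) :
    Exec I I.cap Prog.prepare s
      (2 * I.n * (Nat.sqrt (4 * I.n) * 8 + 11) + 4 * Nat.clog 2 (4 * I.n) + 6 * I.n + 4 * I.k + 32)
      fun s' => ∃ p L ℓ, Setting I p L ℓ ∧ Env I p L ℓ s' ∧ s'.regs rCnt = 0 := by
  have hn := hI.n_pos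
  have hclog : ∀ {p : ℕ}, p ≤ 4 * I.n → Nat.clog 2 p ≤ Nat.clog 2 (4 * I.n) := fun h =>
    Nat.clog_mono_right 2 h
  refine Exec.mono (Exec.frame (D := 8 + ((2 * I.n * (Nat.sqrt (4 * I.n) * 8 + 11) + 2) +
    ((4 * Nat.clog 2 (4 * I.n) + 6) + ((6 * I.n + 6) + (4 * I.k + 10)))))
    (Q := fun s' => ∃ p L ℓ, Setting I p L ℓ ∧ Env I p L ℓ s')
    (Exec.seq (Exec.mono (Exec.readParams hI hs) le_rfl ?_)))
    (by omega) fun s' hs' => ?_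
  · rintro s₁ ⟨hb₁, hP₁, hFl₁⟩
    refine Exec.seq (Exec.mono (Exec.findPrime hI hb₁ hP₁ hFl₁) le_rfl ?_)
    rintro s₂ ⟨hb₂, p, hP₂, hp, hp1, hp2, hp3⟩
    refine Exec.seq (Exec.mono (Exec.findPow hI hb₂ hP₂ hp.two_le hp2)
      (by have := hclog hp2; omega) ?_)
    rintro s₃ ⟨hb₃, L, hP₃, hL₃, hPW₃, hKK₃, hL1, hL2⟩
    have hL0 : 1 ≤ L := by
      rcases Nat.eq_zero_or_pos L with h0 | h0
      · subst h0; simp at hL1; omega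
      · exact h0
    have hL8 : L ≤ 8 * I.n := by have : L < 2 ^ L := Nat.lt_two_pow_self; omega
    refine Exec.seq (Exec.mono (Exec.frame (Exec.findLen hI hb₃ hL₃ hL0 hL8)) le_rfl ?_)
    rintro s₄ ⟨⟨ℓ, hE₄, hℓ1, hℓ2, hℓ3⟩, hs₄⟩
    have hb₄ : Base I s₄ := hb₃.frame hs₄ (by decide)
    have hset : Setting I p L ℓ := ⟨hI, hp, hp1, hp3, hp2, hL1, hL2, hℓ1, hℓ2, hℓ3⟩
    refine Exec.mono (Exec.frame (Exec.countTrials hI hb₄ hE₄ hset.len_sq_le)) le_rfl ?_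
    rintro s₅ ⟨⟨hR₅, hQ₅⟩, hs₅⟩
    refine ⟨p, L, ℓ, hset, hb₄.frame hs₅ (by decide), ?_, ?_, ?_, ?_, ?_, hR₅, hQ₅⟩
    · rw [hs₅ _ (by decide), hs₄ _ (by decide), hP₃]
    · rw [hs₅ _ (by decide), hs₄ _ (by decide), hL₃]
    · rw [hs₅ _ (by decide), hs₄ _ (by decide), hPW₃]
    · rw [hs₅ _ (by decide), hs₄ _ (by decide), hKK₃]
    · rw [hs₅ _ (by decide), hE₄]
  · obtain ⟨⟨p, L, ℓ, h1, h2⟩, h3⟩ := hs'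
    exact ⟨p, L, ℓ, h1, h2, by rw [h3 _ (by decide), hs]⟩

end Exec

end KSum

/-! ### The code of a single trial -/

namespace KSum

namespace Prog

open Instr

/-- `rX :=` the hash value of `rV`. -/
def hash : Prog 41 :=
  ops [mul rX rAd rV, add rX rX rAc, mul rX rX rV, add rX rX rAb, mul rX rX rV, add rX rX rAa,
    mod rX rX rP, mod rX rX rNN]

/-- Advance `rX` to the next vertex of the walk. -/
def advance : Prog 41 :=
  seq (ite rX rN (ops [entry rV rZ rX, mod rV rV rN])
    (ops [sub rV rX rN, entry rV rOne rV, sub rV rB rV, mod rV rV rN])) hash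

/-- Go to the start of the walk. -/
def start : Prog 41 :=
  seq (ops [copy rV rN]) (seq hash (ops [copy rXs rX, copy rTo rX, copy rHa rX, copy rMe rX,
    const rC 0]))

/-- Tortoise and hare: `rMe :=` the place where they meet for the last time. -/
def meet : Prog 41 :=
  loop rC rE (seq (ops [copy rX rTo]) (seq advance (seq (ops [copy rTo rX, copy rX rHa])
    (seq advance (seq advance (seq (ops [copy rHa rX, add rC rC rOne])
      (ite rTo rHa (ops []) (ite rHa rTo (ops []) (ops [copy rMe rTo])))))))))

/-- See whether the vertices `rTo` and `rMe` give a solution. -/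
def check : Prog 41 :=
  ite rTo rN (ite rMe rN (ops []) (seq (ops [entry rU rZ rTo, sub rV rMe rN, entry rW rOne rV,
    add rV rU rW, add rV rV rRest]) (ite rV rT (ops []) (ite rT rV (ops [])
      (ops [copy rSa rU, copy rSb rW, copy rF rOne]))))) (ops [])

/-- Walk from the start and from the meeting place at the same speed. -/
def compare : Prog 41 :=
  seq (ops [copy rTo rXs, const rC 0])
    (loop rC rE (seq check (seq (ops [copy rX rTo]) (seq advance (seq (ops [copy rTo rX,
      copy rX rMe]) (seq advance (ops [copy rMe rX, add rC rC rOne])))))))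

/-- Compute the coefficients of the hash function from the random number `rA`. -/
def coefficients : Prog 41 :=
  ops [mod rAa rA rPW, div rA rA rPW, mod rAb rA rPW, div rA rA rPW, mod rAc rA rPW, div rA rA rPW,
    mod rAd rA rPW]

/-- Output a solution. -/
def report : Prog 41 :=
  seq (ops [output rSa, output rSb, copy rY rIdx, copy rC rTwo])
    (loop rC rK (ops [mod rU rY rN, div rY rY rN, entry rU rC rU, output rU, add rC rC rOne]))

/-- Go to the next trial or, if a solution was found, output it and finish. -/
def finish : Prog 41 :=
  seq (ops [add rCnt rCnt rOne]) (ite rZ rF (seq report (ops [copy rCnt rQ])) (ops []))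

/-- The part of a trial that follows the coin tosses. -/
def search : Prog 41 :=
  seq coefficients (seq start (seq meet (seq compare finish)))

/-- The part of a trial that precedes the coin tosses: the sum of the integers in the `k - 2` last
lists, in the positions given by the number of the trial. -/
def choosePositions : Prog 41 :=
  seq (ops [div rIdx rCnt rR, copy rY rIdx, const rRest 0, copy rC rTwo])
    (seq (loop rC rK (ops [mod rU rY rN, div rY rY rN, entry rU rC rU, add rRest rRest rU,
      add rC rC rOne]))
    (ops [mul rB rK rM, add rB rB rT, sub rB rB rRest, const rA 0, const rC 0, const rF 0]))

/-- Toss `rKK` coins. -/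
def toss : Prog 41 :=
  loop rC rKK (ops [coin rU, add rA rA rA, add rA rA rU, add rC rC rOne])

end Prog

/-! ### What the program computes -/

/-- A cubic polynomial modulo `p`, modulo `2 * n`. -/
def hashNat (n p : ℕ) (a : Fin 4 → ℕ) (z : ℕ) : ℕ :=
  (((a 3 * z + a 2) * z + a 1) * z + a 0) % p % (2 * n)

namespace Input

variable (I : Input)

/-- The residue modulo `n` that belongs to a vertex. -/
def cell (B x : ℕ) : ℕ :=
  if x < I.n then I.read 0 x % I.n else (B - I.read 1 (x - I.n)) % I.n

/-- The vertices of the walk. -/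
def orbit (p : ℕ) (a : Fin 4 → ℕ) (B : ℕ) : ℕ → ℕ
  | 0 => hashNat I.n p a I.n
  | c + 1 => hashNat I.n p a (I.cell B (orbit p a B c))

/-- The sum of the integers in the last `k - 2` lists in the positions coded by `q`. -/
def rest (q : ℕ) : ℕ := ∑ i ∈ range (I.k - 2), I.read (2 + i) (q / I.n ^ i % I.n)

theorem read_le (i j : ℕ) : I.read i j ≤ I.m := by
  unfold read
  split_ifs
  · exact (I.lists _ _).2
  · exact Nat.zero_le _

theorem cell_lt (hn : 0 < I.n) (B x : ℕ) : I.cell B x < I.n := by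
  unfold cell; split_ifs <;> exact Nat.mod_lt _ hn

theorem orbit_lt (hn : 0 < I.n) (p : ℕ) (a : Fin 4 → ℕ) (B c : ℕ) :
    I.orbit p a B c < 2 * I.n := by
  cases c <;> exact Nat.mod_lt _ (by omega)

theorem rest_le (q : ℕ) : I.rest q ≤ (I.k - 2) * I.m := by
  refine (Finset.sum_le_card_nsmul _ _ I.m fun i _ => I.read_le _ _).trans ?_
  simp

/-- The output solves the instance. -/
def Good (out : List ℕ) : Prop :=
  ∃ s : Fin I.k → ℕ, out = List.ofFn s ∧ IsSolution I.lists I.target s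

end Input

/-- The last `c' ≤ c` with `x c' = x (2 * c')`. -/
def lastMeet (x : ℕ → ℕ) : ℕ → ℕ
  | 0 => 0
  | c + 1 => if x (c + 1) = x (2 * (c + 1)) then c + 1 else lastMeet x c

/-- The vertices `x` and `y` give a solution. -/
def Input.Match (I : Input) (rest x y : ℕ) : Prop :=
  x < I.n ∧ I.n ≤ y ∧ I.read 0 x + I.read 1 (y - I.n) + rest = I.target

/-- A trial is successful. -/
def Input.Success (I : Input) (p ℓ : ℕ) (a : Fin 4 → ℕ) (B rest : ℕ) : Prop :=
  ∃ c < ℓ, I.Match rest (I.orbit p a B c)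
    (I.orbit p a B (lastMeet (I.orbit p a B) ℓ + c))

theorem lastMeet_spec {x : ℕ → ℕ} {c c₀ : ℕ} (h : c₀ ≤ c) (h0 : x c₀ = x (2 * c₀)) :
    c₀ ≤ lastMeet x c ∧ x (lastMeet x c) = x (2 * lastMeet x c) := by
  induction c with
  | zero =>
    obtain rfl : c₀ = 0 := by omega
    exact ⟨le_rfl, h0⟩
  | succ c ih =>
    rw [lastMeet]
    split_ifs with hx
    · exact ⟨h, hx⟩
    · rcases Nat.lt_or_ge c c₀ with h' | h'
      · obtain rfl : c₀ = c + 1 := by omega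
        exact absurd h0 hx
      · exact ih h'

/-- Two vertices with the same successor on a walk are found by Floyd's method. -/
theorem lastMeet_add {x : ℕ → ℕ} {u v ℓ : ℕ} (huv : u < v) (hv : v < ℓ)
    (hinj : ∀ s t, s ≤ v → t ≤ v → x s = x t → s = t) (hper : ∀ s, u + 1 ≤ s → x (s + (v - u)) = x s) :
    x (lastMeet x ℓ + u) = x v := by
  obtain ⟨d, rfl⟩ : ∃ d, v = u + d := ⟨v - u, by omega⟩
  rw [Nat.add_sub_cancel_left] at hper
  have hd : 0 < d := by omega
  have hper' : ∀ r s, u + 1 ≤ s → x (s + d * r) = x s := by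
    intro r
    induction r with
    | zero => intro s _; simp
    | succ r ih =>
      intro s hs
      rw [Nat.mul_succ, ← add_assoc, hper _ (by omega), ih s hs]
  -- Among the `d` consecutive times `u + 1, …, u + d` one is a multiple of the period `d`. There
  -- tortoise and hare meet, their distance being the multiple `c₀` of the period.
  obtain ⟨c₀, hc1, hc2, hc3⟩ : ∃ c₀, u + 1 ≤ c₀ ∧ c₀ ≤ u + d ∧ d ∣ c₀ := by
    refine ⟨d * ((u + d) / d), ?_, Nat.mul_div_le _ _, dvd_mul_right _ _⟩
    have := Nat.lt_mul_div_succ (u + d) hd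
    rw [Nat.mul_succ] at this
    omega
  obtain ⟨h1, h2⟩ := lastMeet_spec (x := x) (c := ℓ) (c₀ := c₀) (by omega) (by
    obtain ⟨r, rfl⟩ := hc3
    rw [two_mul, hper' r _ hc1])
  set M := lastMeet x ℓ
  have hred : ∀ s, u + 1 ≤ s → ∃ r, s = (u + 1 + (s - (u + 1)) % d) + d * r := by
    intro s hs
    refine ⟨(s - (u + 1)) / d, ?_⟩
    have := Nat.mod_add_div (s - (u + 1)) d
    omega
  have hx : ∀ s, u + 1 ≤ s → x s = x (u + 1 + (s - (u + 1)) % d) := by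
    intro s hs
    obtain ⟨r, hr⟩ := hred s hs
    conv_lhs => rw [hr]
    exact hper' r _ (by omega)
  -- The last meeting lies beyond `u`, hence on the cycle, where equal vertices mean equal times
  -- modulo `d`; so `d` divides `M`.
  have hmod : (M - (u + 1)) % d = (2 * M - (u + 1)) % d := by
    have h3 := Nat.mod_lt (M - (u + 1)) hd
    have h4 := Nat.mod_lt (2 * M - (u + 1)) hd
    rw [hx M (by omega), hx (2 * M) (by omega)] at h2
    have := hinj _ _ (by omega) (by omega) h2
    omega
  have hdvd : d ∣ M := by
    have h3 := (Nat.modEq_iff_dvd' (n := d) (by omega : M - (u + 1) ≤ 2 * M - (u + 1))).1 hmod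
    have e : 2 * M - (u + 1) - (M - (u + 1)) = M := by omega
    rwa [e] at h3
  obtain ⟨r, hr⟩ := hdvd
  have hr0 : 0 < r := by
    rcases Nat.eq_zero_or_pos r with h | h
    · subst h; simp at hr; omega
    · exact h
  obtain ⟨r', rfl⟩ : ∃ r', r = r' + 1 := ⟨r - 1, by omega⟩
  -- Time `M + u` differs from `v = u + d` by a multiple of the period, and both lie on the cycle.
  have e : M + u = (u + d) + d * r' := by rw [hr]; ring
  rw [e, hper' r' _ (by omega)]

/-! ### The parts of a trial -/

/-- The registers during the search. -/
structure Searching (I : Input) (p L ℓ q B : ℕ) (a : Fin 4 → ℕ) (s : St 41) : Prop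
    extends Env I p L ℓ s where
  hIdx : s.regs rIdx = q
  hRest : s.regs rRest = I.rest q
  hB : s.regs rB = B
  hAa : s.regs rAa = a 0
  hAb : s.regs rAb = a 1
  hAc : s.regs rAc = a 2
  hAd : s.regs rAd = a 3

theorem Searching.frame {I : Input} {p L ℓ q B : ℕ} {a : Fin 4 → ℕ} {s s' : St 41} {P : Prog 41}
    (h : Searching I p L ℓ q B a s) (hs : SameOff P s s')
    (hP : ∀ r ∈ [rZ, rK, rN, rM, rT, rOne, rTwo, rNN, rP, rL, rPW, rKK, rE, rR, rQ, rIdx, rRest, rB,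
      rAa, rAb, rAc, rAd], r ∉ P.writes) : Searching I p L ℓ q B a s' where
  toEnv := h.toEnv.frame hs fun r hr => hP r (by revert r; decide)
  hIdx := by rw [hs _ (hP _ (by decide)), h.hIdx]
  hRest := by rw [hs _ (hP _ (by decide)), h.hRest]
  hB := by rw [hs _ (hP _ (by decide)), h.hB]
  hAa := by rw [hs _ (hP _ (by decide)), h.hAa]
  hAb := by rw [hs _ (hP _ (by decide)), h.hAb]
  hAc := by rw [hs _ (hP _ (by decide)), h.hAc]
  hAd := by rw [hs _ (hP _ (by decide)), h.hAd]

namespace Exec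

variable {I : Input} {p L ℓ q B : ℕ} {a : Fin 4 → ℕ} {s : St 41}

/-- The coefficients are at most `8 * n` and the argument is at most `n`, so all intermediate
results of Horner's scheme stay below `32 * n ^ 4`. -/
theorem hash (hset : Setting I p L ℓ) (h : Searching I p L ℓ q B a s) (ha : ∀ i, a i ≤ 8 * I.n)
    {z : ℕ} (hV : s.regs rV = z) (hz : z ≤ I.n) :
    Exec I I.cap Prog.hash s 8 fun s' => s'.regs rX = hashNat I.n p a z := by
  have hn := hset.n_pos
  have h1 : a 3 * z ≤ 8 * I.n ^ 2 := by
    calc a 3 * z ≤ (8 * I.n) * I.n := Nat.mul_le_mul (ha 3) hz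
      _ = _ := by ring
  have hn2 : I.n ≤ I.n ^ 2 := Nat.le_self_pow (by norm_num) _
  have hn3 : I.n ≤ I.n ^ 3 := Nat.le_self_pow (by norm_num) _
  have hn4 : I.n ≤ I.n ^ 4 := Nat.le_self_pow (by norm_num) _
  have h2 : a 3 * z + a 2 ≤ 16 * I.n ^ 2 := by have := ha 2; omega
  have h3 : (a 3 * z + a 2) * z ≤ 16 * I.n ^ 3 := by
    calc (a 3 * z + a 2) * z ≤ (16 * I.n ^ 2) * I.n := Nat.mul_le_mul h2 hz
      _ = _ := by ring
  have h4 : (a 3 * z + a 2) * z + a 1 ≤ 24 * I.n ^ 3 := by have := ha 1; omega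
  have h5 : ((a 3 * z + a 2) * z + a 1) * z ≤ 24 * I.n ^ 4 := by
    calc ((a 3 * z + a 2) * z + a 1) * z ≤ (24 * I.n ^ 3) * I.n := Nat.mul_le_mul h4 hz
      _ = _ := by ring
  have h6 : ((a 3 * z + a 2) * z + a 1) * z + a 0 ≤ 32 * I.n ^ 4 := by have := ha 0; omega
  have hc : ∀ {x i : ℕ}, i ≤ 4 → x ≤ 32 * I.n ^ i → x ≤ I.cap := fun hi h =>
    Input.le_cap_of_pow hset.toValid hi (h.trans (Nat.mul_le_mul_right _ (by norm_num)))
  have h7 : (((a 3 * z + a 2) * z + a 1) * z + a 0) % p ≤ 32 * I.n ^ 4 :=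
    (Nat.mod_le _ _).trans h6
  have h8 : (((a 3 * z + a 2) * z + a 1) * z + a 0) % p % (2 * I.n) ≤ 32 * I.n ^ 4 :=
    (Nat.mod_le _ _).trans h7
  refine Exec.ops ?_
  simp [opsWp, Input.eval, h.hAa, h.hAb, h.hAc, h.hAd, h.hP, h.hNN, hV, hashNat]
  exact ⟨hc (i := 2) (by norm_num) (by omega), hc (i := 2) (by norm_num) (by omega),
    hc (i := 3) (by norm_num) (by omega), hc (i := 3) (by norm_num) (by omega),
    hc (i := 4) (by norm_num) (by omega), hc (i := 4) (by norm_num) (by omega),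
    hc (i := 4) (by norm_num) (by omega), hc (i := 4) (by norm_num) (by omega)⟩

theorem advance (hset : Setting I p L ℓ) (h : Searching I p L ℓ q B a s) (ha : ∀ i, a i ≤ 8 * I.n)
    (hB : B ≤ 2 * (I.k * I.m)) {x : ℕ} (hX : s.regs rX = x) (hx : x ≤ 2 * I.n) :
    Exec I I.cap Prog.advance s 14 fun s' => s'.regs rX = hashNat I.n p a (I.cell B x) := by
  have hn := hset.n_pos
  have hkm := hset.toValid.le_km
  have hc : ∀ {x : ℕ}, x ≤ 4 * (I.k * I.m) → x ≤ I.cap := Input.le_cap_of_km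
  refine Exec.seq (D := 6) (D' := 8) (Exec.mono (Exec.frame (Exec.ite (D := 4)
    (Q := fun s' => s'.regs rV = I.cell B x) ?_ ?_)) le_rfl ?_)
  · intro hlt
    rw [hX, h.hN] at hlt
    refine Exec.mono (Exec.ops ?_) (by decide : 2 ≤ 4) fun _ h => h
    have h1 := I.read_le 0 x
    have h2 := Nat.mod_le (I.read 0 x) I.n
    simp [opsWp, Input.eval, h.hZ, h.hN, hX, Input.cell, hlt]
    exact ⟨hc (by omega), hc (by omega)⟩
  · intro hlt
    rw [hX, h.hN] at hlt
    refine Exec.ops ?_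
    have h1 := I.read_le 1 (x - I.n)
    have h2 := Nat.mod_le (B - I.read 1 (x - I.n)) I.n
    simp [opsWp, Input.eval, h.hOne, h.hN, h.hB, hX, Input.cell, hlt]
    have h3 : 2 * I.n ≤ I.cap := Input.le_cap_of_n hset.toValid (by omega)
    have h4 : 2 * (I.k * I.m) ≤ I.cap := hc (by omega)
    exact ⟨by omega, by omega, by omega, by omega⟩
  rintro s₁ ⟨hV₁, hs₁⟩
  exact Exec.hash hset (h.frame hs₁ (by decide)) ha hV₁ (I.cell_lt hn B x).le

theorem start (hset : Setting I p L ℓ) (h : Searching I p L ℓ q B a s) (ha : ∀ i, a i ≤ 8 * I.n) :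
    Exec I I.cap Prog.start s 14 fun s' => s'.regs rXs = I.orbit p a B 0 ∧
      s'.regs rTo = I.orbit p a B 0 ∧ s'.regs rHa = I.orbit p a B 0 ∧
      s'.regs rMe = I.orbit p a B 0 ∧ s'.regs rC = 0 := by
  have hn := hset.n_pos
  refine Exec.seq (D := 1) (D' := 13) (Exec.mono (Exec.frame (Exec.ops
    (Q := fun s' => s'.regs rV = I.n) ?_)) le_rfl ?_)
  · simp [opsWp, Input.eval, h.hN]
    exact Input.le_cap_of_n hset.toValid (by omega)
  rintro s₁ ⟨hV₁, hs₁⟩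
  have h₁ := h.frame hs₁ (by decide)
  refine Exec.seq (D := 8) (D' := 5) (Exec.mono (Exec.hash hset h₁ ha hV₁ le_rfl) le_rfl ?_)
  intro s₂ hX₂
  refine Exec.ops ?_
  have := I.orbit_lt hn p a B 0
  rw [Input.orbit] at this
  simp [opsWp, Input.eval, hX₂, Input.orbit]
  exact Input.le_cap_of_n hset.toValid (by omega)

theorem meet (hset : Setting I p L ℓ) (h : Searching I p L ℓ q B a s) (ha : ∀ i, a i ≤ 8 * I.n)
    (hB : B ≤ 2 * (I.k * I.m)) (hTo : s.regs rTo = I.orbit p a B 0)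
    (hHa : s.regs rHa = I.orbit p a B 0) (hMe : s.regs rMe = I.orbit p a B 0)
    (hC : s.regs rC = 0) :
    Exec I I.cap Prog.meet s (54 * ℓ + 2) fun s' =>
      s'.regs rMe = I.orbit p a B (lastMeet (I.orbit p a B) ℓ) := by
  have hn := hset.n_pos
  have hℓ := hset.len_sq_le
  have hℓ2 : ℓ ≤ ℓ ^ 2 := Nat.le_self_pow (by norm_num) _
  have hlt := I.orbit_lt hn p a B
  have hsucc : ∀ c, hashNat I.n p a (I.cell B (I.orbit p a B c)) = I.orbit p a B (c + 1) :=
    fun _ => rfl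
  have hc : ∀ c, I.orbit p a B c ≤ I.cap := fun c =>
    Input.le_cap_of_n hset.toValid (by have := hlt c; omega)
  set x := I.orbit p a B
  refine Exec.mono (Exec.loop (D := 52) ℓ (fun j s' => s'.regs rTo = x j ∧
    s'.regs rHa = x (2 * j) ∧ s'.regs rMe = x (lastMeet x j) ∧ s'.regs rC = j)
    ⟨hTo, hHa, hMe, hC⟩ ?_ ?_) (by omega) ?_
  · rintro j s' hj ⟨-, -, -, hC'⟩ hs'
    rw [hC', hs' _ (by decide), h.hE]
  · rintro j s₀ hj ⟨hTo₀, hHa₀, hMe₀, hC₀⟩ hs₀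
    have h₀ := h.frame hs₀ (by decide)
    refine Exec.seq (D := 1) (D' := 51) (Exec.mono (Exec.frame (Exec.ops (Q := fun s' =>
      s'.regs rX = x j) ?_)) le_rfl ?_)
    · simp [opsWp, Input.eval, hTo₀, hc]
    rintro s₁ ⟨hX₁, hs₁⟩
    have h₁ := h₀.frame hs₁ (by decide)
    refine Exec.seq (D := 14) (D' := 37) (Exec.mono (Exec.frame
      (Exec.advance hset h₁ ha hB hX₁ (hlt j).le)) le_rfl ?_)
    rintro s₂ ⟨hX₂, hs₂⟩
    rw [hsucc] at hX₂
    have h₂ := h₁.frame hs₂ (by decide)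
    have hHa₂ : s₂.regs rHa = x (2 * j) := by
      rw [hs₂ _ (by decide), hs₁ _ (by decide), hHa₀]
    refine Exec.seq (D := 2) (D' := 35) (Exec.mono (Exec.frame (Exec.ops (Q := fun s' =>
      s'.regs rX = x (2 * j) ∧ s'.regs rTo = x (j + 1)) ?_)) le_rfl ?_)
    · simp [opsWp, Input.eval, hX₂, hHa₂, hc]
    rintro s₃ ⟨⟨hX₃, hTo₃⟩, hs₃⟩
    have h₃ := h₂.frame hs₃ (by decide)
    refine Exec.seq (D := 14) (D' := 21) (Exec.mono (Exec.frame
      (Exec.advance hset h₃ ha hB hX₃ (hlt _).le)) le_rfl ?_)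
    rintro s₄ ⟨hX₄, hs₄⟩
    rw [hsucc] at hX₄
    have h₄ := h₃.frame hs₄ (by decide)
    refine Exec.seq (D := 14) (D' := 7) (Exec.mono (Exec.frame
      (Exec.advance hset h₄ ha hB hX₄ (hlt _).le)) le_rfl ?_)
    rintro s₅ ⟨hX₅, hs₅⟩
    rw [hsucc] at hX₅
    have h₅ := h₄.frame hs₅ (by decide)
    have hC₅ : s₅.regs rC = j := by
      rw [hs₅ _ (by decide), hs₄ _ (by decide), hs₃ _ (by decide), hs₂ _ (by decide),
        hs₁ _ (by decide), hC₀]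
    have hTo₅ : s₅.regs rTo = x (j + 1) := by
      rw [hs₅ _ (by decide), hs₄ _ (by decide), hTo₃]
    have hMe₅ : s₅.regs rMe = x (lastMeet x j) := by
      rw [hs₅ _ (by decide), hs₄ _ (by decide), hs₃ _ (by decide), hs₂ _ (by decide),
        hs₁ _ (by decide), hMe₀]
    refine Exec.seq (D := 2) (D' := 5) (Exec.mono (Exec.ops (Q := fun s' =>
      s'.regs rHa = x (2 * (j + 1)) ∧ s'.regs rC = j + 1 ∧ s'.regs rTo = x (j + 1) ∧
      s'.regs rMe = x (lastMeet x j)) ?_) le_rfl ?_)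
    · have e : 2 * j + 1 + 1 = 2 * (j + 1) := by ring
      rw [e] at hX₅
      simp [opsWp, Input.eval, hX₅, hTo₅, hMe₅, hC₅, h₅.hOne, hc]
      exact Input.le_cap_of_n hset.toValid (by omega)
    rintro s₆ ⟨hHa₆, hC₆, hTo₆, hMe₆⟩
    -- Equality of tortoise and hare is detected by the failure of both strict comparisons.
    refine Exec.ite (D := 3) (fun hcmp => ?_) (fun hcmp => Exec.ite (D := 1) (fun hcmp' => ?_)
      (fun hcmp' => ?_)) <;> rw [hHa₆, hTo₆] at hcmp
    · refine Exec.mono (Exec.ops (l := []) ?_) (Nat.zero_le 3) fun _ h => h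
      exact ⟨hTo₆, hHa₆, by rw [hMe₆, lastMeet, if_neg (by omega)], hC₆⟩
    · rw [hHa₆, hTo₆] at hcmp'
      refine Exec.mono (Exec.ops (l := []) ?_) (Nat.zero_le 1) fun _ h => h
      exact ⟨hTo₆, hHa₆, by rw [hMe₆, lastMeet, if_neg (by omega)], hC₆⟩
    · rw [hHa₆, hTo₆] at hcmp'
      refine Exec.ops ?_
      have e : x (j + 1) = x (2 * (j + 1)) := by omega
      simp [opsWp, Input.eval, hTo₆, hHa₆, hC₆, hc, lastMeet, e]
  · rintro s' ⟨⟨-, -, h', -⟩, -⟩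
    exact h'

theorem check (hset : Setting I p L ℓ) (h : Searching I p L ℓ q B a s) {x y : ℕ}
    (hTo : s.regs rTo = x) (hMe : s.regs rMe = y) (hy : y < 2 * I.n) :
    Exec I I.cap Prog.check s 16 fun s' =>
      (I.Match (I.rest q) x y ∧ s'.regs rF = 1 ∧ s'.regs rSa = I.read 0 x ∧
          s'.regs rSb = I.read 1 (y - I.n)) ∨
        (¬I.Match (I.rest q) x y ∧ s'.regs rF = s.regs rF ∧ s'.regs rSa = s.regs rSa ∧
          s'.regs rSb = s.regs rSb) := by
  have hn := hset.n_pos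
  have hkm := hset.toValid.le_km
  have h2n : 2 * I.n ≤ I.cap := Input.le_cap_of_n hset.toValid (by omega)
  have hcap : 4 * (I.k * I.m) ≤ I.cap := Input.le_cap_of_km le_rfl
  have hrest : I.rest q ≤ I.k * I.m :=
    (I.rest_le q).trans (Nat.mul_le_mul_right _ (Nat.sub_le _ _))
  have h1 := I.read_le 0 x
  have h2 := I.read_le 1 (y - I.n)
  refine Exec.ite (D := 14) (fun hlt => ?_) (fun hlt => ?_)
  · rw [hTo, h.hN] at hlt
    refine Exec.ite (D := 12) (fun hlt' => ?_) (fun hlt' => ?_)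
    · rw [hMe, h.hN] at hlt'
      refine Exec.mono (Exec.ops (l := []) ?_) (Nat.zero_le _) fun _ h => h
      exact Or.inr ⟨fun hm => by have := hm.2.1; omega, rfl, rfl, rfl⟩
    · rw [hMe, h.hN] at hlt'
      refine Exec.seq (D := 5) (D' := 7) (Exec.mono (Exec.frame (Exec.ops (Q := fun s' =>
        s'.regs rU = I.read 0 x ∧ s'.regs rW = I.read 1 (y - I.n) ∧
        s'.regs rV = I.read 0 x + I.read 1 (y - I.n) + I.rest q) ?_)) le_rfl ?_)
      · simp [opsWp, Input.eval, hTo, hMe, h.hN, h.hZ, h.hOne, h.hRest]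
        exact ⟨by omega, by omega, by omega, by omega, by omega⟩
      rintro s₁ ⟨⟨hU₁, hW₁, hV₁⟩, hs₁⟩
      have h₁ := h.frame hs₁ (by decide)
      have hF₁ : s₁.regs rF = s.regs rF := hs₁ _ (by decide)
      have hSa₁ : s₁.regs rSa = s.regs rSa := hs₁ _ (by decide)
      have hSb₁ : s₁.regs rSb = s.regs rSb := hs₁ _ (by decide)
      refine Exec.ite (D := 5) (fun hcmp => ?_) (fun hcmp => Exec.ite (D := 3) (fun hcmp' => ?_)
        (fun hcmp' => ?_)) <;> rw [hV₁, h₁.hT] at hcmp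
      · refine Exec.mono (Exec.ops (l := []) ?_) (Nat.zero_le _) fun _ h => h
        exact Or.inr ⟨fun hm => by have := hm.2.2; omega, hF₁, hSa₁, hSb₁⟩
      · rw [hV₁, h₁.hT] at hcmp'
        refine Exec.mono (Exec.ops (l := []) ?_) (Nat.zero_le _) fun _ h => h
        exact Or.inr ⟨fun hm => by have := hm.2.2; omega, hF₁, hSa₁, hSb₁⟩
      · rw [hV₁, h₁.hT] at hcmp'
        have hm : I.Match (I.rest q) x y := ⟨hlt, by omega, by omega⟩
        refine Exec.ops ?_
        simp [opsWp, Input.eval, hU₁, hW₁, h₁.hOne, hm]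
        exact ⟨by omega, by omega, by omega⟩
  · rw [hTo, h.hN] at hlt
    refine Exec.mono (Exec.ops (l := []) ?_) (Nat.zero_le _) fun _ h => h
    exact Or.inr ⟨fun hm => hlt hm.1, rfl, rfl, rfl⟩

/-- If `rF = 1`, then two integers from the first two lists that complete a solution are in `rSa`
and `rSb`. -/
def _root_.KSum.Found (I : Input) (rest : ℕ) (s : St 41) : Prop :=
  s.regs rF = 1 ∧ ∃ i < I.n, ∃ j < I.n, s.regs rSa = I.read 0 i ∧ s.regs rSb = I.read 1 j ∧
    I.read 0 i + I.read 1 j + rest = I.target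

/-- Later rounds can replace a recorded match only by another match, so `Found` persists until the
end of the loop. -/
theorem compare (hset : Setting I p L ℓ) (h : Searching I p L ℓ q B a s) (ha : ∀ i, a i ≤ 8 * I.n)
    (hB : B ≤ 2 * (I.k * I.m)) (hXs : s.regs rXs = I.orbit p a B 0)
    (hMe : s.regs rMe = I.orbit p a B (lastMeet (I.orbit p a B) ℓ)) (hF : s.regs rF = 0) :
    Exec I I.cap Prog.compare s (51 * ℓ + 4) fun s' => Found I (I.rest q) s' ∨
      (s'.regs rF = 0 ∧ ¬I.Success p ℓ a B (I.rest q)) := by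
  have hn := hset.n_pos
  have hℓ := hset.len_sq_le
  have hℓ2 : ℓ ≤ ℓ ^ 2 := Nat.le_self_pow (by norm_num) _
  have hlt := I.orbit_lt hn p a B
  have hsucc : ∀ c, hashNat I.n p a (I.cell B (I.orbit p a B c)) = I.orbit p a B (c + 1) :=
    fun _ => rfl
  have hc : ∀ c, I.orbit p a B c ≤ I.cap := fun c =>
    Input.le_cap_of_n hset.toValid (by have := hlt c; omega)
  unfold Input.Success
  set x := I.orbit p a B
  set M := lastMeet x ℓ
  refine Exec.seq (D := 2) (D' := 51 * ℓ + 2) (Exec.mono (Exec.frame (Exec.ops (Q := fun s' =>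
    s'.regs rTo = x 0 ∧ s'.regs rC = 0) ?_)) le_rfl ?_) |>.mono (by omega) fun _ h => h
  · simp [opsWp, Input.eval, hXs, hc]
  rintro s₁ ⟨⟨hTo₁, hC₁⟩, hs₁⟩
  have h₁ := h.frame hs₁ (by decide)
  refine Exec.mono (Exec.loop (D := 49) ℓ (fun j s' => s'.regs rTo = x j ∧
    s'.regs rMe = x (M + j) ∧ s'.regs rC = j ∧ (Found I (I.rest q) s' ∨
      (s'.regs rF = 0 ∧ ¬∃ c < j, I.Match (I.rest q) (x c) (x (M + c)))))
    ⟨hTo₁, ?_, hC₁, Or.inr ⟨?_, ?_⟩⟩ ?_ ?_) (by omega) ?_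
  · rw [hs₁ _ (by decide), hMe, add_zero]
  · rw [hs₁ _ (by decide), hF]
  · rintro ⟨c, hc, -⟩; omega
  · rintro j s' hj ⟨-, -, hC', -⟩ hs'
    rw [hC', hs' _ (by decide), h₁.hE]
  · rintro j s₀ hj ⟨hTo₀, hMe₀, hC₀, hfound⟩ hs₀
    have h₀ := h₁.frame hs₀ (by decide)
    refine Exec.seq (D := 16) (D' := 33) (Exec.mono (Exec.frame
      (Exec.check hset h₀ hTo₀ hMe₀ (hlt _))) le_rfl ?_)
    rintro s₂ ⟨hchk, hs₂⟩
    have h₂ := h₀.frame hs₂ (by decide)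
    have hfound₂ : Found I (I.rest q) s₂ ∨
        (s₂.regs rF = 0 ∧ ¬∃ c < j + 1, I.Match (I.rest q) (x c) (x (M + c))) := by
      rcases hchk with ⟨hm, h1, h2, h3⟩ | ⟨hm, h1, h2, h3⟩
      · have := hlt (M + j)
        exact Or.inl ⟨h1, _, hm.1, _, by have := hm.2.1; omega, h2, h3, hm.2.2⟩
      · rcases hfound with ⟨h4, h5⟩ | ⟨h4, h5⟩
        · rw [← h2, ← h3] at h5
          exact Or.inl ⟨h1.trans h4, h5⟩
        · refine Or.inr ⟨h1.trans h4, ?_⟩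
          rintro ⟨c, hc, hm'⟩
          rcases Nat.lt_succ_iff_lt_or_eq.1 hc with h' | rfl
          · exact h5 ⟨c, h', hm'⟩
          · exact hm hm'
    have hTo₂ : s₂.regs rTo = x j := by rw [hs₂ _ (by decide), hTo₀]
    refine Exec.seq (D := 1) (D' := 32) (Exec.mono (Exec.frame (Exec.ops (Q := fun s' =>
      s'.regs rX = x j) ?_)) le_rfl ?_)
    · simp [opsWp, Input.eval, hTo₂, hc]
    rintro s₃ ⟨hX₃, hs₃⟩
    have h₃ := h₂.frame hs₃ (by decide)
    refine Exec.seq (D := 14) (D' := 18) (Exec.mono (Exec.frame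
      (Exec.advance hset h₃ ha hB hX₃ (hlt j).le)) le_rfl ?_)
    rintro s₄ ⟨hX₄, hs₄⟩
    rw [hsucc] at hX₄
    have h₄ := h₃.frame hs₄ (by decide)
    have hMe₄ : s₄.regs rMe = x (M + j) := by
      rw [hs₄ _ (by decide), hs₃ _ (by decide), hs₂ _ (by decide), hMe₀]
    refine Exec.seq (D := 2) (D' := 16) (Exec.mono (Exec.frame (Exec.ops (Q := fun s' =>
      s'.regs rX = x (M + j) ∧ s'.regs rTo = x (j + 1)) ?_)) le_rfl ?_)
    · simp [opsWp, Input.eval, hX₄, hMe₄, hc]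
    rintro s₅ ⟨⟨hX₅, hTo₅⟩, hs₅⟩
    have h₅ := h₄.frame hs₅ (by decide)
    refine Exec.seq (D := 14) (D' := 2) (Exec.mono (Exec.frame
      (Exec.advance hset h₅ ha hB hX₅ (hlt _).le)) le_rfl ?_)
    rintro s₆ ⟨hX₆, hs₆⟩
    rw [hsucc] at hX₆
    have h₆ := h₅.frame hs₆ (by decide)
    have hsame : ∀ r, r ∉ [rX, rV, rU, rTo] → s₆.regs r = s₂.regs r := by
      intro r hr
      have e : ∀ {P : Prog 41}, (∀ r ∈ P.writes, r ∈ [rX, rV, rU, rTo]) → r ∉ P.writes :=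
        fun hP hr' => hr (hP r hr')
      rw [hs₆ _ (e (by decide)), hs₅ _ (e (by decide)), hs₄ _ (e (by decide)), hs₃ _ (e (by decide))]
    have hTo₆ : s₆.regs rTo = x (j + 1) := by rw [hs₆ _ (by decide), hTo₅]
    have hC₆ : s₆.regs rC = j := by rw [hsame _ (by decide), hs₂ _ (by decide), hC₀]
    refine Exec.ops ?_
    unfold Found at hfound₂ ⊢
    simp [opsWp, Input.eval, hX₆, hTo₆, hC₆, h₆.hOne, hc, hsame]
    simp at hfound₂
    exact ⟨Input.le_cap_of_n hset.toValid (by omega), rfl, hfound₂⟩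
  · rintro s' ⟨⟨-, -, -, h'⟩, -⟩
    exact h'

end Exec

end KSum

/-! ### Choice of positions, search and output -/

namespace KSum

/-- The registers at the time of the coin tosses. -/
structure Chosen (I : Input) (p L ℓ q B : ℕ) (s : St 41) : Prop extends Env I p L ℓ s where
  hIdx : s.regs rIdx = q
  hRest : s.regs rRest = I.rest q
  hB : s.regs rB = B
  hF : s.regs rF = 0

theorem Chosen.frame {I : Input} {p L ℓ q B : ℕ} {s s' : St 41} {P : Prog 41}
    (h : Chosen I p L ℓ q B s) (hs : SameOff P s s')
    (hP : ∀ r ∈ [rZ, rK, rN, rM, rT, rOne, rTwo, rNN, rP, rL, rPW, rKK, rE, rR, rQ, rIdx, rRest, rB,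
      rF], r ∉ P.writes) : Chosen I p L ℓ q B s' where
  toEnv := h.toEnv.frame hs fun r hr => hP r (by revert r; decide)
  hIdx := by rw [hs _ (hP _ (by decide)), h.hIdx]
  hRest := by rw [hs _ (hP _ (by decide)), h.hRest]
  hB := by rw [hs _ (hP _ (by decide)), h.hB]
  hF := by rw [hs _ (hP _ (by decide)), h.hF]

/-- The digits of `x` in base `2 ^ L`. -/
def coefficient (L x : ℕ) (i : Fin 4) : ℕ := x / (2 ^ L) ^ (i : ℕ) % 2 ^ L

/-- The output of a solution. -/
def Input.solution (I : Input) (x y q : ℕ) : List ℕ :=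
  [x, y] ++ (List.range (I.k - 2)).map fun i => I.read (2 + i) (q / I.n ^ i % I.n)

theorem Input.good_solution {I : Input} (hI : I.Valid) {i j q : ℕ} (hi : i < I.n) (hj : j < I.n)
    (h : I.read 0 i + I.read 1 j + I.rest q = I.target) :
    I.Good (I.solution (I.read 0 i) (I.read 1 j) q) := by
  obtain ⟨k, n, m, w, t⟩ := I
  have hk : 2 ≤ k := hI.two_le_k
  have hn : 0 < n := hI.n_pos
  obtain ⟨k, rfl⟩ : ∃ k', k = k' + 2 := ⟨k - 2, by omega⟩
  set I : Input := ⟨k + 2, n, m, w, t⟩ with hIdef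
  let pos : ℕ → ℕ := fun c => if c = 0 then i else if c = 1 then j else q / n ^ (c - 2) % n
  have hpos : ∀ c, pos c < n := by
    intro c
    simp only [pos]
    split_ifs
    · exact hi
    · exact hj
    · exact Nat.mod_lt _ hn
  have e : ∀ c, I.read (c + 1 + 1) (pos (c + 1 + 1)) = I.read (2 + c) (q / n ^ c % n) := by
    intro c
    simp only [pos, add_comm 2 c]
    rfl
  refine ⟨fun c => I.read c (pos c), ?_, fun c => ⟨⟨pos c, hpos c⟩, ?_⟩, ?_⟩
  · rw [List.ofFn_succ, List.ofFn_succ]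
    have e1 : I.k - 2 = k := rfl
    simp only [Input.solution, e1, List.cons_append, List.nil_append]
    congr 2
    rw [← List.map_coe_finRange_eq_range, List.map_map, List.ofFn_eq_map]
    refine List.map_congr_left fun c _ => ?_
    exact (e c).symm
  · have hc : (c : ℕ) < I.k ∧ pos c < I.n := ⟨c.2, hpos c⟩
    exact dif_pos hc
  · have e2 : ∑ c : Fin (k + 2), I.read c (pos c) = ∑ c ∈ range (k + 2), I.read c (pos c) :=
      Fin.sum_univ_eq_sum_range (fun c => I.read c (pos c)) (k + 2)
    refine e2.trans ?_
    rw [sum_range_succ', sum_range_succ', sum_congr rfl fun c _ => e c]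
    have e3 : ∑ c ∈ range k, I.read (2 + c) (q / n ^ c % n) = I.rest q := rfl
    rw [e3]
    change _ = I.target
    rw [← h]
    simp [pos]
    ring

namespace Exec

variable {I : Input} {p L ℓ q B : ℕ} {s : St 41}

theorem coefficients (hset : Setting I p L ℓ) (h : Chosen I p L ℓ q B s) {x : ℕ}
    (hA : s.regs rA = x) (hx : x < 2 ^ (4 * L)) :
    Exec I I.cap Prog.coefficients s 7 fun s' => Searching I p L ℓ q B (coefficient L x) s' := by
  have hn := hset.n_pos
  have hpw : 2 ^ L ≤ 8 * I.n := by have := hset.pow_lt; have := hset.p_le; omega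
  have hx4 : x ≤ I.cap := by
    refine Input.le_cap_of_pow (i := 4) hset.toValid le_rfl (hx.le.trans ?_)
    calc 2 ^ (4 * L) = (2 ^ L) ^ 4 := by rw [mul_comm, pow_mul]
      _ ≤ (8 * I.n) ^ 4 := Nat.pow_le_pow_left hpw 4
      _ = 4096 * I.n ^ 4 := by ring
      _ ≤ _ := Nat.mul_le_mul_right _ (by norm_num)
  have hmod : ∀ y, y ≤ x → y % 2 ^ L ≤ I.cap := fun y hy => (Nat.mod_le _ _).trans (hy.trans hx4)
  have h1 : x / 2 ^ L ≤ x := Nat.div_le_self _ _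
  have h2 : x / 2 ^ L / 2 ^ L ≤ x := (Nat.div_le_self _ _).trans h1
  have h3 : x / 2 ^ L / 2 ^ L / 2 ^ L ≤ x := (Nat.div_le_self _ _).trans h2
  refine Exec.mono (Exec.frame (Exec.ops (Q := fun s' => s'.regs rAa = x % 2 ^ L ∧
    s'.regs rAb = x / 2 ^ L % 2 ^ L ∧ s'.regs rAc = x / 2 ^ L / 2 ^ L % 2 ^ L ∧
    s'.regs rAd = x / 2 ^ L / 2 ^ L / 2 ^ L % 2 ^ L) ?_)) le_rfl ?_
  · simp only [opsWp, Input.eval, h.hPW, hA, Function.update_self, ne_eq, Fin.reduceEq,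
      not_false_eq_true, Function.update_of_ne]
    exact ⟨hmod _ le_rfl, h1.trans hx4, hmod _ h1, h2.trans hx4, hmod _ h2, h3.trans hx4, hmod _ h3,
      trivial, trivial, trivial, trivial⟩
  · rintro s₁ ⟨⟨ha, hb, hc, hd⟩, hs₁⟩
    have h₁ := h.frame hs₁ (by decide)
    refine ⟨h₁.toEnv, h₁.hIdx, h₁.hRest, h₁.hB, ?_, ?_, ?_, ?_⟩
    · rw [ha]; simp [coefficient]
    · rw [hb]; simp [coefficient]
    · rw [hc, Nat.div_div_eq_div_mul]; simp [coefficient, sq]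
    · rw [hd, Nat.div_div_eq_div_mul, Nat.div_div_eq_div_mul]; simp [coefficient, pow_succ, mul_assoc]

theorem report (hset : Setting I p L ℓ) (h : Env I p L ℓ s) (hIdx : s.regs rIdx = q)
    (hq : q ≤ I.cap) {x y : ℕ} (hSa : s.regs rSa = x) (hSb : s.regs rSb = y) (hout : s.out = []) :
    Exec I I.cap Prog.report s (7 * I.k + 6) fun s' => s'.out = I.solution x y q := by
  have hn := hset.n_pos
  have hkm := hset.toValid.le_km
  have h2k := hset.two_le_k
  have h2n : 2 * I.n ≤ I.cap := Input.le_cap_of_n hset.toValid (by omega)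
  have hcap : 4 * (I.k * I.m) ≤ I.cap := Input.le_cap_of_km le_rfl
  refine Exec.mono (D := 4 + ((I.k - 2) * 7 + 2)) (Exec.seq (Exec.mono (Exec.frame (Exec.ops
    (Q := fun s' => s'.regs rY = q ∧ s'.regs rC = 2 ∧ s'.out = [x, y]) ?_)) le_rfl ?_)) (by omega)
    fun _ h => h
  · simp [opsWp, Input.eval, Instr.outReg, hSa, hSb, hIdx, h.hTwo, hout]
    exact ⟨hq, by omega⟩
  rintro s₁ ⟨⟨hY₁, hC₁, hout₁⟩, hs₁⟩
  have h₁ := h.frame hs₁ (by decide)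
  refine Exec.mono (Exec.loop (D := 5) (I.k - 2) (fun j s' => s'.regs rC = 2 + j ∧
    s'.regs rY = q / I.n ^ j ∧ s'.out = [x, y] ++ (List.range j).map fun i =>
      I.read (2 + i) (q / I.n ^ i % I.n)) ⟨hC₁, by simpa using hY₁, by simpa using hout₁⟩ ?_ ?_)
    le_rfl ?_
  · rintro j s' hj ⟨h', -, -⟩ hs'
    rw [h', hs' _ (by decide), h₁.hK]
    omega
  · rintro j s' hj ⟨hC', hY', hout'⟩ hs'
    have h' := h₁.frame hs' (by decide)
    have h1 := I.read_le (2 + j) (q / I.n ^ j % I.n)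
    have h2 := Nat.mod_lt (q / I.n ^ j) hn
    have h3 : q / I.n ^ j / I.n ≤ q := (Nat.div_le_self _ _).trans (Nat.div_le_self _ _)
    refine Exec.ops ?_
    simp only [opsWp, Input.eval, Instr.outReg, hC', hY', hout', h'.hN, h'.hOne,
      Function.update_self, ne_eq, Fin.reduceEq, not_false_eq_true, Function.update_of_ne]
    refine ⟨by omega, by omega, by omega, by omega, by omega, ?_, ?_⟩
    · rw [pow_succ, Nat.div_div_eq_div_mul]
    · rw [List.range_succ, List.map_append, List.append_assoc]; rfl
  · rintro s' ⟨⟨-, -, h'⟩, -⟩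
    exact h'

/-- The outcome of a trial. -/
def _root_.KSum.Outcome (I : Input) (success : Prop) (c Q : ℕ) (s : St 41) : Prop :=
  (s.regs rCnt = Q ∧ I.Good s.out) ∨ (s.regs rCnt = c + 1 ∧ s.out = [] ∧ ¬success)

/-- After a success the counter is set to the number of all trials, which ends the main loop; so
only one solution is ever output. -/
theorem finish (hset : Setting I p L ℓ) (h : Env I p L ℓ s) {rest c Q : ℕ} {success : Prop}
    (hIdx : s.regs rIdx = q) (hq : q ≤ I.cap) (hrest : rest = I.rest q) (hQ : s.regs rQ = Q)
    (hQc : Q ≤ I.cap) (hCnt : s.regs rCnt = c) (hc : c < Q) (hout : s.out = [])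
    (hfound : Found I rest s ∨ (s.regs rF = 0 ∧ ¬success)) :
    Exec I I.cap Prog.finish s (7 * I.k + 10) fun s' => Outcome I success c Q s' := by
  refine Exec.mono (D := 1 + (7 * I.k + 6 + 1 + 2)) (Exec.seq (Exec.mono (Exec.frame
    (Exec.silent (Exec.ops (Q := fun s' => s'.regs rCnt = c + 1) ?_) (by decide))) le_rfl ?_))
    (by omega) fun _ h => h
  · simp only [opsWp, Input.eval, hCnt, h.hOne, Function.update_self]
    exact ⟨by omega, trivial⟩
  rintro s₁ ⟨⟨hCnt₁, hout₁⟩, hs₁⟩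
  have h₁ := h.frame hs₁ (by decide)
  have hF₁ : s₁.regs rF = s.regs rF := hs₁ _ (by decide)
  have hSa₁ : s₁.regs rSa = s.regs rSa := hs₁ _ (by decide)
  have hSb₁ : s₁.regs rSb = s.regs rSb := hs₁ _ (by decide)
  have hIdx₁ : s₁.regs rIdx = q := by rw [hs₁ _ (by decide), hIdx]
  have hQ₁ : s₁.regs rQ = Q := by rw [hs₁ _ (by decide), hQ]
  rw [hout] at hout₁
  refine Exec.ite (D := 7 * I.k + 6 + 1) (fun hlt => ?_) (fun hlt => ?_) <;> rw [h₁.hZ, hF₁] at hlt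
  · rcases hfound with ⟨-, i, hi, j, hj, hSa, hSb, hsum⟩ | ⟨hF, -⟩
    · rw [← hSa₁] at hSa
      rw [← hSb₁] at hSb
      refine Exec.seq (D' := 1) (Exec.mono (Exec.frame (Exec.report hset h₁ hIdx₁ hq hSa hSb hout₁)) le_rfl ?_)
      rintro s₂ ⟨hout₂, hs₂⟩
      refine Exec.ops ?_
      have hQ₂ : s₂.regs rQ = Q := by rw [hs₂ _ (by decide), hQ₁]
      simp only [opsWp, Input.eval, hQ₂]
      refine ⟨hQc, Or.inl ⟨by simp, ?_⟩⟩
      rw [hout₂]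
      exact Input.good_solution hset.toValid hi hj (hrest ▸ hsum)
    · omega
  · rcases hfound with ⟨hF, -⟩ | ⟨-, hsucc⟩
    · omega
    · refine Exec.mono (Exec.ops (l := []) ?_) (Nat.zero_le _) fun _ h => h
      exact Or.inr ⟨hCnt₁, hout₁, hsucc⟩

theorem search (hset : Setting I p L ℓ) (h : Chosen I p L ℓ q B s) (hB : B ≤ 2 * (I.k * I.m))
    {x c Q : ℕ} (hA : s.regs rA = x) (hx : x < 2 ^ (4 * L)) (hq : q ≤ I.cap)
    (hQ : s.regs rQ = Q) (hQc : Q ≤ I.cap) (hCnt : s.regs rCnt = c) (hc : c < Q)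
    (hout : s.out = []) :
    Exec I I.cap Prog.search s (105 * ℓ + 7 * I.k + 37) fun s' =>
      Outcome I (I.Success p ℓ (coefficient L x) B (I.rest q)) c Q s' := by
  have hpw : 2 ^ L ≤ 8 * I.n := by have := hset.pow_lt; have := hset.p_le; omega
  have ha : ∀ i, coefficient L x i ≤ 8 * I.n := fun i =>
    (Nat.mod_lt _ (by positivity)).le.trans hpw
  refine Exec.mono (D := 7 + (14 + ((54 * ℓ + 2) + ((51 * ℓ + 4) + (7 * I.k + 10)))))
    (Exec.seq (Exec.mono (Exec.frame (Exec.silent (Exec.coefficients hset h hA hx) (by decide)))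
    le_rfl ?_)) (by omega) fun _ h => h
  rintro s₁ ⟨⟨h₁, hout₁⟩, hs₁⟩
  refine Exec.seq (Exec.mono (Exec.frame (Exec.silent (Exec.start hset h₁ ha) (by decide)))
    le_rfl ?_)
  rintro s₂ ⟨⟨⟨hXs₂, hTo₂, hHa₂, hMe₂, hC₂⟩, hout₂⟩, hs₂⟩
  have h₂ := h₁.frame hs₂ (by decide)
  refine Exec.seq (Exec.mono (Exec.frame (Exec.silent
    (Exec.meet hset h₂ ha hB hTo₂ hHa₂ hMe₂ hC₂) (by decide))) le_rfl ?_)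
  rintro s₃ ⟨⟨hMe₃, hout₃⟩, hs₃⟩
  have h₃ := h₂.frame hs₃ (by decide)
  have hXs₃ : s₃.regs rXs = _ := (hs₃ _ (by decide)).trans hXs₂
  have hF₃ : s₃.regs rF = 0 := by
    rw [hs₃ _ (by decide), hs₂ _ (by decide), hs₁ _ (by decide), h.hF]
  refine Exec.seq (Exec.mono (Exec.frame (Exec.silent
    (Exec.compare hset h₃ ha hB hXs₃ hMe₃ hF₃) (by decide))) le_rfl ?_)
  rintro s₄ ⟨⟨hfound, hout₄⟩, hs₄⟩
  have h₄ := h₃.frame hs₄ (by decide)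
  refine Exec.finish hset h₄.toEnv h₄.hIdx hq rfl ?_ hQc ?_ hc ?_ hfound
  · rw [hs₄ _ (by decide), hs₃ _ (by decide), hs₂ _ (by decide), hs₁ _ (by decide), hQ]
  · rw [hs₄ _ (by decide), hs₃ _ (by decide), hs₂ _ (by decide), hs₁ _ (by decide), hCnt]
  · rw [hout₄, hout₃, hout₂, hout₁, hout]

/-- The summand `k * m` keeps the truncated subtraction exact. It is also a multiple of `n` whenever
`m` is, so it does not disturb residues in that case. -/
theorem choosePositions (hset : Setting I p L ℓ) (h : Env I p L ℓ s) {c : ℕ}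
    (hCnt : s.regs rCnt = c) (hc : c ≤ I.cap) :
    Exec I I.cap Prog.choosePositions s (7 * I.k + 12) fun s' =>
      Chosen I p L ℓ (c / (I.n ^ 2 / ℓ ^ 2 + 1))
        (I.k * I.m + I.target - I.rest (c / (I.n ^ 2 / ℓ ^ 2 + 1))) s' ∧
      s'.regs rA = 0 ∧ s'.regs rC = 0 := by
  have hn := hset.n_pos
  have hkm := hset.toValid.le_km
  have h2k := hset.two_le_k
  have ht := hset.target_le
  have h2n : 2 * I.n ≤ I.cap := Input.le_cap_of_n hset.toValid (by omega)
  have hcap : 4 * (I.k * I.m) ≤ I.cap := Input.le_cap_of_km le_rfl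
  have hqc : c / (I.n ^ 2 / ℓ ^ 2 + 1) ≤ c := Nat.div_le_self _ _
  have hRr := h.hR
  set q := c / (I.n ^ 2 / ℓ ^ 2 + 1) with hqdef
  have hrest : ∀ j ≤ I.k - 2, ∑ i ∈ range j, I.read (2 + i) (q / I.n ^ i % I.n) ≤ I.k * I.m := by
    intro j hj
    refine (Finset.sum_le_card_nsmul _ _ I.m fun i _ => I.read_le _ _).trans ?_
    rw [card_range, smul_eq_mul]
    exact Nat.mul_le_mul_right _ (by omega)
  refine Exec.mono (D := 4 + (((I.k - 2) * 7 + 2) + 6)) (Exec.seq (Exec.mono (Exec.frame (Exec.ops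
    (Q := fun s' => s'.regs rIdx = q ∧ s'.regs rY = q ∧ s'.regs rRest = 0 ∧ s'.regs rC = 2) ?_))
    le_rfl ?_)) (by omega) fun _ h => h
  · simp only [opsWp, Input.eval, hCnt, hRr, h.hTwo, Function.update_self, ne_eq, Fin.reduceEq,
      not_false_eq_true, Function.update_of_ne, ← hqdef]
    exact ⟨by omega, by omega, by omega, by omega, trivial, trivial, trivial, trivial⟩
  rintro s₁ ⟨⟨hIdx₁, hY₁, hRest₁, hC₁⟩, hs₁⟩
  have h₁ := h.frame hs₁ (by decide)
  refine Exec.seq (Exec.mono (Exec.loop (D := 5) (I.k - 2) (fun j s' => s'.regs rC = 2 + j ∧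
    s'.regs rY = q / I.n ^ j ∧ s'.regs rRest = ∑ i ∈ range j, I.read (2 + i) (q / I.n ^ i % I.n))
    ⟨hC₁, by simpa using hY₁, by simpa using hRest₁⟩ ?_ ?_) le_rfl ?_)
  · rintro j s' hj ⟨h', -, -⟩ hs'
    rw [h', hs' _ (by decide), h₁.hK]
    omega
  · rintro j s' hj ⟨hC', hY', hRest'⟩ hs'
    have h' := h₁.frame hs' (by decide)
    have h1 := I.read_le (2 + j) (q / I.n ^ j % I.n)
    have h2 := Nat.mod_lt (q / I.n ^ j) hn
    have h3 : q / I.n ^ j / I.n ≤ q := (Nat.div_le_self _ _).trans (Nat.div_le_self _ _)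
    have h4 := hrest (j + 1) hj
    rw [sum_range_succ] at h4
    refine Exec.ops ?_
    simp only [opsWp, Input.eval, hC', hY', hRest', h'.hN, h'.hOne,
      Function.update_self, ne_eq, Fin.reduceEq, not_false_eq_true, Function.update_of_ne]
    refine ⟨by omega, by omega, by omega, by omega, by omega, by omega, ?_, ?_⟩
    · rw [pow_succ, Nat.div_div_eq_div_mul]
    · rw [sum_range_succ]
  rintro s₂ ⟨⟨-, -, hRest₂⟩, hs₂⟩
  have h₂ := h₁.frame hs₂ (by decide)
  have hIdx₂ : s₂.regs rIdx = q := by rw [hs₂ _ (by decide), hIdx₁]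
  refine Exec.mono (Exec.frame (Exec.ops (Q := fun s' => s'.regs rB =
    I.k * I.m + I.target - I.rest q ∧ s'.regs rA = 0 ∧ s'.regs rC = 0 ∧ s'.regs rF = 0) ?_))
    le_rfl ?_
  · simp only [opsWp, Input.eval, h₂.hK, h₂.hM, h₂.hT, hRest₂,
      Function.update_self, ne_eq, Fin.reduceEq, not_false_eq_true, Function.update_of_ne]
    exact ⟨by omega, by omega, by omega, by omega, by omega, by omega, rfl, trivial, trivial,
      trivial⟩
  · rintro s₃ ⟨⟨hB₃, hA₃, hC₃, hF₃⟩, hs₃⟩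
    refine ⟨⟨h₂.frame hs₃ (by decide), ?_, ?_, hB₃, hF₃⟩, hA₃, hC₃⟩
    · rw [hs₃ _ (by decide), hIdx₂]
    · rw [hs₃ _ (by decide), hRest₂]; rfl

end Exec

end KSum

/-! ### Coin tosses and the loop over all trials -/

namespace KSum

namespace Prog

/-- One trial. -/
def trial : Prog 41 := seq choosePositions (seq toss search)

/-- The trials. -/
def trials : Prog 41 := loop rCnt rQ trial

end Prog

/-- The machine. -/
def machine : Machine := ⟨41, (Prog.seq Prog.prepare Prog.trials).compile 0⟩

theorem CodeAt.seq_right {R : ℕ} {code : List (Instr R)} {P Q : Prog R} {o : ℕ}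
    (h : CodeAt code o ((Prog.seq P Q).compile o)) :
    CodeAt code (o + P.size) (Q.compile (o + P.size)) := by
  have := h.right
  rwa [Prog.length_compile] at this

theorem Exec.guarantee {M : Machine} {I : Input} {B : ℕ} {Good : List ℕ → Prop} {T D o : ℕ} {x : ℝ}
    {P : Prog M.numRegs} {s : St M.numRegs} {Q : St M.numRegs → Prop} (h : Exec I B P s D Q)
    (hs : s.Bdd B) (hl : CodeAt M.code o (P.compile o))
    (hQ : ∀ s', s'.Bdd B → Q s' →
      Guarantee M I (M.numRegs * Nat.size B) Good (s'.at (o + P.size)) T x) :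
    Guarantee M I (M.numRegs * Nat.size B) Good (s.at o) (T + D) x := by
  obtain ⟨s', d, hd, hr, hq⟩ := h
  obtain ⟨h1, h2⟩ := hr.guarantee (M := M) (Good := Good) (T := T) (x := x) hs hl
  exact (h2 (hQ s' h1 hq)).mono (by omega) le_rfl

/-- The coin tosses produce a uniformly random number below `2 ^ K`. -/
theorem Guarantee.toss {code : List (Instr 41)} {I : Input} {B : ℕ} {Good : List ℕ → Prop}
    {T o K : ℕ} {s : St 41} (f : ℕ → ℝ) (hl : CodeAt code o (Prog.toss.compile o))
    (hs : s.Bdd B) (hA : s.regs rA = 0) (hC : s.regs rC = 0) (hOne : s.regs rOne = 1)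
    (hKK : s.regs rKK = K) (hK : K ≤ B) (hpow : 2 ^ K ≤ B)
    (h : ∀ x < 2 ^ K, ∀ s' : St 41, s'.Bdd B → SameOff Prog.toss s s' → s'.out = s.out →
      s'.regs rA = x →
      Guarantee ⟨41, code⟩ I (41 * Nat.size B) Good (s'.at (o + Prog.toss.size)) T (f x)) :
    Guarantee ⟨41, code⟩ I (41 * Nat.size B) Good (s.at o) (T + (K * 6 + 2))
      ((∑ x ∈ range (2 ^ K), f x) / 2 ^ K) := by
  -- After `c` tosses the number `a` consists of the bits so far; with `r` tosses to come, the final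
  -- numbers are those from `a * 2 ^ r` up to `a * 2 ^ r + 2 ^ r - 1`, and `f` is averaged over
  -- them.
  suffices ∀ r c a (s' : St 41), c + r = K → a < 2 ^ c → s'.Bdd B → SameOff Prog.toss s s' →
      s'.out = s.out → s'.regs rA = a → s'.regs rC = c →
      Guarantee ⟨41, code⟩ I (41 * Nat.size B) Good (s'.at o) (T + (r * 6 + 2))
        ((∑ x ∈ range (2 ^ r), f (a * 2 ^ r + x)) / 2 ^ r) by
    simpa using this K 0 0 s (by omega) (by norm_num) hs (fun _ _ => rfl) rfl hA hC
  intro r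
  induction r with
  | zero =>
    intro c a s' hc ha hs' hoff hout hA' hC'
    have hc' : c = K := by omega
    have hKK' : s'.regs rKK = K := by rw [hoff _ (by decide), hKK]
    refine (Guarantee.loop_exit (M := ⟨41, code⟩) (P := _) hs' hl ?_ (h a (hc' ▸ ha) s' hs' hoff hout hA')).mono
      (by omega) ?_
    · rw [hC', hKK']; omega
    · simp
  | succ r ih =>
    intro c a s' hc ha hs' hoff hout hA' hC'
    have hKK' : s'.regs rKK = K := by rw [hoff _ (by decide), hKK]
    have hOne' : s'.regs rOne = 1 := by rw [hoff _ (by decide), hOne]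
    have hpc : 2 ^ (c + 1) ≤ 2 ^ K := Nat.pow_le_pow_right (by norm_num) (by omega)
    have hpc' : 2 ^ (c + 1) = 2 * 2 ^ c := by ring
    have e : T + ((r + 1) * 6 + 2) = (T + (r * 6 + 2) + 1 + 3 + 1) + 1 := by ring
    rw [e]
    refine Guarantee.loop_enter (M := ⟨41, code⟩) hs' hl (by rw [hC', hKK']; omega) ?_
    have hbody := CodeAt.loop_body (M := ⟨41, code⟩) hl
    refine Guarantee.step _ _ _ (fun b => (∑ x ∈ range (2 ^ r),
      f ((2 * a + b.toNat) * 2 ^ r + x)) / 2 ^ r) (hs'.bits_le _) (fun b => ?_) ?_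
    · have hstep : KSum.step ⟨41, code⟩ I b (s'.at (o + 2)) =
          St.at ⟨Function.update s'.regs rU b.toNat, s'.out⟩ (o + 2 + 1) := by
        unfold KSum.step
        simp only [St.at]
        rw [hbody.fetch]
        rfl
      rw [hstep]
      have hb : b.toNat ≤ 1 := Bool.toNat_le b
      have hbd : (⟨Function.update s'.regs rU b.toNat, s'.out⟩ : St 41).Bdd B :=
        hs'.update _ (by omega) _
      have hexec : Exec I B (Prog.ops [Instr.add rA rA rA, Instr.add rA rA rU,
          Instr.add rC rC rOne]) ⟨Function.update s'.regs rU b.toNat, s'.out⟩ 3 fun s₂ =>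
          (s₂.regs rA = 2 * a + b.toNat ∧ s₂.regs rC = c + 1) ∧ SameOff Prog.toss s s₂ ∧
            s₂.out = s.out := by
        refine Exec.mono (Exec.frame (Exec.silent (Exec.ops (Q := fun s₂ =>
          s₂.regs rA = 2 * a + b.toNat ∧ s₂.regs rC = c + 1) ?_) (by decide))) le_rfl ?_
        · simp only [opsWp, Input.eval, hA', hC', hOne', Function.update_self, ne_eq, Fin.reduceEq,
            not_false_eq_true, Function.update_of_ne]
          exact ⟨by omega, by omega, by omega, by omega, trivial⟩
        · rintro s₂ ⟨⟨h1, hout₂⟩, h2⟩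
          refine ⟨h1, fun r hr => ?_, hout₂.trans hout⟩
          have e1 : ∀ r ∈ (Prog.ops [Instr.add rA rA rA, Instr.add rA rA rU,
              Instr.add rC rC rOne] : Prog 41).writes, r ∈ Prog.toss.writes := by decide
          rw [h2 r fun hr' => hr (e1 r hr')]
          refine (Function.update_of_ne ?_ _ _).trans (hoff r hr)
          rintro rfl
          exact hr (by decide)
      refine Exec.guarantee (M := ⟨41, code⟩) (T := T + (r * 6 + 2) + 1) (D := 3) (P := Prog.ops
        [Instr.add rA rA rA, Instr.add rA rA rU, Instr.add rC rC rOne]) hexec hbd hbody.tail ?_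
      rintro s₂ hs₂ ⟨⟨hA₂, hC₂⟩, hoff₂, hout₂⟩
      exact Guarantee.loop_back (M := ⟨41, code⟩) (o := o) hs₂ hl
        (ih (c + 1) _ s₂ (by omega) (by omega) hs₂ hoff₂ hout₂ hA₂ hC₂)
    · have e2 : ∑ x ∈ range (2 ^ (r + 1)), f (a * 2 ^ (r + 1) + x) =
          ∑ x ∈ range (2 ^ r), f ((2 * a + 0) * 2 ^ r + x) +
            ∑ x ∈ range (2 ^ r), f ((2 * a + 1) * 2 ^ r + x) := by
        rw [pow_succ, mul_two, sum_range_add]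
        congr 1
        · refine sum_congr rfl fun x _ => congr_arg f ?_
          ring
        · refine sum_congr rfl fun x _ => congr_arg f ?_
          ring
      rw [e2]
      simp only [Bool.toNat_false, Bool.toNat_true]
      rw [pow_succ, ← add_div, div_div]

/-- The success probability of a trial with the `k - 2` positions coded by `q`. -/
noncomputable def Input.trialProb (I : Input) (p L ℓ q : ℕ) : ℝ :=
  (∑ x ∈ range (2 ^ (4 * L)), ind (I.Success p ℓ (coefficient L x)
    (I.k * I.m + I.target - I.rest q) (I.rest q))) / 2 ^ (4 * L)

/-- The trials. If the `c`-th trial is successful with probability `σ`, then the trials from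
number `c` on are successful with probability `V c ≤ σ + (1 - σ) * V (c + 1)`. -/
theorem Guarantee.trials {code : List (Instr 41)} {I : Input} {p L ℓ R Q o : ℕ}
    (hset : Setting I p L ℓ) (hR : R = I.n ^ 2 / ℓ ^ 2 + 1) (hQ : Q = R * I.n ^ (I.k - 2))
    (hl : CodeAt code o (Prog.trials.compile o)) (hend : code.length ≤ o + Prog.trials.size)
    (V : ℕ → ℝ) (hV1 : ∀ c, V c ≤ 1) (hVQ : V Q ≤ 0)
    (hV : ∀ c < Q, V c ≤ I.trialProb p L ℓ (c / R) +
      (1 - I.trialProb p L ℓ (c / R)) * V (c + 1))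
    {s : St 41} (hs : s.Bdd I.cap) (henv : Env I p L ℓ s) (hCnt : s.regs rCnt = 0)
    (hout : s.out = []) :
    Guarantee ⟨41, code⟩ I (41 * Nat.size I.cap) I.Good (s.at o)
      (Q * (105 * ℓ + 24 * L + 14 * I.k + 53) + 2) (V 0) := by
  have hn := hset.n_pos
  have hk := hset.two_le_k
  have hkm := hset.toValid.le_km
  have hQcap : Q ≤ I.cap := by
    refine Input.le_cap_of_trials ?_
    have h1 : I.n ^ 2 / ℓ ^ 2 ≤ I.n ^ 2 := Nat.div_le_self _ _
    have h2 : 0 < I.n ^ 2 := by positivity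
    calc Q ≤ (2 * I.n ^ 2) * I.n ^ (I.k - 2) := by
          rw [hQ]; exact Nat.mul_le_mul_right _ (by omega)
      _ = 2 * I.n ^ (2 + (I.k - 2)) := by ring
      _ ≤ _ := by rw [Nat.add_sub_cancel' hk]; omega
  have hpw : 2 ^ L ≤ 8 * I.n := by have := hset.pow_lt; have := hset.p_le; omega
  have hpcap : 2 ^ (4 * L) ≤ I.cap := by
    refine Input.le_cap_of_pow (i := 4) hset.toValid le_rfl ?_
    calc 2 ^ (4 * L) = (2 ^ L) ^ 4 := by rw [mul_comm, pow_mul]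
      _ ≤ (8 * I.n) ^ 4 := Nat.pow_le_pow_left hpw 4
      _ = 4096 * I.n ^ 4 := by ring
      _ ≤ _ := Nat.mul_le_mul_right _ (by norm_num)
  have hLcap : 4 * L ≤ I.cap := (Nat.lt_two_pow_self).le.trans hpcap
  have hdone : ∀ (s' : St 41) (T : ℕ) (x : ℝ), s'.Bdd I.cap → s'.regs rCnt = Q → s'.regs rQ = Q →
      (x ≤ 0 ∨ x ≤ 1 ∧ I.Good s'.out) →
      Guarantee ⟨41, code⟩ I (41 * Nat.size I.cap) I.Good (s'.at o) (T + 2) x := by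
    intro s' T x hs' hCnt' hQ' hx
    refine Guarantee.loop_exit (M := ⟨41, code⟩) (P := Prog.trial) hs' hl (by rw [hCnt', hQ']; omega)
      (Guarantee.halted _ _ _ ?_ (hs'.bits_le _) hx)
    unfold Halted Machine.fetch
    rw [List.getD_eq_default]
    exact hend
  suffices ∀ r c (s' : St 41), c + r = Q → s'.Bdd I.cap → Env I p L ℓ s' → s'.regs rCnt = c →
      s'.out = [] → Guarantee ⟨41, code⟩ I (41 * Nat.size I.cap) I.Good (s'.at o)
        (r * (105 * ℓ + 24 * L + 14 * I.k + 53) + 2) (V c) from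
    this Q 0 s (by omega) hs henv hCnt hout
  intro r
  induction r with
  | zero =>
    intro c s' hc hs' h' hCnt' hout'
    obtain rfl : c = Q := by omega
    exact hdone s' _ _ hs' hCnt' (by rw [h'.hQ, ← hR, hQ]) (Or.inl hVQ)
  | succ r ih =>
    intro c s' hc hs' h' hCnt' hout'
    have hQ' : s'.regs rQ = Q := by rw [h'.hQ, ← hR, hQ]
    set T := r * (105 * ℓ + 24 * L + 14 * I.k + 53) + 2 with hT
    have hT' : T = (T - 2) + 2 := by omega
    have hbody := CodeAt.loop_body (M := ⟨41, code⟩) (P := Prog.trial) hl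
    have hb1 := hbody.left
    have hb2 := (CodeAt.seq_right hbody).left
    have hb3 := CodeAt.seq_right (CodeAt.seq_right hbody)
    have hchoose := Exec.frame (Exec.silent (Exec.choosePositions hset h' hCnt' (by omega))
      (by decide))
    refine Guarantee.mono (T := T + 1 + (105 * ℓ + 7 * I.k + 37) + (4 * L * 6 + 2) +
      (7 * I.k + 12) + 1) (Guarantee.loop_enter (M := ⟨41, code⟩) (P := Prog.trial) hs' hl
        (by rw [hCnt', hQ']; omega) ?_) (by rw [add_mul r 1]; omega) (hV c (by omega))
    refine Exec.guarantee (M := ⟨41, code⟩) hchoose hs' hb1 ?_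
    rintro s₁ hs₁ ⟨⟨⟨h₁, hA₁, hC₁⟩, hout₁⟩, hoff₁⟩
    have hCnt₁ : s₁.regs rCnt = c := (hoff₁ rCnt (by clear * -; decide)).trans hCnt'
    rw [← hR] at h₁
    set q := c / R with hq
    have hqcap : q ≤ I.cap := (Nat.div_le_self _ _).trans (by omega)
    have hrest : I.k * I.m + I.target - I.rest q ≤ 2 * (I.k * I.m) := by
      have := hset.target_le; omega
    -- For a random number `x` with a successful trial the value is `1`, otherwise it is `V (c +
    -- 1)`. The average over `x` is the right-hand side of the recursion for `V c`.
    have key := Guarantee.toss (code := code) (I := I) (B := I.cap) (Good := I.Good)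
      (T := T + 1 + (105 * ℓ + 7 * I.k + 37)) (K := 4 * L) (o := o + 2 + Prog.choosePositions.size)
      (s := s₁) (fun x => ind (I.Success p ℓ (coefficient L x)
        (I.k * I.m + I.target - I.rest q) (I.rest q)) + (1 - ind (I.Success p ℓ (coefficient L x)
        (I.k * I.m + I.target - I.rest q) (I.rest q))) * V (c + 1)) hb2 hs₁ hA₁ hC₁ h₁.hOne h₁.hKK
      hLcap hpcap ?_
    · refine key.mono le_rfl (le_of_eq ?_)
      rw [sum_add_distrib, ← sum_mul, sum_sub_distrib, sum_const, card_range, Input.trialProb]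
      have : (2 : ℝ) ^ (4 * L) ≠ 0 := by positivity
      field_simp
      ring
    · intro x hx s₂ hs₂ hoff₂ hout₂ hA₂
      have h₂ := h₁.frame hoff₂ (by decide)
      have hCnt₂ : s₂.regs rCnt = c := by rw [hoff₂ _ (by decide), hCnt₁]
      have hQ₂ : s₂.regs rQ = Q := by rw [h₂.hQ, ← hR, hQ]
      refine Exec.guarantee (M := ⟨41, code⟩) (Exec.frame (Exec.search hset h₂ hrest hA₂ hx hqcap hQ₂
        hQcap hCnt₂ (by omega) (by rw [hout₂, hout₁, hout']))) hs₂ hb3 ?_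
      rintro s₃ hs₃ ⟨hoc, hoff₃⟩
      have h₃ := h₂.toEnv.frame hoff₃ (by decide)
      have e : o + 2 + Prog.choosePositions.size + Prog.toss.size + Prog.search.size =
          o + 2 + Prog.trial.size := by
        simp only [Prog.trial, Prog.size]; omega
      rw [e]
      refine Guarantee.loop_back (M := ⟨41, code⟩) (P := Prog.trial) hs₃ hl ?_
      have hind := ind_le_one (I.Success p ℓ (coefficient L x)
        (I.k * I.m + I.target - I.rest q) (I.rest q))
      -- If a correct solution was output, any value up to `1` may be claimed; otherwise the trial
      -- was not successful and the next one takes over.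
      rcases hoc with ⟨hCnt₃, hgood⟩ | ⟨hCnt₃, hout₃, hsucc⟩
      · rw [hT']
        refine hdone s₃ _ _ hs₃ hCnt₃ (by rw [h₃.hQ, ← hR, hQ]) (Or.inr ⟨?_, hgood⟩)
        have hmul := mul_nonneg (sub_nonneg.2 hind) (sub_nonneg.2 (hV1 (c + 1)))
        generalize ind _ = i at hind hmul ⊢
        generalize V (c + 1) = v at hmul ⊢
        linear_combination hmul
      · rw [ind_false hsucc]
        exact (ih (c + 1) s₃ (by omega) hs₃ h₃ hCnt₃ hout₃).mono le_rfl (by simp)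

/-- The running time. -/
def runningTime (k n L ℓ : ℕ) : ℕ :=
  2 * n * (Nat.sqrt (4 * n) * 8 + 11) + 4 * Nat.clog 2 (4 * n) + 6 * n + 4 * k + 32 +
    ((n ^ 2 / ℓ ^ 2 + 1) * n ^ (k - 2) * (105 * ℓ + 24 * L + 14 * k + 53) + 2)

theorem machine_guarantee {I : Input} {p L ℓ : ℕ} (hset : Setting I p L ℓ) (V : ℕ → ℝ)
    (hV1 : ∀ c, V c ≤ 1) (hVQ : V ((I.n ^ 2 / ℓ ^ 2 + 1) * I.n ^ (I.k - 2)) ≤ 0)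
    (hV : ∀ c < (I.n ^ 2 / ℓ ^ 2 + 1) * I.n ^ (I.k - 2),
      V c ≤ I.trialProb p L ℓ (c / (I.n ^ 2 / ℓ ^ 2 + 1)) +
        (1 - I.trialProb p L ℓ (c / (I.n ^ 2 / ℓ ^ 2 + 1))) * V (c + 1)) :
    Guarantee machine I (41 * Nat.size I.cap) I.Good (initial machine)
      (runningTime I.k I.n L ℓ) (V 0) := by
  have hl : CodeAt machine.code 0 ((Prog.seq Prog.prepare Prog.trials).compile 0) := by
    intro j i hj
    rw [zero_add]
    exact hj
  have hl2 := CodeAt.seq_right hl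
  have e : initial machine = St.at ⟨fun _ => 0, []⟩ 0 := rfl
  rw [e, runningTime, add_comm]
  refine Exec.guarantee (M := machine) (P := Prog.prepare) (Exec.silent (Exec.prepare hset.toValid
    fun _ => rfl) (by decide)) (fun _ => Nat.zero_le _) hl.left ?_
  rintro s hs ⟨⟨p', L', ℓ', hset', henv, hCnt⟩, hout⟩
  obtain ⟨rfl, rfl, rfl⟩ := hset.unique hset' rfl
  refine Guarantee.trials hset rfl rfl hl2 ?_ V hV1 hVQ hV hs henv hCnt hout
  refine le_of_eq ((Prog.length_compile _ _).trans ?_)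
  rw [Prog.size, zero_add]
  rfl

end KSum

/-! ### From hits of the walk to successful trials -/

namespace KSum

section Link

variable {k n m : ℕ} (hk : 2 ≤ k) (hn : 0 < n) (w : Lists k n m) (t : ℕ)

theorem hashNat_eq (p : ℕ) [NeZero n] (a : Fin 4 → ℕ) (z : Option (Fin n)) :
    hashNat n p a (z.elim n fun v => (v : ℕ)) = polyHash n p (fun i => (a i : ZMod p)) z := by
  have e : cubic (fun i => (a i : ZMod p)) (hashPoint n p z) =
      ((((a 3 * (z.elim n fun v => (v : ℕ)) + a 2) * (z.elim n fun v => (v : ℕ)) + a 1) *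
        (z.elim n fun v => (v : ℕ)) + a 0 : ℕ) : ZMod p) := by
    rw [hashPoint, cubic]
    push_cast
    rfl
  simp only [polyHash]
  rw [e, hashNat, ZMod.val_natCast]

theorem cell_eq (B : ℕ) (x : Fin (2 * n)) :
    (⟨k, n, m, w, t⟩ : Input).cell B x = cellVal hk hn w B x := by
  have h0 : 0 < k := by omega
  have h1 : 1 < k := by omega
  have hx := x.2
  by_cases h : (x : ℕ) < n
  · simp [Input.cell, cellVal, Input.read, h, h0]
  · have h2 : (x : ℕ) - n < n := by omega
    simp [Input.cell, cellVal, Input.read, h, h1, h2]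

theorem orbit_eq_walk (p : ℕ) [NeZero n] (a : Fin 4 → ℕ) (B c : ℕ) :
    (⟨k, n, m, w, t⟩ : Input).orbit p a B c =
      walk (polyHash n p fun i => (a i : ZMod p)) (cellVal hk hn w B) c := by
  induction c with
  | zero => exact hashNat_eq p a none
  | succ c ih =>
    rw [Input.orbit, ih, cell_eq hk hn, walk]
    exact hashNat_eq p a (some _)

/-- For a solution, `B` minus the integer at `j` equals the integer at `i` plus `k * m`, and `n ∣
m`; so the two cells have equal values and the same successor. Hence the walk has period `v - u`
from time `u + 1` on, and `lastMeet_add` shows that the pair is compared at time `u`. -/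
theorem success_of_hits (hnm : n ∣ m) {p ℓ B rest : ℕ} [NeZero n] (a : Fin 4 → ℕ) (i j : Fin n)
    (hB : B + rest = k * m + t)
    (hij : value w ⟨0, by omega⟩ i + value w ⟨1, by omega⟩ j + rest = t)
    (h : Hits (polyHash n p fun i => (a i : ZMod p)) (cellVal hk hn w B) ℓ ⟨i, by omega⟩
      ⟨j + n, by omega⟩) :
    (⟨k, n, m, w, t⟩ : Input).Success p ℓ a B rest := by
  obtain ⟨u, v, hv, huv, hu, hv', hinj⟩ := h
  set I : Input := ⟨k, n, m, w, t⟩ with hI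
  have horb := orbit_eq_walk hk hn w t p a B
  rw [← hI] at horb
  have hxu : I.orbit p a B u = i := by rw [horb, hu]
  have hxv : I.orbit p a B v = j + n := by rw [horb, hv']
  have hread0 : I.read 0 i = value w ⟨0, by omega⟩ i := by
    simp [I, Input.read, show 0 < k by omega]
  have hread1 : I.read 1 j = value w ⟨1, by omega⟩ j := by
    simp [I, Input.read, show 1 < k by omega]
  have hcell : I.cell B (I.orbit p a B u) = I.cell B (I.orbit p a B v) := by
    have e1 : I.cell B i = I.read 0 i % n := if_pos i.2
    have e2 : I.cell B (j + n) = (B - I.read 1 j) % n := by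
      have : ¬(j : ℕ) + n < I.n := by simp [I]
      rw [Input.cell, if_neg this]
      simp [I]
    rw [hxu, hxv, e1, e2]
    have e3 : B - I.read 1 j = I.read 0 i + k * m := by omega
    rw [e3]
    obtain ⟨r, rfl⟩ := hnm
    rw [← mul_assoc, mul_comm k n, mul_assoc, Nat.add_mul_mod_self_left]
  have hper : ∀ s, u + 1 ≤ s → I.orbit p a B (s + (v - u)) = I.orbit p a B s := by
    intro s hs
    induction s, hs using Nat.le_induction with
    | base =>
      have e : u + 1 + (v - u) = v + 1 := by omega
      rw [e, Input.orbit, Input.orbit, hcell]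
    | succ s hs ih =>
      have e : s + 1 + (v - u) = (s + (v - u)) + 1 := by omega
      rw [e, Input.orbit, Input.orbit, ih]
  refine ⟨u, huv.trans hv, ?_, ?_, ?_⟩
  · rw [hxu]; exact i.2
  all_goals rw [lastMeet_add huv hv (fun s t hs ht hst => hinj s t hs ht
    (Fin.ext (by rw [← horb, ← horb, hst]))) hper, hxv]
  · exact Nat.le_add_left _ _
  · rw [hxu]
    have e : (j : ℕ) + n - I.n = j := Nat.add_sub_cancel _ _
    rw [e, hread0, hread1, hij]

end Link

/-- The number with digits `b` in base `2 ^ L`. -/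
def combine (L : ℕ) (b : Fin 4 → ℕ) : ℕ :=
  b 0 + 2 ^ L * (b 1 + 2 ^ L * (b 2 + 2 ^ L * b 3))

theorem combine_lt {L : ℕ} {b : Fin 4 → ℕ} (hb : ∀ i, b i < 2 ^ L) : combine L b < 2 ^ (4 * L) := by
  have key : ∀ {x y K : ℕ}, x < 2 ^ L → y < K → x + 2 ^ L * y < 2 ^ L * K := by
    intro x y K hx hy
    calc x + 2 ^ L * y < 2 ^ L * (y + 1) := by rw [mul_add]; omega
      _ ≤ _ := Nat.mul_le_mul_left _ hy
  have e : 2 ^ (4 * L) = 2 ^ L * (2 ^ L * (2 ^ L * 2 ^ L)) := by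
    rw [mul_comm, pow_mul]; ring
  rw [e]
  exact key (hb 0) (key (hb 1) (key (hb 2) (hb 3)))

theorem coefficient_combine {L : ℕ} {b : Fin 4 → ℕ} (hb : ∀ i, b i < 2 ^ L) :
    coefficient L (combine L b) = b := by
  have hpos : 0 < 2 ^ L := by positivity
  have hdiv : ∀ {x y : ℕ}, x < 2 ^ L → (x + 2 ^ L * y) / 2 ^ L = y := by
    intro x y hx
    rw [Nat.add_mul_div_left _ _ hpos, Nat.div_eq_of_lt hx, zero_add]
  have hmod : ∀ {x y : ℕ}, x < 2 ^ L → (x + 2 ^ L * y) % 2 ^ L = x := by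
    intro x y hx
    rw [Nat.add_mul_mod_self_left, Nat.mod_eq_of_lt hx]
  have e0 : combine L b % 2 ^ L = b 0 := hmod (hb 0)
  have e1 : combine L b / 2 ^ L = b 1 + 2 ^ L * (b 2 + 2 ^ L * b 3) := hdiv (hb 0)
  funext i
  fin_cases i
  · simpa [coefficient] using e0
  · simp [coefficient, e1]
    exact Nat.mod_eq_of_lt (hb 1)
  · simp only [coefficient, sq, ← Nat.div_div_eq_div_mul, e1, hdiv (hb 1), hmod (hb 2)]
    rfl
  · simp only [coefficient, pow_succ, pow_zero, one_mul, ← Nat.div_div_eq_div_mul, e1,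
      hdiv (hb 1), hdiv (hb 2), Nat.mod_eq_of_lt (hb 3)]
    rfl

theorem trialProb_nonneg (I : Input) (p L ℓ q : ℕ) : 0 ≤ I.trialProb p L ℓ q :=
  div_nonneg (sum_nonneg fun _ _ => ind_nonneg _) (by positivity)

theorem trialProb_le_one (I : Input) (p L ℓ q : ℕ) : I.trialProb p L ℓ q ≤ 1 := by
  unfold Input.trialProb
  refine div_le_one_of_le₀ ?_ (by positivity)
  refine (sum_le_sum fun _ _ => ind_le_one _).trans ?_
  simp

/-- The coins produce coefficients that are uniform below `2 ^ L` and not below `p`. Among these,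
the residues below `p` represent each polynomial exactly once, and as `2 ^ L < 2 * p` the loss is at
most a factor `2` for each of the four coefficients. -/
theorem hitProb_le_trialProb {k n m : ℕ} (hk : 2 ≤ k) (hn : 0 < n) (w : Lists k n m) {t : ℕ}
    (hnm : n ∣ m) {p L ℓ q : ℕ} [Fact p.Prime] (hp1 : p ≤ 2 ^ L) (hp2 : 2 ^ L < 2 * p) (i j : Fin n)
    (hij : value w ⟨0, by omega⟩ i + value w ⟨1, by omega⟩ j +
      (⟨k, n, m, w, t⟩ : Input).rest q = t) :
    hitProb hk hn w p ℓ (k * m + t - (⟨k, n, m, w, t⟩ : Input).rest q) i j / 16 ≤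
      (⟨k, n, m, w, t⟩ : Input).trialProb p L ℓ q := by
  have : NeZero n := ⟨hn.ne'⟩
  set I : Input := ⟨k, n, m, w, t⟩
  set B := k * m + t - I.rest q with hB
  have hval : ∀ (b : Fin 4 → ZMod p) i, (b i).val < 2 ^ L := fun b i =>
    (ZMod.val_lt _).trans_le hp1
  have hinj : Function.Injective fun b : Fin 4 → ZMod p => combine L fun i => (b i).val := by
    intro b b' h
    have h1 := congr_arg (coefficient L) h
    simp only [coefficient_combine (hval b), coefficient_combine (hval b')] at h1
    funext i
    exact ZMod.val_injective p (congr_fun h1 i)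
  have hsum : ∑ b : Fin 4 → ZMod p, ind (Hits (polyHash n p b) (cellVal hk hn w B) ℓ
      ⟨i, by omega⟩ ⟨j + n, by omega⟩) ≤
      ∑ x ∈ range (2 ^ (4 * L)), ind (I.Success p ℓ (coefficient L x) B (I.rest q)) := by
    calc ∑ b : Fin 4 → ZMod p, ind (Hits (polyHash n p b) (cellVal hk hn w B) ℓ
          ⟨i, by omega⟩ ⟨j + n, by omega⟩)
        ≤ ∑ b : Fin 4 → ZMod p, ind (I.Success p ℓ (coefficient L
            (combine L fun i => (b i).val)) B (I.rest q)) := by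
          refine sum_le_sum fun b _ => ind_mono fun h => ?_
          rw [coefficient_combine (hval b)]
          refine success_of_hits hk hn w t hnm _ i j (by omega) hij ?_
          have e : (fun i => ((b i).val : ZMod p)) = b := funext fun i => ZMod.natCast_zmod_val _
          rwa [e]
      _ = ∑ x ∈ univ.image (fun b : Fin 4 → ZMod p => combine L fun i => (b i).val),
            ind (I.Success p ℓ (coefficient L x) B (I.rest q)) := by
          rw [sum_image fun b _ b' _ h => hinj h]
      _ ≤ _ := by
          refine sum_le_sum_of_subset_of_nonneg ?_ fun _ _ _ => ind_nonneg _
          intro x hx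
          obtain ⟨b, -, rfl⟩ := mem_image.1 hx
          exact mem_range.2 (combine_lt (hval b))
  have hp0 : (0 : ℝ) < p := by exact_mod_cast (Fact.out : p.Prime).pos
  have hpow : (2 : ℝ) ^ (4 * L) ≤ 16 * (p : ℝ) ^ 4 := by
    have h1 : (2 : ℝ) ^ L ≤ 2 * p := by exact_mod_cast hp2.le
    calc (2 : ℝ) ^ (4 * L) = ((2 : ℝ) ^ L) ^ 4 := by rw [mul_comm, pow_mul]
      _ ≤ (2 * p) ^ 4 := by gcongr
      _ = _ := by ring
  have hnonneg : 0 ≤ ∑ b : Fin 4 → ZMod p, ind (Hits (polyHash n p b) (cellVal hk hn w B) ℓ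
      ⟨i, by omega⟩ ⟨j + n, by omega⟩) := sum_nonneg fun _ _ => ind_nonneg _
  have e1 : hitProb hk hn w p ℓ B i j = (∑ b : Fin 4 → ZMod p, ind (Hits (polyHash n p b)
      (cellVal hk hn w B) ℓ ⟨i, by omega⟩ ⟨j + n, by omega⟩)) / (p : ℝ) ^ 4 := by
    rw [hitProb, Fintype.expect_eq_sum_div_card]
    congr 1
    simp [ZMod.card]
  rw [e1, div_div, Input.trialProb]
  refine div_le_div₀ (sum_nonneg fun _ _ => ind_nonneg _) hsum (by positivity) ?_
  linarith

end KSum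

/-! ### Repetition of trials and coding of positions -/

namespace KSum

theorem Setting.transfer {I I' : Input} {p L ℓ : ℕ} (h : Setting I p L ℓ) (hI' : I'.Valid)
    (hn : I'.n = I.n) : Setting I' p L ℓ where
  toValid := hI'
  prime := h.prime
  lt_p := hn ▸ h.lt_p
  p_min := hn ▸ h.p_min
  p_le := hn ▸ h.p_le
  p_le_pow := h.p_le_pow
  pow_lt := h.pow_lt
  two_le_len := h.two_le_len
  len_lt := hn ▸ h.len_lt
  le_len := hn ▸ h.le_len

/-- Existence of the parameters is read off from the execution of the program that computes them. -/
theorem Setting.exists_of_valid {I : Input} (hI : I.Valid) : ∃ p L ℓ, Setting I p L ℓ := by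
  obtain ⟨-, -, -, -, p, L, ℓ, h, -⟩ := Exec.prepare (s := ⟨fun _ => 0, []⟩) hI fun _ => rfl
  exact ⟨p, L, ℓ, h⟩

theorem Setting.one_le_L {I : Input} {p L ℓ : ℕ} (h : Setting I p L ℓ) : 1 ≤ L := by
  rcases Nat.eq_zero_or_pos L with h0 | h0
  · have h1 := h.p_le_pow
    have h2 := h.prime.two_le
    rw [h0] at h1
    omega
  · exact h0

/-- If some trials are successful with probability `σ`, then the machine succeeds with probability
`1 - (1 - σ) ^ R`, where `R` is the number of these trials. -/
theorem machine_guarantee_pow {I : Input} {p L ℓ q₀ : ℕ} (hset : Setting I p L ℓ)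
    (hq₀ : q₀ < I.n ^ (I.k - 2)) {σ : ℝ} (hσ : σ ≤ I.trialProb p L ℓ q₀) :
    Guarantee machine I (41 * Nat.size I.cap) I.Good (initial machine)
      (runningTime I.k I.n L ℓ) (1 - (1 - σ) ^ (I.n ^ 2 / ℓ ^ 2 + 1)) := by
  set R := I.n ^ 2 / ℓ ^ 2 + 1 with hR
  have hRpos : 0 < R := Nat.succ_pos _
  have hσ1 : σ ≤ 1 := hσ.trans (trialProb_le_one _ _ _ _ _)
  -- The number of trials from number `c` on that belong to the block of `q₀`; trials of other
  -- blocks are not relied upon.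
  set rem : ℕ → ℕ := fun c => (q₀ + 1) * R - max c (q₀ * R) with hrem
  have hQ : (q₀ + 1) * R ≤ R * I.n ^ (I.k - 2) := by
    rw [mul_comm R]; exact Nat.mul_le_mul_right _ hq₀
  have hpow : ∀ r, 0 ≤ (1 - σ) ^ r := fun r => pow_nonneg (by linarith) _
  have key := machine_guarantee hset (fun c => 1 - (1 - σ) ^ rem c)
    (fun c => by linarith [hpow (rem c)]) ?_ ?_
  · have e : rem 0 = R := by
      simp only [hrem, add_mul, one_mul]; omega
    rwa [e] at key
  · have e : rem (R * I.n ^ (I.k - 2)) = 0 := by simp only [hrem]; omega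
    rw [← hR, e]; simp
  · intro c hc
    rw [← hR]
    by_cases h : c / R = q₀
    · rw [h]
      have h1 : q₀ * R ≤ c := by rw [← h]; exact Nat.div_mul_le_self _ _
      have h2 : c < (q₀ + 1) * R := (Nat.div_lt_iff_lt_mul hRpos).1 (by omega)
      have e : rem c = rem (c + 1) + 1 := by simp only [hrem]; omega
      rw [e, pow_succ]
      nlinarith [hpow (rem (c + 1))]
    · have e : rem c = rem (c + 1) := by
        rcases lt_or_gt_of_ne h with h' | h'
        · have := (Nat.div_lt_iff_lt_mul hRpos).1 h'
          simp only [hrem]; omega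
        · have := (Nat.le_div_iff_mul_le hRpos).1 h'
          rw [Nat.succ_mul] at this
          simp only [hrem, add_mul, one_mul]; omega
      rw [e]
      have h1 := trialProb_nonneg I p L ℓ (c / R)
      nlinarith [hpow (rem (c + 1))]

theorem exists_digits {n : ℕ} (hn : 0 < n) (K : ℕ) (d : ℕ → ℕ) (hd : ∀ i, d i < n) :
    ∃ q < n ^ K, ∀ i < K, q / n ^ i % n = d i := by
  induction K generalizing d with
  | zero => exact ⟨0, by simp, fun i hi => by omega⟩
  | succ K ih =>
    obtain ⟨q, hq, h⟩ := ih (fun i => d (i + 1)) fun i => hd _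
    refine ⟨d 0 + n * q, ?_, fun i hi => ?_⟩
    · calc d 0 + n * q < n * (q + 1) := by rw [mul_add]; have := hd 0; omega
        _ ≤ n * n ^ K := Nat.mul_le_mul_left _ hq
        _ = _ := by ring
    · cases i with
      | zero => rw [pow_zero, Nat.div_one, Nat.add_mul_mod_self_left, Nat.mod_eq_of_lt (hd 0)]
      | succ i =>
        rw [pow_succ', ← Nat.div_div_eq_div_mul, Nat.add_mul_div_left _ _ hn,
          Nat.div_eq_of_lt (hd 0), zero_add]
        exact h i (by omega)

/-- A solution, in terms of two positions and a code of the other positions. -/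
theorem exists_positions {k n m : ℕ} (hk : 2 ≤ k) (hn : 0 < n) {w : Lists k n m} {t : ℕ}
    (h : Solvable w t) : ∃ q < n ^ (k - 2), ∃ i j : Fin n,
      value w ⟨0, by omega⟩ i + value w ⟨1, by omega⟩ j + (⟨k, n, m, w, t⟩ : Input).rest q = t := by
  obtain ⟨s, hs, hsum⟩ := h
  choose pos hpos using hs
  obtain ⟨k, rfl⟩ : ∃ k', k = k' + 2 := ⟨k - 2, by omega⟩
  obtain ⟨q, hq, hd⟩ := exists_digits hn k
    (fun i => if h : i < k then (pos ⟨i + 2, by omega⟩ : ℕ) else 0) fun i => by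
      split_ifs
      · exact (pos _).2
      · exact hn
  refine ⟨q, hq, pos 0, pos 1, ?_⟩
  rw [Fin.sum_univ_succ, Fin.sum_univ_succ, ← add_assoc, hpos 0, hpos (Fin.succ 0)] at hsum
  refine Eq.trans ?_ hsum
  congr 1
  have e1 : k + 2 - 2 = k := rfl
  simp only [Input.rest, e1]
  rw [← Fin.sum_univ_eq_sum_range (fun i => (⟨k + 2, n, m, w, t⟩ : Input).read (2 + i)
    (q / n ^ i % n))]
  refine sum_congr rfl fun i _ => ?_
  rw [hd i i.2, dif_pos i.2, hpos]
  have hi : 2 + (i : ℕ) < k + 2 := by omega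
  simp only [Input.read, hi, Fin.is_lt, and_self, dif_pos, Fin.eta]
  have e2 : (⟨2 + i, hi⟩ : Fin (k + 2)) = i.succ.succ := Fin.ext (by simp; omega)
  have e3 : (⟨(i : ℕ) + 2, by omega⟩ : Fin (k + 2)) = i.succ.succ := rfl
  rw [e2, e3]

/-! ### The bounds on time and memory -/

theorem nat_le_log_of_two_pow_le {a n : ℕ} (hn : 1 ≤ n) (h : 2 ^ a ≤ 8 * n) :
    (a : ℝ) ≤ 3 * (1 + Real.log n) := by
  have hn0 : (0 : ℝ) < n := by exact_mod_cast hn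
  have h1 : (2 : ℝ) ^ a ≤ 2 ^ 3 * n := by norm_num; exact_mod_cast h
  have h2 := Real.log_le_log (by positivity) h1
  rw [Real.log_pow, Real.log_mul (by norm_num) hn0.ne', Real.log_pow] at h2
  have h3 := Real.log_two_gt_d9
  have h4 : 0 ≤ Real.log n := Real.log_nonneg (by exact_mod_cast hn)
  push_cast at h2
  have h5 : ((a : ℝ) - 3) * Real.log 2 ≤ Real.log n := by linarith
  by_contra h6
  rw [not_le] at h6
  have : 3 * Real.log n < (a : ℝ) - 3 := by linarith
  nlinarith

theorem rpow_sub_half {k n : ℕ} (hk : 2 ≤ k) (hn : 1 ≤ n) :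
    (n : ℝ) ^ ((k : ℝ) - 1 / 2) = (n : ℝ) ^ (k - 2) * (n * Real.sqrt n) := by
  have hn0 : (0 : ℝ) < n := by exact_mod_cast hn
  have e : (k : ℝ) - 1 / 2 = ((k - 2 : ℕ) : ℝ) + (1 + 1 / 2) := by
    rw [Nat.cast_sub hk]; push_cast; ring
  rw [e, Real.rpow_add hn0, Real.rpow_add hn0, Real.rpow_natCast, Real.rpow_one,
    Real.sqrt_eq_rpow]

/-- The choice of `ℓ` gives `√n ≤ 2 * ℓ * L`. So about `n ^ 2 / ℓ ^ 2` trials with `O(ℓ * L)` steps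
each, for fixed `k`, take `n * √n` times `L ^ 2`, where `L` is logarithmic in `n`. The factor `n ^
(k - 2)` counts the choices of positions. -/
theorem runningTime_le {I : Input} {p L ℓ : ℕ} (hset : Setting I p L ℓ) :
    (runningTime I.k I.n L ℓ : ℝ) ≤ (2000 * I.k + 20000 : ℕ) * (I.n : ℝ) ^ ((I.k : ℝ) - 1 / 2) *
      (1 + Real.log I.n) ^ 2 := by
  obtain ⟨k, n, m, w, t⟩ := I
  have hk : 2 ≤ k := hset.two_le_k
  have hn : 1 ≤ n := hset.n_pos
  have hL := hset.one_le_L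
  have hℓ := hset.two_le_len
  have hℓn : ℓ ^ 2 ≤ 4 * n := hset.len_sq_le
  have hlen : n ≤ ((ℓ + 1) * L) ^ 2 := hset.le_len
  have hpw : 2 ^ L ≤ 8 * n := by
    have := hset.pow_lt; have : p ≤ 4 * n := hset.p_le; omega
  clear hset
  rw [rpow_sub_half hk hn]
  have hlog := nat_le_log_of_two_pow_le hn hpw
  have hlg : 1 ≤ 1 + Real.log n := by
    have := Real.log_nonneg (by exact_mod_cast hn : (1 : ℝ) ≤ n); linarith
  set lg := 1 + Real.log n
  set r := Real.sqrt n with hr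
  have hr2 : r * r = n := Real.mul_self_sqrt (Nat.cast_nonneg n)
  have hr1 : 1 ≤ r := Real.one_le_sqrt.2 (by exact_mod_cast hn)
  have hn1 : (1 : ℝ) ≤ n := by exact_mod_cast hn
  have hL1 : (1 : ℝ) ≤ L := by exact_mod_cast hL
  have hℓ2 : (2 : ℝ) ≤ ℓ := by exact_mod_cast hℓ
  have hk2 : (2 : ℝ) ≤ k := by exact_mod_cast hk
  set N := (n : ℝ) ^ (k - 2) with hN
  have hN1 : 1 ≤ N := one_le_pow₀ hn1
  have hrℓ : r ≤ 2 * (ℓ * L) := by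
    refine Real.sqrt_le_iff.2 ⟨by positivity, ?_⟩
    have h1 : (n : ℝ) ≤ ((ℓ + 1) * L) ^ 2 := by exact_mod_cast hlen
    refine h1.trans (pow_le_pow_left₀ (by positivity) ?_ 2)
    nlinarith
  have hprep : ((2 * n * (Nat.sqrt (4 * n) * 8 + 11) + 4 * Nat.clog 2 (4 * n) + 6 * n + 4 * k + 32 :
      ℕ) : ℝ) ≤ (4 * k + 110) * (n * r) := by
    have h1 : ((Nat.sqrt (4 * n) : ℕ) : ℝ) ≤ 2 * r := by
      refine (Real.nat_sqrt_le_real_sqrt).trans ?_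
      push_cast
      rw [Real.sqrt_mul (by norm_num), show (4 : ℝ) = 2 ^ 2 by norm_num,
        Real.sqrt_sq (by norm_num)]
    have h2 : ((Nat.clog 2 (4 * n) : ℕ) : ℝ) ≤ 4 * n := by
      have : Nat.clog 2 (4 * n) ≤ 4 * n :=
        Nat.clog_le_of_le_pow (Nat.lt_two_pow_self).le
      exact_mod_cast this
    push_cast
    have h3 : (n : ℝ) ≤ n * r := by nlinarith
    nlinarith
  have hmain : ((n ^ 2 / ℓ ^ 2 + 1 : ℕ) : ℝ) * (ℓ * L) ≤ 90 * (n * r) * lg ^ 2 := by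
    have h1 : ((n ^ 2 / ℓ ^ 2 : ℕ) : ℝ) ≤ (n : ℝ) ^ 2 / ℓ ^ 2 := by
      refine Nat.cast_div_le.trans ?_
      push_cast; exact le_rfl
    have hℓpos : (0 : ℝ) < ℓ ^ 2 := by positivity
    have h2 : (1 : ℝ) ≤ 4 * (n : ℝ) ^ 2 / ℓ ^ 2 := by
      rw [one_le_div hℓpos]
      have : (ℓ : ℝ) ^ 2 ≤ 4 * n := by exact_mod_cast hℓn
      nlinarith
    have h3 : ((n ^ 2 / ℓ ^ 2 + 1 : ℕ) : ℝ) ≤ 5 * (n : ℝ) ^ 2 / ℓ ^ 2 := by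
      push_cast
      have : 5 * (n : ℝ) ^ 2 / ℓ ^ 2 = (n : ℝ) ^ 2 / ℓ ^ 2 + 4 * (n : ℝ) ^ 2 / ℓ ^ 2 := by ring
      linarith
    have h4 : ((n ^ 2 / ℓ ^ 2 + 1 : ℕ) : ℝ) * (ℓ * L) ≤ 5 * (n : ℝ) ^ 2 * L / ℓ := by
      refine (mul_le_mul_of_nonneg_right h3 (by positivity)).trans (le_of_eq ?_)
      field_simp
    refine h4.trans ?_
    rw [div_le_iff₀ (by positivity)]
    have h5 : (L : ℝ) ^ 2 ≤ 9 * lg ^ 2 := by nlinarith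
    calc 5 * (n : ℝ) ^ 2 * L = 5 * (n * r) * r * L := by rw [← hr2]; ring
      _ ≤ 5 * (n * r) * (2 * (ℓ * L)) * L := by gcongr
      _ = 10 * (n * r) * ℓ * L ^ 2 := by ring
      _ ≤ 10 * (n * r) * ℓ * (9 * lg ^ 2) := by gcongr
      _ = _ := by ring
  have hbody : ((105 * ℓ + 24 * L + 14 * k + 53 : ℕ) : ℝ) ≤ (182 + 14 * k) * (ℓ * L) := by
    push_cast
    have h1 : (ℓ : ℝ) ≤ ℓ * L := by nlinarith
    have h2 : (L : ℝ) ≤ ℓ * L := by nlinarith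
    nlinarith
  have hlg2 : 1 ≤ lg ^ 2 := one_le_pow₀ hlg
  have hnr : 1 ≤ n * r := by nlinarith
  have hNnr : n * r ≤ N * (n * r) := by nlinarith
  calc (runningTime k n L ℓ : ℝ)
      = ((2 * n * (Nat.sqrt (4 * n) * 8 + 11) + 4 * Nat.clog 2 (4 * n) + 6 * n + 4 * k + 32 : ℕ) : ℝ)
        + (((n ^ 2 / ℓ ^ 2 + 1 : ℕ) : ℝ) * N *
          ((105 * ℓ + 24 * L + 14 * k + 53 : ℕ) : ℝ) + 2) := by
        rw [runningTime, hN]; push_cast; ring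
    _ ≤ (4 * k + 110) * (n * r) + (((n ^ 2 / ℓ ^ 2 + 1 : ℕ) : ℝ) * N *
          ((182 + 14 * k) * (ℓ * L)) + 2) := by gcongr
    _ = (4 * k + 110) * (n * r) + (N * (182 + 14 * k) *
          (((n ^ 2 / ℓ ^ 2 + 1 : ℕ) : ℝ) * (ℓ * L)) + 2) := by ring
    _ ≤ (4 * k + 110) * (n * r) + (N * (182 + 14 * k) * (90 * (n * r) * lg ^ 2) + 2) := by gcongr
    _ ≤ (4 * k + 110) * (N * (n * r) * lg ^ 2) + ((182 + 14 * k) * 90 * (N * (n * r) * lg ^ 2) +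
          2 * (N * (n * r) * lg ^ 2)) := by
        have h1 : N * (n * r) ≤ N * (n * r) * lg ^ 2 := le_mul_of_one_le_right (by positivity) hlg2
        have h2 : n * r ≤ N * (n * r) * lg ^ 2 := hNnr.trans h1
        have h3 : 1 ≤ N * (n * r) * lg ^ 2 := hnr.trans h2
        have h4 : N * (182 + 14 * k) * (90 * (n * r) * lg ^ 2) =
          (182 + 14 * k) * 90 * (N * (n * r) * lg ^ 2) := by ring
        rw [h4]
        gcongr
        linarith
    _ ≤ (2000 * k + 20000) * (N * (n * r) * lg ^ 2) := by
        have h0 : 0 ≤ N * (n * r) * lg ^ 2 := by positivity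
        nlinarith
    _ = _ := by push_cast; ring

theorem size_cap_le {I : Input} (hI : I.Valid) {A D : ℕ} (hm : I.m ≤ A * I.n ^ D) :
    (Nat.size I.cap : ℝ) ≤
      (65540 + 4 * (I.k * A) + 3 * (4 + I.k + D) : ℕ) * (1 + Real.log I.n) := by
  obtain ⟨k, n, m, w, t⟩ := I
  have hn : 1 ≤ n := hI.n_pos
  change m ≤ A * n ^ D at hm
  set W := 65540 + 4 * (k * A) with hW
  set E := 4 + k + D with hE
  have hpow : ∀ i ≤ E, n ^ i ≤ n ^ E := fun i hi => Nat.pow_le_pow_right hn hi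
  have hcap : Input.cap ⟨k, n, m, w, t⟩ ≤ W * n ^ E := by
    unfold Input.cap
    change 65536 * n ^ 4 + 4 * n ^ k + 4 * (k * m) ≤ _
    calc 65536 * n ^ 4 + 4 * n ^ k + 4 * (k * m)
        ≤ 65536 * n ^ E + 4 * n ^ E + 4 * (k * (A * n ^ E)) := by
          have h1 := hpow 4 (by omega)
          have h2 := hpow k (by omega)
          have h3 : m ≤ A * n ^ E := hm.trans (Nat.mul_le_mul_left _ (hpow D (by omega)))
          gcongr
      _ = W * n ^ E := by rw [hW]; ring
  clear_value W E
  have hsize : Nat.size (Input.cap ⟨k, n, m, w, t⟩) ≤ W + E * Nat.size n := by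
    rw [Nat.size_le]
    calc Input.cap ⟨k, n, m, w, t⟩ ≤ W * n ^ E := hcap
      _ < 2 ^ W * n ^ E := Nat.mul_lt_mul_of_pos_right Nat.lt_two_pow_self (by positivity)
      _ ≤ 2 ^ W * (2 ^ Nat.size n) ^ E :=
        Nat.mul_le_mul_left _ (Nat.pow_le_pow_left (Nat.lt_size_self n).le _)
      _ = _ := by rw [pow_add, mul_comm E, pow_mul]
  have hn2 : 2 ^ Nat.size n ≤ 8 * n := by
    have h0 : 0 < Nat.size n := Nat.size_pos.2 hn
    have h1 : 2 ^ (Nat.size n - 1) ≤ n := Nat.lt_size.1 (by omega)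
    obtain ⟨a, ha⟩ : ∃ a, Nat.size n = a + 1 := ⟨Nat.size n - 1, by omega⟩
    rw [ha] at h1 ⊢
    rw [pow_succ]; simp at h1; omega
  have h1 := nat_le_log_of_two_pow_le hn hn2
  have hlg : 0 ≤ Real.log n := Real.log_nonneg (by exact_mod_cast hn)
  calc (Nat.size (Input.cap ⟨k, n, m, w, t⟩) : ℝ) ≤ (W + E * Nat.size n : ℕ) := by
        exact_mod_cast hsize
    _ = W + E * (Nat.size n : ℝ) := by push_cast; ring
    _ ≤ W * (1 + Real.log n) + E * (3 * (1 + Real.log n)) := by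
        gcongr
        have : (0 : ℝ) ≤ W := Nat.cast_nonneg _
        nlinarith
    _ = _ := by push_cast; ring

/-! ### The probability of success -/

theorem successProb_eq (M : Machine) (k n m T : ℕ) (τ : Lists k n m → ℕ) :
    successProb M k n m T τ = 𝔼 w : Lists k n m, 𝔼 coins : Fin T → Bool,
      ind (Solvable w (τ w) → Finds M w (τ w) coins) := by
  classical
  rw [successProb, Nat.card_eq_fintype_card, Nat.card_eq_fintype_card, Fintype.card_subtype,
    Fintype.card_prod, Fintype.expect_eq_sum_div_card]
  simp only [Fintype.expect_eq_sum_div_card]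
  rw [← sum_div, div_div, ← Nat.cast_mul, mul_comm (Fintype.card (Fin T → Bool))]
  congr 1
  rw [← Fintype.sum_prod_type', card_filter, Nat.cast_sum]
  refine sum_congr rfl fun x _ => ?_
  simp only [ind]
  split_ifs <;> simp

/-- At least half of the lists are good for all offsets simultaneously, whatever target the
adversary picks. For good lists, each of the more than `n ^ 2 / ℓ ^ 2` trials at the positions of a
solution succeeds with probability at least `σ = ρ / 16 * (ℓ ^ 2 / n ^ 2)`, so all of them fail with
probability at most `exp (-(ρ / 16))`. -/
theorem le_successProb {k n m : ℕ} (hk : 2 ≤ k) (hn : 0 < n) (hm : 0 < m) (hnm : n ∣ m)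
    {p L ℓ : ℕ} [Fact p.Prime] {ρ : ℝ} (hρ : 0 < ρ)
    (hset : ∀ (w : Lists k n m) t, t ≤ k * m → Setting ⟨k, n, m, w, t⟩ p L ℓ)
    (hgood : 1 / 2 ≤ 𝔼 w : Lists k n m, ind (∀ B, m ≤ B → ∀ i j,
      ρ * ((ℓ : ℝ) ^ 2 / n ^ 2) ≤ hitProb hk hn w p ℓ B i j))
    (τ : Lists k n m → ℕ) (hτ : ∀ w, τ w ≤ k * m) {T : ℕ} (hT : runningTime k n L ℓ ≤ T) :
    (1 - Real.exp (-(ρ / 16))) / 2 ≤ successProb machine k n m T τ := by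
  have hc : 0 ≤ 1 - Real.exp (-(ρ / 16)) := by
    rw [sub_nonneg, Real.exp_le_one_iff]; linarith
  have hn0 : (0 : ℝ) < n := by exact_mod_cast hn
  rw [successProb_eq]
  calc (1 - Real.exp (-(ρ / 16))) / 2 = (1 - Real.exp (-(ρ / 16))) * (1 / 2) := by ring
    _ ≤ (1 - Real.exp (-(ρ / 16))) * 𝔼 w : Lists k n m, ind (∀ B, m ≤ B → ∀ i j,
      ρ * ((ℓ : ℝ) ^ 2 / n ^ 2) ≤ hitProb hk hn w p ℓ B i j) :=
      mul_le_mul_of_nonneg_left hgood hc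
    _ = 𝔼 w : Lists k n m, (1 - Real.exp (-(ρ / 16))) * ind (∀ B, m ≤ B → ∀ i j,
      ρ * ((ℓ : ℝ) ^ 2 / n ^ 2) ≤ hitProb hk hn w p ℓ B i j) := by rw [mul_expect]
    _ ≤ _ := expect_le_expect fun w _ => ?_
  by_cases hw : ∀ B, m ≤ B → ∀ i j, ρ * ((ℓ : ℝ) ^ 2 / n ^ 2) ≤ hitProb hk hn w p ℓ B i j
  swap
  · rw [ind_false hw, mul_zero]
    exact expect_nonneg fun _ _ => ind_nonneg _
  rw [ind_true hw, mul_one]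
  -- Without a solution the event holds trivially.
  by_cases hsol : Solvable w (τ w)
  swap
  · simp only [ind_true (fun h => absurd h hsol : Solvable w (τ w) → _)]
    rw [expect_const univ_nonempty]
    linarith [Real.exp_pos (-(ρ / 16))]
  have hs := hset w (τ w) (hτ w)
  obtain ⟨q, hq, i, j, hij⟩ := exists_positions hk hn hsol
  set I : Input := ⟨k, n, m, w, τ w⟩ with hI
  have hℓ0 : (0 : ℝ) < ℓ := by have := hs.two_le_len; exact_mod_cast (by omega : 0 < ℓ)
  -- At most `(k - 2) * m` is subtracted from `k * m + τ w`, so the offset is in the range covered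
  -- by the good lists.
  have hB : m ≤ k * m + τ w - I.rest q := by
    have h1 : I.rest q ≤ (k - 2) * m := I.rest_le q
    have h2 : (k - 2) * m + 2 * m = k * m := by rw [← add_mul, Nat.sub_add_cancel hk]
    omega
  have hprob : ρ / 16 * ((ℓ : ℝ) ^ 2 / n ^ 2) ≤ I.trialProb p L ℓ q := by
    refine le_trans ?_ (hitProb_le_trialProb hk hn w hnm hs.p_le_pow hs.pow_lt i j hij)
    have := hw _ hB i j
    linarith
  set σ := ρ / 16 * ((ℓ : ℝ) ^ 2 / n ^ 2) with hσ
  have hσ0 : 0 ≤ σ := by positivity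
  have hσ1 : σ ≤ 1 := hprob.trans (trialProb_le_one _ _ _ _ _)
  have hpow : (1 - σ) ^ (n ^ 2 / ℓ ^ 2 + 1) ≤ Real.exp (-(ρ / 16)) := by
    have h1 : 1 - σ ≤ Real.exp (-σ) := by have := Real.add_one_le_exp (-σ); linarith
    refine (pow_le_pow_left₀ (by linarith) h1 _).trans ?_
    rw [← Real.exp_nat_mul, Real.exp_le_exp]
    have h2 : (n : ℝ) ^ 2 / ℓ ^ 2 ≤ ((n ^ 2 / ℓ ^ 2 + 1 : ℕ) : ℝ) := by
      have h3 : n ^ 2 < ℓ ^ 2 * (n ^ 2 / ℓ ^ 2 + 1) :=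
        Nat.lt_mul_div_succ _ (by have := hs.two_le_len; positivity)
      rw [div_le_iff₀ (by positivity)]
      have h4 : ((n ^ 2 : ℕ) : ℝ) ≤ ((ℓ ^ 2 * (n ^ 2 / ℓ ^ 2 + 1) : ℕ) : ℝ) := by
        exact_mod_cast h3.le
      rw [Nat.cast_mul (ℓ ^ 2), mul_comm] at h4
      simpa using h4
    have h5 : ρ / 16 = (n : ℝ) ^ 2 / ℓ ^ 2 * σ := by rw [hσ]; field_simp
    have h6 := mul_le_mul_of_nonneg_right h2 hσ0
    rw [← h5] at h6
    linarith
  have hguar := ((machine_guarantee_pow hs hq hprob).mono hT le_rfl).le_expect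
  calc 1 - Real.exp (-(ρ / 16)) ≤ 1 - (1 - σ) ^ (n ^ 2 / ℓ ^ 2 + 1) := by linarith
    _ ≤ _ := hguar
    _ ≤ _ := expect_le_expect fun coins _ => ind_mono ?_
  rintro ⟨s, hs1, hs2⟩ -
  refine ⟨s, ?_, hs2⟩
  rw [run_eq_runFrom]
  exact hs1

end KSum
theorem theorem4 :
    ∃ M : KSum.Machine, ∀ k : ℕ, 2 ≤ k →
      ∃ c : ℝ, 0 < c ∧ ∀ A D : ℕ, ∃ C e : ℕ, ∀ n m : ℕ,
        1 ≤ n → n ≤ m → m ≤ A * n ^ D → n ∣ m →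
        ∃ T S : ℕ,
          (T : ℝ) ≤ C * (n : ℝ) ^ ((k : ℝ) - 1 / 2) * (1 + Real.log n) ^ e ∧
          (S : ℝ) ≤ C * (1 + Real.log n) ∧
          (∀ (w : KSum.Lists k n m) (t : ℕ), t ≤ k * m →
            KSum.RunsWithin M ⟨k, n, m, w, t⟩ T S) ∧
          ∀ τ : KSum.Lists k n m → ℕ, (∀ w, τ w ≤ k * m) →
            c ≤ KSum.successProb M k n m T τ := by
  obtain ⟨ρ, hρ, hmain⟩ := KSum.exists_hitProb_ge
  refine ⟨KSum.machine, fun k hk => ⟨(1 - Real.exp (-(ρ / 16))) / 2, ?_, fun A D =>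
    ⟨(2000 * k + 20000) + 41 * (65540 + 4 * (k * A) + 3 * (4 + k + D)), 2,
      fun n m hn hnm hm hdvd => ?_⟩⟩⟩
  · have : Real.exp (-(ρ / 16)) < 1 := Real.exp_lt_one_iff.2 (by linarith)
    linarith
  have hm0 : 0 < m := by omega
  have hvalid : ∀ (w : KSum.Lists k n m) (t : ℕ), t ≤ k * m →
      KSum.Input.Valid ⟨k, n, m, w, t⟩ := fun w t ht => ⟨hk, hn, hm0, ht⟩
  have hv₀ := hvalid (fun _ _ => ⟨0, hm0⟩) 0 (Nat.zero_le _)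
  obtain ⟨p, L, ℓ, hset₀⟩ := KSum.Setting.exists_of_valid hv₀
  have hset : ∀ (w : KSum.Lists k n m) (t : ℕ), t ≤ k * m →
      KSum.Setting ⟨k, n, m, w, t⟩ p L ℓ := fun w t ht => hset₀.transfer (hvalid w t ht) rfl
  have : Fact p.Prime := ⟨hset₀.prime⟩
  have hlog : 0 ≤ Real.log n := Real.log_nonneg (by exact_mod_cast hn)
  have hcap := KSum.size_cap_le hv₀ hm
  -- The cap depends on `k`, `n` and `m` only, so it may be taken from an arbitrary input with these
  -- parameters.
  refine ⟨KSum.runningTime k n L ℓ, 41 * Nat.size (KSum.Input.cap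
    ⟨k, n, m, fun _ _ => ⟨0, hm0⟩, 0⟩), ?_, ?_, fun w t ht coins => ?_, fun τ hτ => ?_⟩
  · refine (KSum.runningTime_le hset₀).trans ?_
    exact mul_le_mul_of_nonneg_right (mul_le_mul_of_nonneg_right
      (Nat.cast_le.2 (Nat.le_add_right _ _)) (by positivity)) (by positivity)
  · rw [Nat.cast_mul, Nat.cast_add, Nat.cast_mul 41]
    have h0 : (0 : ℝ) ≤ (2000 * k + 20000 : ℕ) := Nat.cast_nonneg _
    nlinarith
  -- With success probability `σ = 0` the guarantee is reduced to halting and memory, which hold for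
  -- all lists.
  · have h := (KSum.machine_guarantee_pow (q₀ := 0) (σ := 0) (hset w t ht) (by positivity)
      (KSum.trialProb_nonneg _ _ _ _ _)).halts coins
    simp only [← KSum.run_eq_runFrom] at h
    exact h
  · exact KSum.le_successProb hk hn hm0 hdvd hρ hset
      (hmain k n m hk hn hm0 hdvd p hset₀.lt_p hset₀.p_le L ℓ hset₀.p_le_pow hset₀.pow_lt
        hset₀.two_le_len hset₀.len_lt hset₀.le_len) τ hτ le_rfl
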